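/- Fix $d$ and write points of phase space $\mathbb R^{2d}=\mathbb R^d\times\mathbb R^d$ as $z=(x,\xi)$, with symplectic form $\sigma((x,\xi),(x',\xi'))=x'\cdot\xi-x\cdot\xi'$. The symplectic Fourier transform is $\mathcal F_\sigma a(w)=\int_{\mathbb R^{2d}}a(z)e^{-2\pi i\sigma(w,z)}\,dz$, extended by duality to tempered distributions. For $u\in\mathcal S'(\mathbb R^{2d})$ let $\rho(u):\mathcal S(\mathbb R^d)\to\mathcal S'(\mathbb R^d)$ be the operator with Schwartz kernel $k_u(t,x)=(\mathcal F^{\xi}u)\big(t-x,-\tfrac{t+x}2\big)$, where $\mathcal F^\xi$ is the partial Fourier transform $\mathcal F^{\xi}u(x,\eta)=\int u(x,\xi)e^{-2\pi i\xi\cdot\eta}\,d\xi$ in the second variable (formally $\rho(u)=\int u(z)\rho(z)\,dz$ with $[\rho(x,\xi)g](t)=e^{-\pi i x\cdot\xi+2\pi i t\cdot\xi}g(t-x)$). The Weyl quantization of $a\in\mathcal S'(\mathbb R^{2d})$ is $L_a:=\rho(\mathcal F_\sigma a)$. For a bounded operator $T$ on $L^2(\mathbb R^d)$ put $\|T\|_{\mathcal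 S^p}=\big(\operatorname{tr}\,(T^*T)^{p/2}\big)^{1/p}\in[0,\infty]$ if $1\le p<\infty$, and let $\|T\|_{\mathcal S^\infty}$ be the operator norm. If $L_a$ extends to a bounded operator $T$ on $L^2(\mathbb R^d)$, put $\|L_a\|_{\mathcal S^p}:=\|T\|_{\mathcal S^p}$; otherwise $\|L_a\|_{\mathcal S^p}:=\infty$. Likewise $\|b\|_{L^p(\mathbb R^{2d})}:=\infty$ if the tempered distribution $b$ is not given by an $L^p$ function. **Theorem.** There is a constant $C>0$, depending only on $d$, such that the following holds. If $u$ is a compactly supported distribution on $\mathbb R^{2d}$ whose support is contained in a closed (Euclidean) ball $\overline{B(z_0,R)}$ with $z_0\in\mathbb R^{2d}$ and $R\ge 1$, then for every $1\le p\le\infty$ $$\|L_{\mathcal F_\sigma u}\|_{\mathcal S^p}\le C\,R^{5d+2}\,\|\mathcal F_\sigma u\|_{L^p(\mathbb R^{2d})},$$ and, conversely, $$\|\mathcal F_\sigma u\|_{L^p(\mathbb R^{2d})}\le C\,R^{5d+2}\,\|L_{\mathcal F_\sigma u}\|_{\mathcal S^p}.$$ -/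

import Mathlib

open MeasureTheory SchwartzMap
open scoped ENNReal NNReal FourierTransform RealInnerProductSpace

noncomputable section
set_option linter.unusedSectionVars false
namespace Weyl

section PartialFourier

variable {X Y : Type} [NormedAddCommGroup X] [NormedSpace ℝ X]
  [NormedAddCommGroup Y] [InnerProductSpace ℝ Y] [FiniteDimensional ℝ Y]
  [MeasurableSpace Y] [BorelSpace Y]

/-- The function `(y, η) ↦ ∫ Φ(y, s) e^{-2πi⟨s, η⟩} ds`. -/
def partialFourierFun {F : Type} [NormedAddCommGroup F] [NormedSpace ℂ F]
    (Φ : 𝓢(X × Y, F)) (z : X × Y) : F :=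
  ∫ s : Y, 𝐞 (-⟪s, z.2⟫) • Φ (z.1, s)

theorem slice_iteratedFDeriv_le {F : Type} [NormedAddCommGroup F] [NormedSpace ℂ F]
    (Φ : 𝓢(X × Y, F)) (x : X) (n : ℕ) (s : Y) :
    ‖iteratedFDeriv ℝ n (fun s : Y => Φ (x, s)) s‖ ≤ ‖iteratedFDeriv ℝ n Φ (x, s)‖ := by
  have h1 : (fun s : Y => Φ (x, s)) =
      (fun z : X × Y => Φ ((x, 0) + z)) ∘ (ContinuousLinearMap.inr ℝ X Y) := by
    ext s; simp
  have h2 : ContDiff ℝ n (fun z : X × Y => Φ ((x, 0) + z)) :=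
    (Φ.smooth n).comp (contDiff_const.add contDiff_id)
  rw [h1, ContinuousLinearMap.iteratedFDeriv_comp_right _ h2 s le_rfl,
    iteratedFDeriv_comp_add_left]
  refine (ContinuousMultilinearMap.norm_compContinuousLinearMap_le _ _).trans ?_
  have h3 : ‖ContinuousLinearMap.inr ℝ X Y‖ ≤ 1 := ContinuousLinearMap.norm_inr_le_one ℝ X Y
  have h4 : ∏ _i : Fin n, ‖ContinuousLinearMap.inr ℝ X Y‖ ≤ 1 :=
    Finset.prod_le_one (fun _ _ => by positivity) (fun _ _ => h3)
  simpa using mul_le_of_le_one_right (norm_nonneg _) h4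

theorem slice_bound {F : Type} [NormedAddCommGroup F] [NormedSpace ℂ F]
    (Φ : 𝓢(X × Y, F)) (k l n : ℕ) (x : X) (s : Y) :
    ‖x‖ ^ k * (‖s‖ ^ l * ‖iteratedFDeriv ℝ n (fun s : Y => Φ (x, s)) s‖) ≤
      SchwartzMap.seminorm ℂ (k + l) n Φ := by
  refine le_trans ?_ (Φ.le_seminorm ℂ (k + l) n (x, s))
  rw [pow_add, mul_assoc]
  gcongr
  · exact norm_fst_le (x, s)
  · exact norm_snd_le (x, s)
  · exact slice_iteratedFDeriv_le Φ x n s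

theorem slice_smooth {F : Type} [NormedAddCommGroup F] [NormedSpace ℂ F]
    (Φ : 𝓢(X × Y, F)) (x : X) (N : ℕ∞) : ContDiff ℝ N (fun s : Y => Φ (x, s)) :=
  (Φ.smooth N).comp (contDiff_const.prodMk contDiff_id)

theorem slice_integrable {F : Type} [NormedAddCommGroup F] [NormedSpace ℂ F]
    (Φ : 𝓢(X × Y, F)) (x : X) (k n : ℕ) :
    Integrable (fun s : Y => ‖s‖ ^ k * ‖iteratedFDeriv ℝ n (fun s : Y => Φ (x, s)) s‖) := by
  refine integrable_of_le_of_pow_mul_le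
    (C₁ := SchwartzMap.seminorm ℂ 0 n Φ)
    (C₂ := SchwartzMap.seminorm ℂ (k + (volume : Measure Y).integrablePower) n Φ) ?_ ?_ ?_
  · intro s; simpa using slice_bound Φ 0 0 n x s
  · intro s
    simpa using slice_bound Φ 0 (k + (volume : Measure Y).integrablePower) n x s
  · exact ((slice_smooth Φ x n).continuous_iteratedFDeriv le_rfl).aestronglyMeasurable

theorem slice_integral_le {F : Type} [NormedAddCommGroup F] [NormedSpace ℂ F]
    (Φ : 𝓢(X × Y, F)) (m l n : ℕ) (x : X) :
    ‖x‖ ^ m * ∫ s : Y, ‖s‖ ^ l * ‖iteratedFDeriv ℝ n (fun s : Y => Φ (x, s)) s‖ ≤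
      2 ^ (volume : Measure Y).integrablePower *
        (∫ s : Y, (1 + ‖s‖) ^ (-((volume : Measure Y).integrablePower : ℝ))) *
      (SchwartzMap.seminorm ℂ m n Φ +
        SchwartzMap.seminorm ℂ (m + (l + (volume : Measure Y).integrablePower)) n Φ) := by
  have := integral_pow_mul_le_of_le_of_pow_mul_le (μ := (volume : Measure Y))
    (f := fun s : Y => ‖x‖ ^ m * ‖iteratedFDeriv ℝ n (fun s : Y => Φ (x, s)) s‖) (k := l)
    (C₁ := SchwartzMap.seminorm ℂ m n Φ)
    (C₂ := SchwartzMap.seminorm ℂ (m + (l + (volume : Measure Y).integrablePower)) n Φ)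
    (fun s => by simpa using slice_bound Φ m 0 n x s)
    (fun s => by
      have := slice_bound Φ m (l + (volume : Measure Y).integrablePower) n x s
      rw [norm_mul, norm_pow, norm_norm, norm_norm]
      calc _ = _ := by ring
        _ ≤ _ := this)
  rw [← integral_const_mul]
  refine le_trans (le_of_eq ?_) this
  congr 1; ext s
  rw [norm_mul, norm_pow, norm_norm, norm_norm]; ring

theorem partialFourierFun_eq {F : Type} [NormedAddCommGroup F] [NormedSpace ℂ F]
    (Φ : 𝓢(X × Y, F)) (x : X) (η : Y) :
    partialFourierFun Φ (x, η) = 𝓕 (fun s : Y => Φ (x, s)) η := by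
  rw [Real.fourier_eq]; rfl

theorem seminorm_sum_apply {V ι : Type} [AddCommGroup V] [Module ℂ V] (t : Finset ι)
    (q : ι → Seminorm ℂ V) (v : V) : (∑ i ∈ t, q i) v = ∑ i ∈ t, q i v := by
  classical
  induction t using Finset.induction_on with
  | empty => simp
  | insert a t ha ih => rw [Finset.sum_insert ha, Finset.sum_insert ha, ← ih]; rfl

/-- Decay of the partial Fourier transform. -/
theorem partialFourierFun_decay (F : Type) [NormedAddCommGroup F] [NormedSpace ℂ F] (k : ℕ) :
    ∃ q : Seminorm ℂ 𝓢(X × Y, F), Continuous q ∧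
      ∀ (Φ : 𝓢(X × Y, F)) (z : X × Y), ‖z‖ ^ k * ‖partialFourierFun Φ z‖ ≤ q Φ := by
  have hc : ∀ a b : ℕ, Continuous (SchwartzMap.seminorm ℂ a b : Seminorm ℂ 𝓢(X × Y, F)) :=
    fun a b => (schwartz_withSeminorms ℂ (X × Y) F).continuous_seminorm (a, b)
  set N := (volume : Measure Y).integrablePower with hN
  set A : ℝ≥0 := ⟨2 ^ N * ∫ s : Y, (1 + ‖s‖) ^ (-(N : ℝ)),
    by positivity⟩ with hA
  set B : ℝ≥0 := (2 * k * 0 + 2) ^ k with hB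
  let q0 : ℕ → ℕ → ℕ → Seminorm ℂ 𝓢(X × Y, F) := fun m l n =>
    A • (SchwartzMap.seminorm ℂ m n + SchwartzMap.seminorm ℂ (m + (l + N)) n)
  have hq0 : ∀ m l n, Continuous (q0 m l n) := fun m l n =>
    ((hc m n).add (hc (m + (l + N)) n)).const_smul A
  have h0 : ∀ (Φ : 𝓢(X × Y, F)) (m l n : ℕ) (x : X),
      ‖x‖ ^ m * ∫ s : Y, ‖s‖ ^ l * ‖iteratedFDeriv ℝ n (fun s : Y => Φ (x, s)) s‖ ≤ q0 m l n Φ :=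
    fun Φ m l n x => slice_integral_le Φ m l n x
  refine ⟨q0 k 0 0 + B • ∑ p ∈ Finset.range (0 + 1) ×ˢ Finset.range (k + 1), q0 0 p.1 p.2,
    ?_, ?_⟩
  · have : Continuous (fun Φ : 𝓢(X × Y, F) => q0 k 0 0 Φ +
        B • ∑ p ∈ Finset.range (0 + 1) ×ˢ Finset.range (k + 1), q0 0 p.1 p.2 Φ) :=
      (hq0 _ _ _).add ((continuous_finsetSum _ fun p _ => hq0 _ _ _).const_smul B)
    convert this using 1
    ext Φ
    simp
  · rintro Φ ⟨x, η⟩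
    have e1 : ‖x‖ ^ k * ‖partialFourierFun Φ (x, η)‖ ≤ q0 k 0 0 Φ := by
      refine le_trans ?_ (h0 Φ k 0 0 x)
      gcongr
      refine (norm_integral_le_integral_norm _).trans (le_of_eq ?_)
      congr 1; ext s; simp [Circle.norm_smul]
    have e2 : ‖η‖ ^ k * ‖partialFourierFun Φ (x, η)‖ ≤
        (B • ∑ p ∈ Finset.range (0 + 1) ×ˢ Finset.range (k + 1), q0 0 p.1 p.2) Φ := by
      rw [partialFourierFun_eq]
      have := Real.pow_mul_norm_iteratedFDeriv_fourier_le (K := ⊤) (N := ⊤) (slice_smooth Φ x ⊤)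
        (fun k n _ _ => slice_integrable Φ x k n) (k := 0) (n := k) le_top le_top η
      rw [norm_iteratedFDeriv_zero] at this
      refine this.trans ?_
      rw [smul_apply, seminorm_sum_apply, NNReal.smul_def, smul_eq_mul, hB]
      push_cast
      have hs : ∑ p ∈ Finset.range (0 + 1) ×ˢ Finset.range (k + 1),
          ∫ s : Y, ‖s‖ ^ p.1 * ‖iteratedFDeriv ℝ p.2 (fun s : Y => Φ (x, s)) s‖ ≤
          ∑ p ∈ Finset.range (0 + 1) ×ˢ Finset.range (k + 1), q0 0 p.1 p.2 Φ :=
        Finset.sum_le_sum fun p _ => by simpa using h0 Φ 0 p.1 p.2 x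
      simpa using mul_le_mul_of_nonneg_left hs (by positivity : (0:ℝ) ≤ 2 ^ k)
    have e3 : ‖(x, η)‖ ^ k ≤ ‖x‖ ^ k + ‖η‖ ^ k := by
      rw [Prod.norm_def]
      rcases max_cases ‖x‖ ‖η‖ with ⟨h, _⟩ | ⟨h, _⟩ <;> rw [h]
      · exact le_add_of_nonneg_right (by positivity)
      · exact le_add_of_nonneg_left (by positivity)
    calc ‖(x, η)‖ ^ k * ‖partialFourierFun Φ (x, η)‖
        ≤ (‖x‖ ^ k + ‖η‖ ^ k) * ‖partialFourierFun Φ (x, η)‖ := by gcongr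
      _ = _ := add_mul _ _ _
      _ ≤ _ := add_le_add e1 e2

/-- Schwartz functions with values in a complex space, real differentiability being understood
with respect to the underlying real structure. -/
abbrev CSchwartz (X Y F : Type) [NormedAddCommGroup X] [NormedSpace ℝ X]
    [NormedAddCommGroup Y] [NormedSpace ℝ Y] [NormedAddCommGroup F] [NormedSpace ℂ F] : Type :=
  𝓢(X × Y, F)

/-- The Schwartz function whose partial Fourier transform is the derivative of that of `Φ`. -/
def partialFourierDeriv (F : Type) [NormedAddCommGroup F] [NormedSpace ℂ F] :
    CSchwartz X Y F →L[ℂ] CSchwartz X Y (X × Y →L[ℝ] F) :=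
  postcompCLM (LinearMap.mkContinuous
      { toFun := fun A : X × Y →L[ℝ] F =>
          A ∘L (ContinuousLinearMap.inl ℝ X Y ∘L ContinuousLinearMap.fst ℝ X Y)
        map_add' := fun _ _ => rfl
        map_smul' := fun _ _ => rfl }
      ‖ContinuousLinearMap.inl ℝ X Y ∘L ContinuousLinearMap.fst ℝ X Y‖
      (fun A => by rw [mul_comm]; exact ContinuousLinearMap.opNorm_comp_le _ _))
    ∘L fderivCLM ℂ (X × Y) F
  - (2 * Real.pi * Complex.I : ℂ) • smulRightCLM ℂ F
      (((innerSL ℝ).flip ∘L ContinuousLinearMap.snd ℝ X Y).flip ∘L ContinuousLinearMap.snd ℝ X Y)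

theorem partialFourierDeriv_apply {F : Type} [NormedAddCommGroup F] [NormedSpace ℂ F]
    (Φ : 𝓢(X × Y, F)) (x : X) (s : Y) (v : X × Y) :
    partialFourierDeriv F Φ (x, s) v =
      fderiv ℝ Φ (x, s) (v.1, 0) - (2 * Real.pi * Complex.I : ℂ) • ⟪s, v.2⟫ • Φ (x, s) := by
  rfl

theorem partialFourierFun_integrable {F : Type} [NormedAddCommGroup F] [NormedSpace ℂ F]
    (Φ : 𝓢(X × Y, F)) (z : X × Y) :
    Integrable (fun s : Y => 𝐞 (-⟪s, z.2⟫) • Φ (z.1, s)) := by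
  have h := slice_integrable Φ z.1 0 0
  simp only [pow_zero, one_mul, norm_iteratedFDeriv_zero] at h
  refine h.mono' ?_ (Filter.Eventually.of_forall fun s => by simp [Circle.norm_smul])
  refine Continuous.aestronglyMeasurable ?_
  have := (slice_smooth Φ z.1 0).continuous
  fun_prop

theorem partialFourier_integrand_hasFDerivAt {F : Type} [NormedAddCommGroup F] [NormedSpace ℂ F]
    (Φ : 𝓢(X × Y, F)) (s : Y) (w : X × Y) :
    HasFDerivAt (fun w : X × Y => 𝐞 (-⟪s, w.2⟫) • Φ (w.1, s))
      (𝐞 (-⟪s, w.2⟫) • partialFourierDeriv F Φ (w.1, s) : X × Y →L[ℝ] F) w := by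
  have h1 : HasFDerivAt (fun w : X × Y => ((𝐞 (-⟪s, w.2⟫) : Circle) : ℂ)) _ w :=
    (Real.hasFDerivAt_fourierChar_neg_bilinear_right (innerSL ℝ : Y →L[ℝ] Y →L[ℝ] ℝ) s w.2).comp
      w hasFDerivAt_snd
  have h2 : HasFDerivAt (fun w : X × Y => Φ (w.1, s)) _ w :=
    (Φ.hasFDerivAt (w.1, s)).comp w (hasFDerivAt_fst.prodMk (hasFDerivAt_const s w))
  refine (h1.smul h2).congr_fderiv (ContinuousLinearMap.ext fun v => ?_)
  have e1 : (𝐞 (-⟪s, w.2⟫) • partialFourierDeriv F Φ (w.1, s) : X × Y →L[ℝ] F) v =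
      ((𝐞 (-⟪s, w.2⟫) : Circle) : ℂ) • (fderiv ℝ Φ (w.1, s) (v.1, 0) -
        (2 * Real.pi * Complex.I : ℂ) • ⟪s, v.2⟫ • Φ (w.1, s)) := by
    rw [← partialFourierDeriv_apply]; rfl
  rw [e1]
  simp only [add_apply, smul_apply, ContinuousLinearMap.comp_apply,
    ContinuousLinearMap.smulRight_apply, Complex.ofRealCLM_apply,
    ContinuousLinearMap.prod_apply, zero_apply, smul_eq_mul,
    ContinuousLinearMap.coe_fst', ContinuousLinearMap.coe_snd']
  change _ + (-2 * Real.pi * Complex.I * ((𝐞 (-⟪s, w.2⟫) : Circle) : ℂ) *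
    ((⟪s, v.2⟫ : ℝ) : ℂ)) • Φ (w.1, s) = _
  rw [← Complex.coe_smul ⟪s, v.2⟫]
  module

theorem partialFourierFun_hasFDerivAt {F : Type} [NormedAddCommGroup F] [NormedSpace ℂ F]
    (Φ : 𝓢(X × Y, F)) (z : X × Y) :
    HasFDerivAt (partialFourierFun Φ) (partialFourierFun (F := X × Y →L[ℝ] F) (partialFourierDeriv F Φ) z) z := by
  set N := (volume : Measure Y).integrablePower with hN
  set Ψ := partialFourierDeriv F Φ
  have hb : ∃ C, ∀ w, (1 + ‖w‖) ^ N * ‖Ψ w‖ ≤ C :=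
    ⟨_, fun w => by
      simpa using one_add_le_sup_seminorm_apply (𝕜 := ℂ) (m := (N, 0)) le_rfl le_rfl Ψ w⟩
  obtain ⟨C, hC⟩ := hb
  refine hasFDerivAt_integral_of_dominated_of_fderiv_le (s := Set.univ)
    (F' := fun w s => (𝐞 (-⟪s, w.2⟫) • Ψ (w.1, s) : X × Y →L[ℝ] F))
    (bound := fun s : Y => C * (1 + ‖s‖) ^ (-(N : ℝ))) Filter.univ_mem ?_ ?_ ?_ ?_ ?_ ?_
  · exact Filter.Eventually.of_forall fun w => (partialFourierFun_integrable Φ w).1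
  · exact partialFourierFun_integrable Φ z
  · exact (partialFourierFun_integrable (F := X × Y →L[ℝ] F) Ψ z).1
  · refine Filter.Eventually.of_forall fun s w _ => ?_
    refine (Circle.norm_smul (𝐞 (-⟪s, w.2⟫)) (Ψ (w.1, s))).trans_le ?_
    rw [Real.rpow_neg (by positivity), Real.rpow_natCast,
      ← div_eq_mul_inv, le_div_iff₀ (by positivity), mul_comm]
    refine le_trans ?_ (hC (w.1, s))
    gcongr
    exact norm_snd_le (w.1, s)
  · exact (volume : Measure Y).integrable_pow_neg_integrablePower.const_mul C
  · refine Filter.Eventually.of_forall fun s w _ => ?_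
    exact partialFourier_integrand_hasFDerivAt Φ s w

theorem partialFourierFun_contDiff (n : ℕ) : ∀ (F : Type) [NormedAddCommGroup F] [NormedSpace ℂ F]
    (Φ : 𝓢(X × Y, F)), ContDiff ℝ n (partialFourierFun Φ) := by
  induction n with
  | zero =>
    intro F _ _ Φ
    rw [Nat.cast_zero, contDiff_zero, continuous_iff_continuousAt]
    exact fun z => (partialFourierFun_hasFDerivAt Φ z).continuousAt
  | succ n ih =>
    intro F _ _ Φ
    exact contDiff_succ_iff_hasFDerivAt.2
      ⟨_, ih _ (partialFourierDeriv F Φ), partialFourierFun_hasFDerivAt Φ⟩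

theorem partialFourierFun_bound (k n : ℕ) : ∀ (F : Type) [NormedAddCommGroup F] [NormedSpace ℂ F],
    ∃ q : Seminorm ℂ 𝓢(X × Y, F), Continuous q ∧ ∀ (Φ : 𝓢(X × Y, F)) (z : X × Y),
      ‖z‖ ^ k * ‖iteratedFDeriv ℝ n (partialFourierFun Φ) z‖ ≤ q Φ := by
  induction n with
  | zero =>
    intro F _ _
    obtain ⟨q, hq, h⟩ := partialFourierFun_decay (X := X) (Y := Y) F k
    exact ⟨q, hq, fun Φ z => by simpa using h Φ z⟩
  | succ n ih =>
    intro F _ _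
    obtain ⟨q, hq, h⟩ := ih (X × Y →L[ℝ] F)
    have hc : Continuous (fun Φ => q (partialFourierDeriv F Φ)) :=
      hq.comp (partialFourierDeriv F).continuous
    refine ⟨q.comp (σ₁₂ := RingHom.id ℂ) (partialFourierDeriv F).toLinearMap, ?_, fun Φ z => ?_⟩
    · exact hc
    have : fderiv ℝ (partialFourierFun Φ) = partialFourierFun (F := X × Y →L[ℝ] F) (partialFourierDeriv F Φ) :=
      funext fun w => (partialFourierFun_hasFDerivAt Φ w).fderiv
    rw [← norm_iteratedFDeriv_fderiv, this]
    exact h _ z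

/-- The partial Fourier transform in the second variable,
`(y, η) ↦ ∫ Φ(y, s) e^{-2πi⟨s, η⟩} ds`, as a continuous operator on Schwartz functions. -/
def partialFourier : 𝓢(X × Y, ℂ) →L[ℂ] 𝓢(X × Y, ℂ) :=
  mkCLM (fun Φ => partialFourierFun Φ)
    (fun Φ Ψ z => by
      simp only [partialFourierFun, add_apply, smul_add]
      exact integral_add (partialFourierFun_integrable Φ z) (partialFourierFun_integrable Ψ z))
    (fun c Φ z => by
      simp only [partialFourierFun, smul_apply, RingHom.id_apply]
      rw [← integral_smul]
      congr 1; ext s; rw [smul_comm])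
    (fun Φ => contDiff_infty.2 fun n => partialFourierFun_contDiff n ℂ Φ)
    (fun n => by
      obtain ⟨q, hq, h⟩ := partialFourierFun_bound (X := X) (Y := Y) n.1 n.2 ℂ
      obtain ⟨t, C, _, hC⟩ := Seminorm.bound_of_continuous
        (schwartz_withSeminorms ℂ (X × Y) ℂ) q hq
      exact ⟨t, C, C.2, fun Φ z => (h Φ z).trans (hC Φ)⟩)

theorem partialFourier_apply (Φ : 𝓢(X × Y, ℂ)) (z : X × Y) :
    partialFourier Φ z = ∫ s : Y, 𝐞 (-⟪s, z.2⟫) • Φ (z.1, s) := rfl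

end PartialFourier

section Tensor

variable {X Y : Type} [NormedAddCommGroup X] [NormedSpace ℝ X]
  [NormedAddCommGroup Y] [NormedSpace ℝ Y]

theorem tensor_bound (k n : ℕ) (f : 𝓢(X, ℂ)) (g : 𝓢(Y, ℂ)) (z : X × Y) :
    ‖z‖ ^ k * ‖iteratedFDeriv ℝ n (fun z : X × Y => f z.1 * g z.2) z‖ ≤
      ∑ i ∈ Finset.range (n + 1), (n.choose i : ℝ) *
        (SchwartzMap.seminorm ℂ k i f * SchwartzMap.seminorm ℂ 0 (n - i) g +
          SchwartzMap.seminorm ℂ 0 i f * SchwartzMap.seminorm ℂ k (n - i) g) := by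
  have hf : ∀ i, ‖iteratedFDeriv ℝ i (fun z : X × Y => f z.1) z‖ ≤ ‖iteratedFDeriv ℝ i f z.1‖ := by
    intro i
    have := ContinuousLinearMap.iteratedFDeriv_comp_right (ContinuousLinearMap.fst ℝ X Y)
      (f.smooth i) z le_rfl
    change ‖iteratedFDeriv ℝ i (f ∘ ContinuousLinearMap.fst ℝ X Y) z‖ ≤ _
    rw [this]
    refine (ContinuousMultilinearMap.norm_compContinuousLinearMap_le _ _).trans ?_
    exact mul_le_of_le_one_right (norm_nonneg _)
      (Finset.prod_le_one (fun _ _ => by positivity)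
        (fun _ _ => ContinuousLinearMap.norm_fst_le ℝ X Y))
  have hg : ∀ i, ‖iteratedFDeriv ℝ i (fun z : X × Y => g z.2) z‖ ≤ ‖iteratedFDeriv ℝ i g z.2‖ := by
    intro i
    have := ContinuousLinearMap.iteratedFDeriv_comp_right (ContinuousLinearMap.snd ℝ X Y)
      (g.smooth i) z le_rfl
    change ‖iteratedFDeriv ℝ i (g ∘ ContinuousLinearMap.snd ℝ X Y) z‖ ≤ _
    rw [this]
    refine (ContinuousMultilinearMap.norm_compContinuousLinearMap_le _ _).trans ?_
    exact mul_le_of_le_one_right (norm_nonneg _)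
      (Finset.prod_le_one (fun _ _ => by positivity)
        (fun _ _ => ContinuousLinearMap.norm_snd_le ℝ X Y))
  have e3 : ‖z‖ ^ k ≤ ‖z.1‖ ^ k + ‖z.2‖ ^ k := by
    rw [Prod.norm_def]
    rcases max_cases ‖z.1‖ ‖z.2‖ with ⟨h, _⟩ | ⟨h, _⟩ <;> rw [h]
    · exact le_add_of_nonneg_right (by positivity)
    · exact le_add_of_nonneg_left (by positivity)
  have hm := norm_iteratedFDeriv_mul_le (𝕜 := ℝ) (N := n)
    ((f.smooth n).comp (contDiff_fst (E := X) (F := Y)))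
    ((g.smooth n).comp (contDiff_snd (E := X) (F := Y))) z le_rfl
  refine (mul_le_mul_of_nonneg_left hm (by positivity)).trans ?_
  rw [Finset.mul_sum]
  refine Finset.sum_le_sum fun i _ => ?_
  calc ‖z‖ ^ k * (n.choose i * ‖iteratedFDeriv ℝ i (fun z : X × Y => f z.1) z‖ *
          ‖iteratedFDeriv ℝ (n - i) (fun z : X × Y => g z.2) z‖)
      ≤ (‖z.1‖ ^ k + ‖z.2‖ ^ k) * (n.choose i * ‖iteratedFDeriv ℝ i f z.1‖ *
          ‖iteratedFDeriv ℝ (n - i) g z.2‖) := by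
        gcongr
        · exact hf i
        · exact hg _
    _ = n.choose i * ((‖z.1‖ ^ k * ‖iteratedFDeriv ℝ i f z.1‖) *
          (‖z.2‖ ^ 0 * ‖iteratedFDeriv ℝ (n - i) g z.2‖) +
          (‖z.1‖ ^ 0 * ‖iteratedFDeriv ℝ i f z.1‖) *
          (‖z.2‖ ^ k * ‖iteratedFDeriv ℝ (n - i) g z.2‖)) := by ring
    _ ≤ _ := by
        gcongr <;> exact le_seminorm ℂ _ _ _ _

/-- The tensor product `f ⊗ g`, `(x, y) ↦ f x * g y`, as a continuous operator in `f`. -/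
def tensor (g : 𝓢(Y, ℂ)) : 𝓢(X, ℂ) →L[ℂ] 𝓢(X × Y, ℂ) :=
  mkCLM (fun f z => f z.1 * g z.2)
    (fun f f' z => by simp [add_mul])
    (fun c f z => by simp [mul_assoc])
    (fun f => ((f.smooth ⊤).comp contDiff_fst).mul ((g.smooth ⊤).comp contDiff_snd))
    (fun ⟨k, n⟩ => by
      let a : ℕ → ℕ → ℝ≥0 := fun l i => ⟨n.choose i * SchwartzMap.seminorm ℂ l (n - i) g,
        by positivity⟩
      let S : ℕ → ℕ → Seminorm ℂ 𝓢(X, ℂ) := fun l i => SchwartzMap.seminorm ℂ l i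
      have hS : ∀ l i, Continuous (S l i) :=
        fun l i => (schwartz_withSeminorms ℂ X ℂ).continuous_seminorm (l, i)
      let q : Seminorm ℂ 𝓢(X, ℂ) :=
        ∑ i ∈ Finset.range (n + 1), (a 0 i • S k i + a k i • S 0 i)
      have hv : ∀ f, q f = ∑ i ∈ Finset.range (n + 1), (a 0 i • S k i f + a k i • S 0 i f) :=
        fun f => seminorm_sum_apply _ _ _
      have hq : Continuous q := by
        rw [show (q : 𝓢(X, ℂ) → ℝ) = _ from funext hv]
        exact continuous_finsetSum _ fun i _ =>
          ((hS k i).const_smul (a 0 i)).add ((hS 0 i).const_smul (a k i))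
      obtain ⟨t, C, _, hC⟩ := Seminorm.bound_of_continuous
        (schwartz_withSeminorms ℂ X ℂ) q hq
      refine ⟨t, C, C.2, fun f z => (tensor_bound k n f g z).trans (le_trans ?_ (hC f))⟩
      rw [hv]
      refine le_of_eq (Finset.sum_congr rfl fun i _ => ?_)
      change _ = (n.choose i * SchwartzMap.seminorm ℂ 0 (n - i) g) *
          SchwartzMap.seminorm ℂ k i f +
        (n.choose i * SchwartzMap.seminorm ℂ k (n - i) g) * SchwartzMap.seminorm ℂ 0 i f
      ring)

end Tensor

section WeylCalculus

/-- Position space `ℝ^d`. -/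
abbrev Pos (d : ℕ) := EuclideanSpace ℝ (Fin d)

/-- Phase space `ℝ^{2d} = ℝ^d × ℝ^d`, with the Euclidean norm and Lebesgue measure. -/
abbrev Phase (d : ℕ) := WithLp 2 (Pos d × Pos d)

/-- The symplectic form `σ((x, ξ), (x', ξ')) = x'·ξ - x·ξ'`. -/
def symp {d : ℕ} (w z : Phase d) : ℝ := ⟪z.fst, w.snd⟫ - ⟪w.fst, z.snd⟫

/-- `(x, ξ) ↦ (-ξ, x)`, so that `σ(w, z) = ⟨w, J z⟩`. -/
def sympJ (d : ℕ) : Phase d ≃L[ℝ] Phase d :=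
  (WithLp.prodContinuousLinearEquiv 2 ℝ (Pos d) (Pos d)).trans
    (((ContinuousLinearEquiv.prodComm ℝ (Pos d) (Pos d)).trans
      ((ContinuousLinearEquiv.neg ℝ).prodCongr (ContinuousLinearEquiv.refl ℝ (Pos d)))).trans
      (WithLp.prodContinuousLinearEquiv 2 ℝ (Pos d) (Pos d)).symm)

theorem inner_sympJ {d : ℕ} (w z : Phase d) : ⟪w, sympJ d z⟫ = symp w z := by
  have h : sympJ d z = WithLp.toLp 2 (-z.snd, z.fst) := rfl
  rw [h, WithLp.prod_inner_apply, symp]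
  change ⟪w.fst, -z.snd⟫ + ⟪w.snd, z.fst⟫ = _
  rw [inner_neg_right, real_inner_comm z.fst w.snd]
  ring

/-- The transpose of the symplectic Fourier transform on test functions,
`z ↦ ∫ φ(w) e^{-2πiσ(w, z)} dw`. -/
def sympFourierTest (d : ℕ) : 𝓢(Phase d, ℂ) →L[ℂ] 𝓢(Phase d, ℂ) :=
  compCLMOfContinuousLinearEquiv ℂ (sympJ d) ∘L
    FourierTransform.fourierCLM ℂ 𝓢(Phase d, ℂ)

theorem sympFourierTest_apply {d : ℕ} (φ : 𝓢(Phase d, ℂ)) (z : Phase d) :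
    sympFourierTest d φ z = ∫ w, 𝐞 (-symp w z) • φ w := by
  change 𝓕 (φ : Phase d → ℂ) (sympJ d z) = _
  simp_rw [Real.fourier_eq, inner_sympJ]

/-- The symplectic Fourier transform of a tempered distribution: the extension by duality of
`F_σ a(w) = ∫ a(z) e^{-2πiσ(w, z)} dz`, i.e. `⟨F_σ u, φ⟩ = ⟨u, z ↦ ∫ φ(w) e^{-2πiσ(w, z)} dw⟩`. -/
def sympFourier {d : ℕ} (u : 𝓢'(Phase d, ℂ)) : 𝓢'(Phase d, ℂ) :=
  PointwiseConvergenceCLM.precomp ℂ (sympFourierTest d) u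

/-- The linear map `(y, η) ↦ (y/2 - η, -y/2 - η)` of determinant `±1`, the inverse of
`(t, x) ↦ (t - x, -(t + x)/2)`. -/
def kernelCoord (d : ℕ) : (Pos d × Pos d) ≃L[ℝ] Pos d × Pos d :=
  LinearEquiv.toContinuousLinearEquiv
    { toFun := fun z => ((1 / 2 : ℝ) • z.1 - z.2, -(1 / 2 : ℝ) • z.1 - z.2)
      invFun := fun w => (w.1 - w.2, -(1 / 2 : ℝ) • (w.1 + w.2))
      map_add' := fun z w => by
        ext1 <;> simp only [Prod.fst_add, Prod.snd_add] <;> module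
      map_smul' := fun c z => by
        ext1 <;> simp only [Prod.smul_fst, Prod.smul_snd, RingHom.id_apply] <;> module
      left_inv := fun z => by ext1 <;> dsimp only <;> module
      right_inv := fun z => by ext1 <;> dsimp only <;> module }

/-- The transpose of `u ↦ k_u` on test functions. -/
def kernelTest (d : ℕ) : 𝓢(Pos d × Pos d, ℂ) →L[ℂ] 𝓢(Phase d, ℂ) :=
  compCLMOfContinuousLinearEquiv ℂ (WithLp.prodContinuousLinearEquiv 2 ℝ (Pos d) (Pos d)) ∘L
    partialFourier ∘L compCLMOfContinuousLinearEquiv ℂ (kernelCoord d)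

/-- The Schwartz kernel `k_u(t, x) = (F^ξ u)(t - x, -(t + x)/2)` of `ρ(u)`, where `F^ξ` is the
partial Fourier transform in `ξ` and the change of coordinates is in the sense of distributions. -/
def repKernel {d : ℕ} (u : 𝓢'(Phase d, ℂ)) : 𝓢'(Pos d × Pos d, ℂ) :=
  PointwiseConvergenceCLM.precomp ℂ (kernelTest d) u

/-- The operator `ρ(u) = ∫ u(z) ρ(z) dz` from Schwartz functions to tempered distributions,
`⟨ρ(u)ψ, φ⟩ = ⟨k_u, φ ⊗ ψ⟩`. -/
def rep {d : ℕ} (u : 𝓢'(Phase d, ℂ)) (ψ : 𝓢(Pos d, ℂ)) : 𝓢'(Pos d, ℂ) :=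
  PointwiseConvergenceCLM.precomp ℂ (tensor ψ) (repKernel u)

/-- The Weyl quantization `L_a = ρ(F_σ a)` of a tempered distribution `a`. -/
def weylOp {d : ℕ} (a : 𝓢'(Phase d, ℂ)) (ψ : 𝓢(Pos d, ℂ)) : 𝓢'(Pos d, ℂ) :=
  rep (sympFourier a) ψ

/-- The projective Schrödinger representation
`[ρ(x, ξ)g](t) = e^{-πi x·ξ + 2πi t·ξ} g(t - x)`. -/
def schrodinger {d : ℕ} (z : Phase d) (g : Pos d → ℂ) (t : Pos d) : ℂ :=
  Complex.exp (-(Real.pi * Complex.I * (⟪z.fst, z.snd⟫ : ℝ)) +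
    2 * Real.pi * Complex.I * (⟪t, z.snd⟫ : ℝ)) * g (t - z.fst)

/-- `⟨ρ(u)ψ, φ⟩` is `u` applied to the matrix coefficient `z ↦ ∫ [ρ(z)ψ](t) φ(t) dt`. -/
theorem kernelTest_tensor_apply {d : ℕ} (φ ψ : 𝓢(Pos d, ℂ)) (z : Phase d) :
    kernelTest d (tensor ψ φ) z = ∫ t, schrodinger z ψ t * φ t := by
  have h : kernelTest d (tensor ψ φ) z = ∫ s : Pos d, 𝐞 (-⟪s, z.snd⟫) •
      (φ ((1 / 2 : ℝ) • z.fst - s) * ψ (-(1 / 2 : ℝ) • z.fst - s)) := rfl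
  rw [h, ← integral_sub_left_eq_self _ _ ((1 / 2 : ℝ) • z.fst)]
  congr 1; ext t
  rw [sub_sub_cancel, show -(1 / 2 : ℝ) • z.fst - ((1 / 2 : ℝ) • z.fst - t) = t - z.fst by module,
    schrodinger, Circle.smul_def, Real.fourierChar_apply, smul_eq_mul, inner_sub_left,
    real_inner_smul_left]
  rw [show ((2 * Real.pi * -((1 / 2 : ℝ) * ⟪z.fst, z.snd⟫ - ⟪t, z.snd⟫) : ℝ) : ℂ) * Complex.I =
    -(Real.pi * Complex.I * (⟪z.fst, z.snd⟫ : ℝ)) +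
      2 * Real.pi * Complex.I * (⟪t, z.snd⟫ : ℝ) by push_cast; ring]
  ring

end WeylCalculus

section Schatten

variable {H : Type} [NormedAddCommGroup H] [InnerProductSpace ℂ H] [CompleteSpace H]

/-- The trace `∑ ⟨S e_i, e_i⟩ ∈ [0, ∞]` of a positive operator, over an orthonormal basis
(the choice of which is immaterial, see `posTrace_eq`). -/
def posTrace (S : H →L[ℂ] H) : ℝ≥0∞ :=
  ∑' i, ENNReal.ofReal
    (RCLike.re (inner ℂ (S ((exists_hilbertBasis ℂ H).choose_spec.choose i))
      ((exists_hilbertBasis ℂ H).choose_spec.choose i)))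

theorem tsum_parseval {ι : Type} (b : HilbertBasis ι ℂ H) (v : H) :
    ∑' i, ENNReal.ofReal (‖inner ℂ (b i) v‖ ^ 2) = ENNReal.ofReal (‖v‖ ^ 2) := by
  have h : HasSum (fun i => ‖inner ℂ (b i) v‖ ^ 2) (‖v‖ ^ 2) := by
    have h1 := (b.hasSum_inner_mul_inner v v).mapL (RCLike.reCLM : ℂ →L[ℝ] ℝ)
    have e1 : (fun i => ‖inner ℂ (b i) v‖ ^ 2) =
        fun i => (RCLike.reCLM : ℂ →L[ℝ] ℝ) (inner ℂ v (b i) * inner ℂ (b i) v) := by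
      ext i
      rw [← inner_conj_symm v (b i), RCLike.conj_mul]
      simp [← Complex.ofReal_pow]
    have e2 : ‖v‖ ^ 2 = (RCLike.reCLM : ℂ →L[ℝ] ℝ) (inner ℂ v v) :=
      (inner_self_eq_norm_sq (𝕜 := ℂ) v).symm
    rw [e1, e2]
    exact h1
  rw [← h.tsum_eq, ENNReal.ofReal_tsum_of_nonneg (fun i => by positivity) h.summable]

theorem posTrace_eq {ι : Type} (b : HilbertBasis ι ℂ H) {S : H →L[ℂ] H} (hS : S.IsPositive) :
    posTrace S = ∑' i, ENNReal.ofReal (RCLike.re (inner ℂ (S (b i)) (b i))) := by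
  have hS0 : 0 ≤ S := (ContinuousLinearMap.nonneg_iff_isPositive S).2 hS
  have hA0 : (CFC.sqrt S).IsPositive :=
    (ContinuousLinearMap.nonneg_iff_isPositive _).1 (CFC.sqrt_nonneg S)
  have hsym : ∀ v w, inner ℂ (CFC.sqrt S v) w = inner ℂ v (CFC.sqrt S w) :=
    fun v w => hA0.isSymmetric v w
  have hSA : ∀ v, RCLike.re (inner ℂ (S v) v) = ‖CFC.sqrt S v‖ ^ 2 := by
    intro v
    have : S v = CFC.sqrt S (CFC.sqrt S v) := by
      conv_lhs => rw [← CFC.sqrt_mul_sqrt_self S hS0]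
      rfl
    rw [this, hsym, inner_self_eq_norm_sq]
  unfold posTrace
  generalize (exists_hilbertBasis ℂ H).choose_spec.choose = e
  simp_rw [hSA]
  calc ∑' i, ENNReal.ofReal (‖CFC.sqrt S (e i)‖ ^ 2)
      = ∑' i, ∑' j, ENNReal.ofReal (‖inner ℂ (b j) (CFC.sqrt S (e i))‖ ^ 2) := by
        simp_rw [tsum_parseval]
    _ = ∑' j, ∑' i, ENNReal.ofReal (‖inner ℂ (e i) (CFC.sqrt S (b j))‖ ^ 2) := by
        rw [ENNReal.tsum_comm]
        refine tsum_congr fun j => tsum_congr fun i => ?_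
        rw [← hsym, norm_inner_symm]
    _ = _ := by simp_rw [tsum_parseval]

/-- The Schatten norm `‖T‖_{S^p} ∈ [0, ∞]` of a bounded operator: `(tr ((T*T)^{p/2}))^{1/p}`, where
`(T*T)^{p/2} = |T|^p` is given by functional calculus, and the operator norm if `p = ∞`. -/
def schattenNorm (p : ℝ≥0∞) (T : H →L[ℂ] H) : ℝ≥0∞ :=
  if p = ⊤ then ‖T‖ₑ else posTrace ((star T * T) ^ (p.toReal / 2)) ^ (1 / p.toReal)

end Schatten

/-- The norm `‖L_a‖_{S^p} ∈ [0, ∞]` of the Weyl operator of a tempered distribution `a`: the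
Schatten norm of the (necessarily unique) bounded operator `T` on `L²(ℝ^d)` with `Tψ = L_a ψ` for
all Schwartz functions `ψ`, and `∞` if there is none. -/
def weylSchattenNorm {d : ℕ} (p : ℝ≥0∞) (a : 𝓢'(Phase d, ℂ)) : ℝ≥0∞ :=
  ⨅ (T : Lp ℂ 2 (volume : Measure (Pos d)) →L[ℂ] Lp ℂ 2 (volume : Measure (Pos d)))
    (_ : ∀ ψ : 𝓢(Pos d, ℂ), weylOp a ψ = Lp.toTemperedDistribution (T (ψ.toLp 2))),
    schattenNorm p T

/-- The norm `‖a‖_{L^p} ∈ [0, ∞]` of a tempered distribution: the `L^p` norm of the (necessarily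
unique) `L^p` function that it is given by, and `∞` if there is none. -/
def distLpNorm {d : ℕ} (p : ℝ≥0∞) [Fact (1 ≤ p)] (a : 𝓢'(Phase d, ℂ)) : ℝ≥0∞ :=
  ⨅ (f : Lp ℂ p (volume : Measure (Phase d))) (_ : Lp.toTemperedDistribution f = a), ‖f‖ₑ

end Weyl

end

noncomputable section
set_option linter.unusedSectionVars false

namespace Weyl

/-! ### Compactness and diagonalisation of operators on a Hilbert space. -/

section SchattenClass

variable {H : Type} [NormedAddCommGroup H] [InnerProductSpace ℂ H] [CompleteSpace H]

/-! Write γ_z = ρ(z)γ for the coherent states of the normalised Gaussian γ (`coh`), and A(v) = ∫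
[ρ(v)ψ](t) φ(t) dt for the matrix coefficient of ψ and φ (`kernelTest`). Then ⟨L_{F_σ u} ψ, φ⟩ =
u(A) (`weylOp_sympFourier`). The mechanism is that a modulated Gaussian e^{2πiσ(v,y)} e^{-π|v-w|²/2}
is, up to a unimodular constant, the matrix coefficient between the coherent states at y - w/2 and y
+ w/2 (`ch_mul_ambiguity`).

A cutoff to the support of u is a superposition of such functions. Convolve a bump ζ on a ball of
radius comparable to R with the product of a fixed bump and a Gaussian, and expand the fixed bump as
a symplectic Fourier integral (`integral_weight`). The weights have total mass O(R^{2d}), and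
multiplying test functions by the cutoff changes u only by a nonzero constant factor
(`apply_eq_apply_cutoffMul`).

If F_σ u is a function a, Moyal's identity (`integral_kernelTest_mul_kernelTest`) turns the
symplectic Fourier transform of cutoff · A into an integral of products of two coherent-state
coefficients (`sympFourierTest_cutoffMul_kernelTest`). Hence L_{F_σ u} is an integral of rank-one
operators built from coherent states translated by z, with density a(z) times the weight. If instead
L_{F_σ u} is given by a bounded T, the cutoff applied to the character v ↦ e^{2πiσ(v,z)} is a
superposition of coherent-state matrix coefficients, so F_σ u(z) is a weighted integral of numbers
⟨γ_{z-s'}, T γ_{z-s}⟩ (`sympFourier_apply_eq`).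

Both formulas are estimated without interpolation by Schur's test
(`lintegral_rpow_lintegral_mul_le`). Its kernel pairs the point z with the i-th members of two
orthonormal families. Summing over i costs at most the mass of the weight by Bessel's inequality for
those families, and integrating over z costs at most the same by Bessel's inequality for coherent
states (`lintegral_enorm_inner_cohL_le`). In one direction this bounds the diagonals ⟨f_i, T e_i⟩,
which control the Schatten norm (`schattenNorm_le_of_sum_inner_le`). In the other it is applied to
the singular value decomposition of T (`exists_singularValues`). Since R ≥ 1, the factor R^{2d} is
at most the stated power. -/

theorem aeval_apply_of_apply_eq_smul {A : H →L[ℂ] H} {v : H} {a : ℝ} (h : A v = (a : ℂ) • v)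
    (q : Polynomial ℝ) : (Polynomial.aeval A q) v = ((q.eval a : ℝ) : ℂ) • v := by
  induction q using Polynomial.induction_on with
  | C r =>
    rw [Polynomial.aeval_C, Polynomial.eval_C, Algebra.algebraMap_eq_smul_one]
    simp
  | add p q hp hq =>
    rw [map_add, add_apply, hp, hq, Polynomial.eval_add]
    push_cast
    rw [add_smul]
  | monomial n r ih =>
    rw [pow_succ, ← mul_assoc, map_mul, Polynomial.aeval_X, mul_apply_eq_comp, h,
      map_smul, ih, smul_smul]
    congr 1
    simp
    ring

/-- An eigenvector of a positive operator is an eigenvector of its powers. -/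
theorem rpow_apply_of_apply_eq_smul {A : H →L[ℂ] H} (hA : 0 ≤ A) {v : H} {a : ℝ} (ha : 0 ≤ a)
    (h : A v = (a : ℂ) • v) {r : ℝ} (hr : 0 < r) : (A ^ r) v = ((a ^ r : ℝ) : ℂ) • v := by
  have hc : Continuous fun x : ℝ => x ^ r := Real.continuous_rpow_const hr.le
  have hsa : IsSelfAdjoint A := IsSelfAdjoint.of_nonneg hA
  set M : ℝ := max ‖A‖ a
  rw [← sub_eq_zero, ← norm_eq_zero]
  refine le_antisymm (le_of_forall_pos_le_add fun ε hε => ?_) (norm_nonneg _)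
  rw [zero_add]
  obtain ⟨δ, hδ, hδε⟩ : ∃ δ > 0, 2 * δ * ‖v‖ ≤ ε := by
    refine ⟨ε / (2 * (‖v‖ + 1)), by positivity, ?_⟩
    rw [mul_assoc, div_mul_eq_mul_div, mul_div_assoc', div_le_iff₀ (by positivity)]
    nlinarith [norm_nonneg v]
  -- For polynomials the claim is evaluation at the eigenvalue. The interval [-M, M] contains both
  -- the spectrum of `A` and `a`, so one Weierstrass approximation controls both sides.
  obtain ⟨q, hq⟩ := exists_polynomial_near_of_continuousOn (-M) M _ hc.continuousOn δ hδ
  have h1 : ‖A ^ r - Polynomial.aeval A q‖ ≤ δ := by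
    rw [CFC.rpow_eq_cfc_real, ← cfc_polynomial q A, ← cfc_sub _ _ A]
    refine norm_cfc_le hδ.le fun x hx => ?_
    rw [Real.norm_eq_abs, abs_sub_comm]
    refine (hq x (abs_le.1 ?_)).le
    rcases subsingleton_or_nontrivial H with hs | hs
    · have : Subsingleton (H →L[ℂ] H) := ⟨fun f g => by ext x; exact Subsingleton.elim _ _⟩
      rw [spectrum.of_subsingleton] at hx
      exact absurd hx (Set.notMem_empty _)
    · exact (spectrum.norm_le_norm_of_mem hx).trans (le_max_left _ _)
  have h2 : ‖((q.eval a : ℝ) : ℂ) - ((a ^ r : ℝ) : ℂ)‖ ≤ δ := by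
    rw [← Complex.ofReal_sub, Complex.norm_real, Real.norm_eq_abs]
    refine (hq a ⟨?_, le_max_right _ _⟩).le
    linarith [le_max_right ‖A‖ a]
  calc ‖(A ^ r) v - ((a ^ r : ℝ) : ℂ) • v‖
      = ‖(A ^ r - Polynomial.aeval A q) v +
          (((q.eval a : ℝ) : ℂ) - ((a ^ r : ℝ) : ℂ)) • v‖ := by
        rw [sub_apply, aeval_apply_of_apply_eq_smul h, sub_smul, sub_add_sub_cancel]
    _ ≤ δ * ‖v‖ + δ * ‖v‖ := by
        refine norm_add_le_of_le ?_ ?_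
        · exact (ContinuousLinearMap.le_opNorm _ _).trans (by gcongr)
        · rw [norm_smul]; gcongr
    _ ≤ ε := by linarith

open scoped ComplexOrder in
/-- A positive compact operator has an orthonormal basis of eigenvectors. -/
theorem exists_hilbertBasis_eigenvectors {A : H →L[ℂ] H} (hA : 0 ≤ A) (hc : IsCompactOperator A) :
    ∃ (ι : Type) (b : HilbertBasis ι ℂ H) (s : ι → ℝ),
      (∀ i, 0 ≤ s i) ∧ ∀ i, A (b i) = (s i : ℂ) • b i := by
  have hp : A.IsPositive := (ContinuousLinearMap.nonneg_iff_isPositive A).1 hA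
  have hsym : (A : H →ₗ[ℂ] H).IsSymmetric := hp.isSymmetric
  choose w bw hbw using fun μ : ℂ => exists_hilbertBasis ℂ (Module.End.eigenspace (A : H →ₗ[ℂ] H) μ)
  have ho := hsym.orthogonalFamily_eigenspaces.orthonormal_sigma_orthonormal
    fun μ => (bw μ).orthonormal
  have hsp : (Submodule.span ℂ (Set.range fun a : Σ μ, w μ =>
      (Module.End.eigenspace (A : H →ₗ[ℂ] H) a.1).subtypeₗᵢ (bw a.1 a.2)))ᗮ = ⊥ := by
    rw [Submodule.eq_bot_iff]
    intro x hx
    rw [Submodule.mem_orthogonal] at hx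
    -- The spectral theorem for compact symmetric operators: only zero is orthogonal to all
    -- eigenspaces. It remains to see that orthogonality to a basis of an eigenspace gives
    -- orthogonality to the eigenspace.
    have h0 := ContinuousLinearMap.orthogonalComplement_iSup_eigenspaces_eq_bot hc hsym
    rw [Submodule.eq_bot_iff] at h0
    refine h0 x ?_
    rw [← Submodule.iInf_orthogonal, Submodule.mem_iInf]
    intro μ
    have hz : (Module.End.eigenspace (A : H →ₗ[ℂ] H) μ).orthogonalProjectionOnto x = 0 := by
      refine (bw μ).repr.injective ?_
      ext i
      rw [map_zero, HilbertBasis.repr_apply_apply, lp.coeFn_zero, Pi.zero_apply,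
        Submodule.inner_orthogonalProjectionOnto_eq_of_mem_left]
      exact hx _ (Submodule.subset_span ⟨⟨μ, i⟩, rfl⟩)
    exact Submodule.orthogonalProjectionOnto_eq_zero_iff.1 hz
  refine ⟨Σ μ, w μ, HilbertBasis.mkOfOrthogonalEqBot ho hsp, fun a => a.1.re, fun a => ?_,
    fun a => ?_⟩
  all_goals
    have he : A (bw a.1 a.2 : H) = a.1 • (bw a.1 a.2 : H) :=
      Module.End.mem_eigenspace_iff.1 (bw a.1 a.2).2
    have hn : ‖(bw a.1 a.2 : H)‖ = 1 := (bw a.1).orthonormal.1 a.2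
    have hin : inner ℂ (bw a.1 a.2 : H) (A (bw a.1 a.2 : H)) = a.1 := by
      rw [he, inner_smul_right, inner_self_eq_norm_sq_to_K, hn]
      simp
    have h0 : 0 ≤ a.1.re ∧ a.1.im = 0 := by
      have := hp.inner_nonneg_right (bw a.1 a.2 : H)
      rw [hin, Complex.nonneg_iff] at this
      exact ⟨this.1, this.2.symm⟩
  · exact h0.1
  · rw [HilbertBasis.coe_mkOfOrthogonalEqBot]
    change A (bw a.1 a.2 : H) = _ • (bw a.1 a.2 : H)
    rw [he]
    congr 1
    exact Complex.ext rfl h0.2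

theorem isCompactOperator_starProjection (U : Submodule ℂ H) [FiniteDimensional ℂ U] :
    IsCompactOperator U.starProjection := by
  have : ProperSpace U := FiniteDimensional.proper ℂ U
  exact (isCompactOperator_of_locallyCompactSpace_dom U.orthogonalProjectionOnto).clm_comp
    U.subtypeL

theorem orthonormal_option_elim {ι : Type} {e : ι → H} (he : Orthonormal ℂ e) {x : H}
    (hx : x ∈ (Submodule.span ℂ (Set.range e))ᗮ) (hn : ‖x‖ = 1) :
    Orthonormal ℂ fun o : Option ι => o.elim x e := by
  have h : ∀ i, inner ℂ (e i) x = 0 := fun i =>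
    (Submodule.mem_orthogonal _ _).1 hx _ (Submodule.subset_span ⟨i, rfl⟩)
  refine ⟨?_, ?_⟩
  · rintro (_ | i)
    · exact hn
    · exact he.1 i
  · rintro (_ | i) (_ | j) hij
    · exact absurd rfl hij
    · exact inner_eq_zero_symm.1 (h j)
    · exact h i
    · exact he.2 fun h => hij (by rw [h])

/-- An operator whose diagonals with respect to pairs of finite orthonormal families are uniformly
bounded in `ℓ^p` is compact. -/
theorem isCompactOperator_of_sum_inner_rpow_le {T : H →L[ℂ] H} {p M : ℝ} (hp : 0 < p)
    (h : ∀ (ι : Type) [Fintype ι] (e f : ι → H), Orthonormal ℂ e → Orthonormal ℂ f →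
      ∑ i, ‖inner ℂ (f i) (T (e i))‖ ^ p ≤ M) : IsCompactOperator T := by
  have key : ∀ ε > 0, ∃ K : H →L[ℂ] H, IsCompactOperator K ∧ ‖T - K‖ ≤ ε := by
    -- If `T` has distance greater than `ε` from every compact operator, pairs of orthonormal
    -- families of any length with all diagonal entries at least `ε` can be built one vector at a
    -- time, which contradicts the bound `M`.
    intro ε hε
    by_contra! hno
    have hind : ∀ n : ℕ, ∃ (ι : Type) (_ : Fintype ι) (e f : ι → H), Fintype.card ι = n ∧
        Orthonormal ℂ e ∧ Orthonormal ℂ f ∧ ∀ i, ε ≤ ‖inner ℂ (f i) (T (e i))‖ := by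
      intro n
      induction n with
      | zero => exact ⟨Empty, inferInstance, Empty.elim, Empty.elim, rfl,
          ⟨fun i => i.elim, fun i => i.elim⟩, ⟨fun i => i.elim, fun i => i.elim⟩, fun i => i.elim⟩
      | succ n ih =>
        obtain ⟨ι, _, e, f, hcard, he, hf, hle⟩ := ih
        have i1 : FiniteDimensional ℂ (Submodule.span ℂ (Set.range e)) :=
          FiniteDimensional.span_of_finite ℂ (Set.finite_range e)
        have i2 : FiniteDimensional ℂ (Submodule.span ℂ (Set.range f)) :=
          FiniteDimensional.span_of_finite ℂ (Set.finite_range f)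
        set U := Submodule.span ℂ (Set.range e)
        set V := Submodule.span ℂ (Set.range f)
        -- Subtracting this compact operator from `T` leaves (1 - P_V) T (1 - P_U). A vector on
        -- which the remainder exceeds `ε` yields new unit vectors orthogonal to `U` and to `V`.
        have hK : IsCompactOperator (T ∘L U.starProjection +
            V.starProjection ∘L (T - T ∘L U.starProjection)) :=
          ((isCompactOperator_starProjection U).clm_comp T).add
            ((isCompactOperator_starProjection V).comp_clm (T - T ∘L U.starProjection))
        have hbig := hno _ hK
        obtain ⟨x, hx⟩ : ∃ x, ε * ‖x‖ < ‖(T - (T ∘L U.starProjection +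
            V.starProjection ∘L (T - T ∘L U.starProjection))) x‖ := by
          by_contra! hle
          exact absurd (ContinuousLinearMap.opNorm_le_bound _ hε.le hle) (not_le.2 hbig)
        set x' := x - U.starProjection x with hx'
        set y := T x' - V.starProjection (T x') with hy
        have hy' : (T - (T ∘L U.starProjection +
            V.starProjection ∘L (T - T ∘L U.starProjection))) x = y := by
          simp [hy, hx']
          abel
        rw [hy'] at hx
        have hxU : x' ∈ Uᗮ := Submodule.sub_starProjection_mem_orthogonal x
        have hyV : y ∈ Vᗮ := Submodule.sub_starProjection_mem_orthogonal (T x')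
        have hxn : ‖x'‖ ≤ ‖x‖ := by
          rw [hx', ← Submodule.starProjection_orthogonal_val]
          exact Submodule.norm_starProjection_apply_le _ _
        have hypos : 0 < ‖y‖ := lt_of_le_of_lt (by positivity) hx
        have hxpos : 0 < ‖x'‖ := by
          rw [norm_pos_iff]
          rintro h0
          rw [hy, h0] at hypos
          simp at hypos
        refine ⟨Option ι, inferInstance, fun o => o.elim (((‖x'‖⁻¹ : ℝ) : ℂ) • x') e,
          fun o => o.elim (((‖y‖⁻¹ : ℝ) : ℂ) • y) f, by rw [Fintype.card_option, hcard],
          orthonormal_option_elim he (Submodule.smul_mem _ _ hxU) ?_,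
          orthonormal_option_elim hf (Submodule.smul_mem _ _ hyV) ?_, ?_⟩
        · rw [norm_smul, Complex.norm_real, norm_inv, norm_norm, inv_mul_cancel₀ hxpos.ne']
        · rw [norm_smul, Complex.norm_real, norm_inv, norm_norm, inv_mul_cancel₀ hypos.ne']
        · rintro (_ | i)
          · have hin : inner ℂ y (T x') = ((‖y‖ ^ 2 : ℝ) : ℂ) := by
              have : T x' = y + V.starProjection (T x') := by rw [hy]; abel
              rw [this, inner_add_right, Submodule.inner_left_of_mem_orthogonal
                (Submodule.starProjection_apply_mem _ _) hyV, add_zero, inner_self_eq_norm_sq_to_K]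
              norm_cast
            change ε ≤ ‖inner ℂ (((‖y‖⁻¹ : ℝ) : ℂ) • y) (T (((‖x'‖⁻¹ : ℝ) : ℂ) • x'))‖
            rw [map_smul, inner_smul_left, inner_smul_right, hin, norm_mul, norm_mul,
              RCLike.norm_conj, Complex.norm_real, Complex.norm_real, Complex.norm_real, norm_inv,
              norm_inv, norm_norm, norm_norm, norm_pow, norm_norm]
            have : ‖y‖⁻¹ * (‖x'‖⁻¹ * ‖y‖ ^ 2) = ‖y‖ / ‖x'‖ := by field_simp
            rw [this, le_div_iff₀ hxpos]
            exact (mul_le_mul_of_nonneg_left hxn hε.le).trans hx.le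
          · exact hle i
    obtain ⟨n, hn⟩ := exists_nat_gt (M / ε ^ p)
    obtain ⟨ι, _, e, f, hcard, he, hf, hle⟩ := hind n
    have h1 : ∑ _i : ι, ε ^ p ≤ M := (Finset.sum_le_sum fun i _ =>
      Real.rpow_le_rpow hε.le (hle i) hp.le).trans (h ι e f he hf)
    rw [Finset.sum_const, Finset.card_univ, hcard, nsmul_eq_mul] at h1
    rw [div_lt_iff₀ (by positivity)] at hn
    linarith
  have hcl : T ∈ closure { f : H →L[ℂ] H | IsCompactOperator f } := by
    rw [Metric.mem_closure_iff]
    intro ε hε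
    obtain ⟨K, hK, hle⟩ := key (ε / 2) (by positivity)
    exact ⟨K, hK, by rw [dist_eq_norm]; linarith⟩
  exact isClosed_setOfPred_isCompactOperator.closure_subset hcl

end SchattenClass

/-! ### Schatten norms through singular values. -/

section SchattenNorm

variable {H : Type} [NormedAddCommGroup H] [InnerProductSpace ℂ H] [CompleteSpace H]

theorem inner_apply_apply_of_eigenvector {T : H →L[ℂ] H} {x y : H} {s : ℝ}
    (h : (star T * T) y = (s : ℂ) • y) : inner ℂ (T x) (T y) = s * inner ℂ x y := by
  rw [← inner_smul_right, ← h, mul_apply_eq_comp, ContinuousLinearMap.star_eq_adjoint,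
    ContinuousLinearMap.adjoint_inner_right]

/-- The left singular vectors belonging to an orthonormal family of right singular vectors. -/
theorem orthonormal_leftSingularVectors {T : H →L[ℂ] H} {ι : Type} {e : ι → H}
    (he : Orthonormal ℂ e) {s : ι → ℝ} (hs : ∀ i, 0 < s i)
    (h : ∀ i, (star T * T) (e i) = (s i : ℂ) • e i) :
    Orthonormal ℂ fun i => (((√(s i))⁻¹ : ℝ) : ℂ) • T (e i) := by
  classical
  rw [orthonormal_iff_ite] at he ⊢
  intro i j
  rw [inner_smul_left, inner_smul_right, inner_apply_apply_of_eigenvector (h j), he,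
    Complex.conj_ofReal]
  split_ifs with hij
  · subst hij
    have h1 : (√(s i))⁻¹ * ((√(s i))⁻¹ * s i) = 1 := by
      have := Real.sqrt_pos.2 (hs i)
      nth_rewrite 3 [← Real.mul_self_sqrt (hs i).le]
      field_simp
    rw [mul_one]
    exact_mod_cast h1
  · simp

theorem posTrace_eq_of_eigenvectors {ι : Type} (b : HilbertBasis ι ℂ H) {S : H →L[ℂ] H}
    (hS : 0 ≤ S) {s : ι → ℝ} (h : ∀ i, S (b i) = (s i : ℂ) • b i) :
    posTrace S = ∑' i, ENNReal.ofReal (s i) := by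
  rw [posTrace_eq b ((ContinuousLinearMap.nonneg_iff_isPositive S).1 hS)]
  refine tsum_congr fun i => ?_
  rw [h, inner_smul_left, inner_self_eq_norm_sq_to_K, b.orthonormal.1 i, Complex.conj_ofReal]
  simp

/-- Upper bound for Schatten norms by diagonals with respect to orthonormal families. -/
theorem schattenNorm_le_of_sum_inner_le {T : H →L[ℂ] H} {p : ℝ≥0∞} (hp1 : 1 ≤ p) (hp : p ≠ ⊤)
    {M : ℝ≥0∞} (hM : M ≠ ⊤)
    (h : ∀ (ι : Type) [Fintype ι] (e f : ι → H), Orthonormal ℂ e → Orthonormal ℂ f →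
      ∑ i, ‖inner ℂ (f i) (T (e i))‖ₑ ^ p.toReal ≤ M ^ p.toReal) :
    schattenNorm p T ≤ M := by
  have hr : 0 < p.toReal := ENNReal.toReal_pos (by positivity) hp
  set r := p.toReal
  have hT : IsCompactOperator T := by
    refine isCompactOperator_of_sum_inner_rpow_le (M := (M ^ r).toReal) hr fun ι _ e f he hf => ?_
    have h1 := ENNReal.toReal_mono (ENNReal.rpow_ne_top_of_nonneg hr.le hM) (h ι e f he hf)
    rw [ENNReal.toReal_sum fun i _ => ENNReal.rpow_ne_top_of_nonneg hr.le enorm_ne_top] at h1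
    simpa [← ENNReal.toReal_rpow] using h1
  have hA : 0 ≤ star T * T := star_mul_self_nonneg T
  obtain ⟨ι, b, s, hs, hb⟩ := exists_hilbertBasis_eigenvectors hA (hT.clm_comp (star T))
  rw [schattenNorm, if_neg hp, posTrace_eq_of_eigenvectors b CFC.rpow_nonneg
    (fun i => rpow_apply_of_apply_eq_smul hA (hs i) (hb i) (by positivity : 0 < r / 2))]
  suffices hsum : ∑' i, ENNReal.ofReal (s i ^ (r / 2)) ≤ M ^ r by
    calc _ ≤ (M ^ r) ^ (1 / r) := ENNReal.rpow_le_rpow hsum (by positivity)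
      _ = M := by rw [← ENNReal.rpow_mul, mul_one_div_cancel hr.ne', ENNReal.rpow_one]
  classical
  rw [ENNReal.tsum_eq_iSup_sum]
  -- Zero eigenvalues contribute nothing. For the others the test families are the eigenvectors e_i
  -- and the left singular vectors T e_i / √s_i, for which the diagonal entry is √s_i.
  refine iSup_le fun F => ?_
  set F' := F.filter fun i => 0 < s i
  have hpos : ∀ i : F', 0 < s i := fun i => (Finset.mem_filter.1 i.2).2
  have he : Orthonormal ℂ fun i : F' => b i :=
    b.orthonormal.comp Subtype.val Subtype.val_injective
  calc ∑ i ∈ F, ENNReal.ofReal (s i ^ (r / 2))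
      = ∑ i ∈ F', ENNReal.ofReal (s i ^ (r / 2)) := by
        refine (Finset.sum_filter_of_ne fun i _ hi => ?_).symm
        by_contra h0
        refine hi ?_
        rw [le_antisymm (not_lt.1 h0) (hs i), Real.zero_rpow (by positivity), ENNReal.ofReal_zero]
    _ = ∑ i : F', ENNReal.ofReal (s i ^ (r / 2)) := (Finset.sum_coe_sort _ _).symm
    _ = ∑ i : F', ‖inner ℂ ((((√(s i))⁻¹ : ℝ) : ℂ) • T (b i)) (T (b i))‖ₑ ^ r := by
        refine Finset.sum_congr rfl fun i _ => ?_
        have h1 : inner ℂ ((((√(s i))⁻¹ : ℝ) : ℂ) • T (b i)) (T (b i)) = ((√(s i) : ℝ) : ℂ) := by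
          rw [inner_smul_left, inner_apply_apply_of_eigenvector (hb i),
            inner_self_eq_norm_sq_to_K, b.orthonormal.1 i, Complex.conj_ofReal]
          have : (√(s i))⁻¹ * s i = √(s i) := by
            nth_rewrite 2 [← Real.mul_self_sqrt (hs i)]
            have := Real.sqrt_pos.2 (hpos i)
            field_simp
          simpa using congrArg (fun x : ℝ => (x : ℂ)) this
        rw [h1, ← ofReal_norm, Complex.norm_real, Real.norm_of_nonneg (Real.sqrt_nonneg _),
          ENNReal.ofReal_rpow_of_nonneg (Real.sqrt_nonneg _) hr.le, Real.sqrt_eq_rpow,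
          ← Real.rpow_mul (hs i)]
        congr 2
        ring
    _ ≤ M ^ r := h F' _ _ he (orthonormal_leftSingularVectors he hpos fun i => hb i)

/-- Finite trace of B² says that B is Hilbert–Schmidt. By Parseval and Bessel the sum of ‖B e_i‖²
over any finite orthonormal family is at most that trace, so the compactness criterion applies with
exponent 2. -/
theorem isCompactOperator_of_posTrace_sq_ne_top {B : H →L[ℂ] H} (hB : 0 ≤ B)
    (h : posTrace (B * B) ≠ ⊤) : IsCompactOperator B := by
  have hp : B.IsPositive := (ContinuousLinearMap.nonneg_iff_isPositive B).1 hB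
  have hsym : ∀ v w, inner ℂ (B v) w = inner ℂ v (B w) := fun v w => hp.isSymmetric v w
  obtain ⟨w, b, -⟩ := exists_hilbertBasis ℂ H
  have hBB : (B * B).IsPositive := by
    rw [← ContinuousLinearMap.nonneg_iff_isPositive]
    simpa [(IsSelfAdjoint.of_nonneg hB).star_eq] using star_mul_self_nonneg B
  have htr : posTrace (B * B) = ∑' j, ENNReal.ofReal (‖B (b j)‖ ^ 2) := by
    rw [posTrace_eq b hBB]
    refine tsum_congr fun j => ?_
    rw [mul_apply_eq_comp, hsym, inner_self_eq_norm_sq]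
  refine isCompactOperator_of_sum_inner_rpow_le (p := 2) (M := (posTrace (B * B)).toReal)
    (by norm_num) fun ι _ e f he hf => ?_
  rw [← ENNReal.ofReal_le_iff_le_toReal h, htr, ENNReal.ofReal_sum_of_nonneg
    fun i _ => by positivity]
  calc ∑ i, ENNReal.ofReal (‖inner ℂ (f i) (B (e i))‖ ^ (2 : ℝ))
      ≤ ∑ i, ENNReal.ofReal (‖B (e i)‖ ^ 2) := by
        refine Finset.sum_le_sum fun i _ => ENNReal.ofReal_le_ofReal ?_
        rw [Real.rpow_two]
        gcongr
        simpa [hf.1 i] using norm_inner_le_norm (𝕜 := ℂ) (f i) (B (e i))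
    _ = ∑ i, ∑' j, ENNReal.ofReal (‖inner ℂ (b j) (B (e i))‖ ^ 2) := by
        simp_rw [tsum_parseval]
    _ = ∑' j, ∑ i, ENNReal.ofReal (‖inner ℂ (e i) (B (b j))‖ ^ 2) := by
        rw [← Summable.tsum_finsetSum fun _ _ => ENNReal.summable]
        refine tsum_congr fun j => Finset.sum_congr rfl fun i _ => ?_
        rw [← hsym, norm_inner_symm]
    _ ≤ _ := by
        refine ENNReal.tsum_le_tsum fun j => ?_
        rw [← ENNReal.ofReal_sum_of_nonneg fun i _ => by positivity]
        exact ENNReal.ofReal_le_ofReal (he.sum_inner_products_le _)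

/-- Singular value decomposition of an operator with finite Schatten norm, as an estimate for its
matrix coefficients. -/
theorem exists_singularValues {T : H →L[ℂ] H} {p : ℝ≥0∞} (hp1 : 1 ≤ p) (hp : p ≠ ⊤)
    (hT : schattenNorm p T ≠ ⊤) :
    ∃ (ι : Type) (_ : Countable ι) (e f : ι → H) (s : ι → ℝ≥0∞),
      Orthonormal ℂ e ∧ Orthonormal ℂ f ∧
      (∀ x y, ‖inner ℂ y (T x)‖ₑ ≤ ∑' i, s i * (‖inner ℂ (e i) x‖ₑ * ‖inner ℂ y (f i)‖ₑ)) ∧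
      ∑' i, s i ^ p.toReal ≤ schattenNorm p T ^ p.toReal := by
  have hr : 0 < p.toReal := ENNReal.toReal_pos (by positivity) hp
  rw [schattenNorm, if_neg hp] at hT ⊢
  set r := p.toReal
  have hA : 0 ≤ star T * T := star_mul_self_nonneg T
  set C := (star T * T) ^ (r / 2) with hCdef
  have hC : 0 ≤ C := CFC.rpow_nonneg
  have htr : posTrace C ≠ ⊤ := fun h => hT (by rw [h, ENNReal.top_rpow_of_pos (by positivity)])
  -- Compactness is not assumed: |T|^p has finite trace, so its square root is Hilbert–Schmidt and
  -- hence compact.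
  have hCc : IsCompactOperator C := by
    have h1 := CFC.sqrt_mul_sqrt_self C hC
    have h2 := isCompactOperator_of_posTrace_sq_ne_top (CFC.sqrt_nonneg C) (by rwa [h1])
    rw [← h1]
    exact h2.clm_comp (CFC.sqrt C)
  obtain ⟨ι, b, μ, hμ, hb⟩ := exists_hilbertBasis_eigenvectors hC hCc
  have hAC : C ^ (2 / r) = star T * T := by
    rw [hCdef, CFC.rpow_rpow_of_exponent_nonneg _ _ _ (by positivity) (by positivity),
      show r / 2 * (2 / r) = 1 by field_simp, CFC.rpow_one _ hA]
  -- An eigenbasis of |T|^p also diagonalises T*T, so the singular values are μ_i^{1/p}. The kernel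
  -- directions are dropped; what remains is countable because Σ μ_i is finite.
  have hbA : ∀ i, (star T * T) (b i) = ((μ i ^ (2 / r) : ℝ) : ℂ) • b i := fun i => by
    rw [← hAC]
    exact rpow_apply_of_apply_eq_smul hC (hμ i) (hb i) (by positivity)
  have htr' := posTrace_eq_of_eigenvectors b hC hb
  have hcount : Countable {i // 0 < μ i} := by
    refine (Summable.countable_support_ennreal (htr' ▸ htr)).mono fun i hi => ?_
    exact (ENNReal.ofReal_pos.2 hi).ne'
  have hpos : ∀ i : {i // 0 < μ i}, 0 < μ i ^ (2 / r) := fun i => Real.rpow_pos_of_pos i.2 _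
  have he : Orthonormal ℂ fun i : {i // 0 < μ i} => b i :=
    b.orthonormal.comp Subtype.val Subtype.val_injective
  have hsq : ∀ i, √(μ i ^ (2 / r)) = μ i ^ (1 / r) := fun i => by
    rw [Real.sqrt_eq_rpow, ← Real.rpow_mul (hμ i)]
    congr 1
    ring
  refine ⟨{i // 0 < μ i}, hcount, _, _, fun i => ENNReal.ofReal (μ i ^ (1 / r)), he,
    orthonormal_leftSingularVectors he hpos fun i => hbA i, fun x y => ?_, ?_⟩
  · have hsum : HasSum (fun i => inner ℂ (b i) x * inner ℂ y (T (b i))) (inner ℂ y (T x)) := by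
      have := ((b.hasSum_repr x).mapL T).mapL (innerSL ℂ y)
      simpa [HilbertBasis.repr_apply_apply] using this
    have hzero : ∀ i, ¬ 0 < μ i → T (b i) = 0 := fun i hi => by
      have h0 : μ i = 0 := le_antisymm (not_lt.1 hi) (hμ i)
      have := inner_apply_apply_of_eigenvector (x := b i) (hbA i)
      rw [h0, Real.zero_rpow (by positivity)] at this
      simpa using this
    rw [← hsum.tsum_eq]
    refine (enorm_tsum_le_tsum_enorm).trans ?_
    rw [← tsum_subtype_eq_of_support_subset (s := {i | 0 < μ i})]
    · refine le_of_eq (tsum_congr fun i => ?_)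
      rw [enorm_mul, inner_smul_right, enorm_mul, mul_left_comm, hsq]
      congr 1
      have h0 := Real.rpow_pos_of_pos i.2 (1 / r)
      have h1 : ‖(((μ i ^ (1 / r))⁻¹ : ℝ) : ℂ)‖ₑ = ENNReal.ofReal (μ i ^ (1 / r))⁻¹ := by
        rw [← ofReal_norm, Complex.norm_real, Real.norm_of_nonneg (by positivity)]
      rw [← mul_assoc, h1, ← ENNReal.ofReal_mul h0.le, mul_inv_cancel₀ h0.ne', ENNReal.ofReal_one,
        one_mul]
    · intro i hi
      by_contra h
      exact hi (by simp [hzero i h])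
  · rw [← ENNReal.rpow_mul, one_div_mul_cancel hr.ne', ENNReal.rpow_one, htr']
    calc ∑' i : {i // 0 < μ i}, ENNReal.ofReal (μ i ^ (1 / r)) ^ r
        = ∑' i : {i // 0 < μ i}, ENNReal.ofReal (μ i) := by
          refine tsum_congr fun i => ?_
          rw [ENNReal.ofReal_rpow_of_nonneg (Real.rpow_nonneg (hμ i) _) hr.le, ← Real.rpow_mul (hμ i),
            one_div_mul_cancel hr.ne', Real.rpow_one]
      _ ≤ _ := ENNReal.tsum_comp_le_tsum_of_injective Subtype.val_injective _

end SchattenNorm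

/-! ### Schur's test. -/

section Schur

variable {Z N : Type} [MeasurableSpace Z] [MeasurableSpace N] {μ : Measure Z} {ν : Measure N}

theorem lintegral_mul_le_of_lintegral_sq_le {f g : Z → ℝ≥0∞} (hf : Measurable f)
    (hg : Measurable g) {A B : ℝ≥0∞} (hA : ∫⁻ z, f z ^ 2 ∂μ ≤ A ^ 2)
    (hB : ∫⁻ z, g z ^ 2 ∂μ ≤ B ^ 2) : ∫⁻ z, f z * g z ∂μ ≤ A * B := by
  have hsq : ∀ x : ℝ≥0∞, (x ^ 2) ^ (1 / 2 : ℝ) = x := fun x => by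
    rw [← ENNReal.rpow_natCast, ← ENNReal.rpow_mul]
    norm_num
  have h := ENNReal.lintegral_mul_norm_pow_le (μ := μ) (hf.pow_const 2).aemeasurable
    (hg.pow_const 2).aemeasurable (p := 1 / 2) (q := 1 / 2) (by norm_num) (by norm_num)
    (by norm_num)
  simp_rw [hsq] at h
  refine h.trans ?_
  calc _ ≤ (A ^ 2) ^ (1 / 2 : ℝ) * (B ^ 2) ^ (1 / 2 : ℝ) := by gcongr
    _ = A * B := by rw [hsq, hsq]

/-- Schur's test in `L^p`. -/
theorem lintegral_rpow_lintegral_mul_le [SFinite μ] [SFinite ν] {k : Z → N → ℝ≥0∞}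
    (hk : Measurable (Function.uncurry k)) {c : ℝ≥0∞} (h1 : ∀ n, ∫⁻ z, k z n ∂μ ≤ c)
    (h2 : ∀ z, ∫⁻ n, k z n ∂ν ≤ c) {F : Z → ℝ≥0∞} (hF : Measurable F) {p : ℝ} (hp : 1 ≤ p) :
    ∫⁻ n, (∫⁻ z, F z * k z n ∂μ) ^ p ∂ν ≤ c ^ p * ∫⁻ z, F z ^ p ∂μ := by
  have hp0 : 0 < p := by linarith
  have hkz : ∀ n, Measurable fun z => k z n := fun n => hk.of_uncurry_right
  have hkn : ∀ z, Measurable fun n => k z n := fun z => hk.of_uncurry_left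
  have hq : 0 ≤ 1 - 1 / p := by
    rw [sub_nonneg, div_le_one hp0]; exact hp
  -- Hölder after splitting F k = (F^p k)^{1/p} · k^{1-1/p}. The exponents 1/p and 1 - 1/p include
  -- the case p = 1.
  have hH : ∀ n, (∫⁻ z, F z * k z n ∂μ) ^ p ≤ c ^ (p - 1) * ∫⁻ z, F z ^ p * k z n ∂μ := by
    intro n
    have h := ENNReal.lintegral_mul_norm_pow_le (μ := μ)
      ((hF.pow_const p).mul (hkz n)).aemeasurable (hkz n).aemeasurable (p := 1 / p)
      (q := 1 - 1 / p) (by positivity) hq (by ring)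
    have e : ∀ z, (F z ^ p * k z n) ^ (1 / p) * k z n ^ (1 - 1 / p) = F z * k z n := fun z => by
      rw [ENNReal.mul_rpow_of_nonneg _ _ (by positivity), ← ENNReal.rpow_mul,
        mul_one_div_cancel hp0.ne', ENNReal.rpow_one, mul_assoc,
        ← ENNReal.rpow_add_of_nonneg _ _ (by positivity) hq, add_sub_cancel, ENNReal.rpow_one]
    simp only [Pi.mul_apply, e] at h
    calc (∫⁻ z, F z * k z n ∂μ) ^ p
        ≤ ((∫⁻ z, F z ^ p * k z n ∂μ) ^ (1 / p) * (∫⁻ z, k z n ∂μ) ^ (1 - 1 / p)) ^ p := by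
          gcongr
      _ = (∫⁻ z, k z n ∂μ) ^ (p - 1) * ∫⁻ z, F z ^ p * k z n ∂μ := by
          rw [ENNReal.mul_rpow_of_nonneg _ _ hp0.le, ← ENNReal.rpow_mul, ← ENNReal.rpow_mul,
            one_div_mul_cancel hp0.ne', ENNReal.rpow_one, mul_comm]
          congr 2
          field_simp
      _ ≤ _ := by gcongr; exact h1 n
  calc ∫⁻ n, (∫⁻ z, F z * k z n ∂μ) ^ p ∂ν
      ≤ ∫⁻ n, c ^ (p - 1) * ∫⁻ z, F z ^ p * k z n ∂μ ∂ν := lintegral_mono hH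
    _ = c ^ (p - 1) * ∫⁻ z, ∫⁻ n, F z ^ p * k z n ∂ν ∂μ := by
        have hm : Measurable (Function.uncurry fun (n : N) (z : Z) => F z ^ p * k z n) :=
          ((hF.pow_const p).comp measurable_snd).mul (hk.comp measurable_swap)
        rw [lintegral_const_mul _ hm.lintegral_prod_right, lintegral_lintegral_swap hm.aemeasurable]
    _ ≤ c ^ (p - 1) * ∫⁻ z, F z ^ p * c ∂μ := by
        gcongr with z
        rw [lintegral_const_mul _ (hkn z)]
        gcongr
        exact h2 z
    _ = c ^ p * ∫⁻ z, F z ^ p ∂μ := by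
        rw [lintegral_mul_const _ (hF.pow_const p), mul_comm _ c, ← mul_assoc]
        congr 1
        nth_rewrite 2 [← ENNReal.rpow_one c]
        rw [← ENNReal.rpow_add_of_nonneg _ _ (by linarith) zero_le_one, sub_add_cancel]

end Schur

/-! ### Bessel families and the kernels they produce. -/

section Subframe

variable {H : Type} [NormedAddCommGroup H] [InnerProductSpace ℂ H]
  {Z Ω : Type} [MeasurableSpace Z] [MeasurableSpace Ω]

/-- A measurable family of vectors of norm at most one that, for each parameter `ω`, satisfies
Bessel's inequality in the variable `z`. -/
structure IsBesselFamily (μ : Measure Z) (a : Z × Ω → H) : Prop where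
  stronglyMeasurable : StronglyMeasurable a
  norm_le_one : ∀ q, ‖a q‖ₑ ≤ 1
  lintegral_le : ∀ ω g, ∫⁻ z, ‖inner ℂ (a (z, ω)) g‖ₑ ^ 2 ∂μ ≤ ‖g‖ₑ ^ 2

/-- The function `z ↦ ∫ m(ω) |⟨a(z, ω), e⟩| |⟨f, b(z, ω)⟩| dω`. -/
def dyadKernel (ν : Measure Ω) (m : Ω → ℝ≥0∞) (a b : Z × Ω → H) (e f : H) (z : Z) : ℝ≥0∞ :=
  ∫⁻ ω, m ω * (‖inner ℂ (a (z, ω)) e‖ₑ * ‖inner ℂ f (b (z, ω))‖ₑ) ∂ν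

variable {μ : Measure Z} {ν : Measure Ω} {m : Ω → ℝ≥0∞} {a b : Z × Ω → H}

theorem IsBesselFamily.measurable_inner_left (ha : IsBesselFamily μ a) (g : H) :
    Measurable fun q => ‖inner ℂ (a q) g‖ₑ :=
  (ha.stronglyMeasurable.inner stronglyMeasurable_const).enorm

theorem IsBesselFamily.measurable_inner_right (ha : IsBesselFamily μ a) (g : H) :
    Measurable fun q => ‖inner ℂ g (a q)‖ₑ :=
  (stronglyMeasurable_const.inner ha.stronglyMeasurable).enorm

theorem enorm_inner_symm (x y : H) : ‖inner ℂ x y‖ₑ = ‖inner ℂ y x‖ₑ := by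
  rw [← ofReal_norm, norm_inner_symm, ofReal_norm]

theorem enorm_inner_le (x y : H) : ‖inner ℂ x y‖ₑ ≤ ‖x‖ₑ * ‖y‖ₑ := by
  rw [← ofReal_norm, ← ofReal_norm, ← ofReal_norm, ← ENNReal.ofReal_mul (norm_nonneg _)]
  exact ENNReal.ofReal_le_ofReal (norm_inner_le_norm x y)

theorem measurable_dyad_integrand (ha : IsBesselFamily μ a) (hb : IsBesselFamily μ b)
    (hm : Measurable m) (e f : H) :
    Measurable fun q : Z × Ω => m q.2 * (‖inner ℂ (a q) e‖ₑ * ‖inner ℂ f (b q)‖ₑ) :=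
  (hm.comp measurable_snd).mul ((ha.measurable_inner_left e).mul (hb.measurable_inner_right f))

theorem measurable_dyadKernel [SFinite ν] (ha : IsBesselFamily μ a) (hb : IsBesselFamily μ b)
    (hm : Measurable m) (e f : H) : Measurable (dyadKernel ν m a b e f) :=
  (measurable_dyad_integrand ha hb hm e f).lintegral_prod_right'

theorem dyadKernel_le (ha : IsBesselFamily μ a) (hb : IsBesselFamily μ b)
    (hm : Measurable m) (e f : H) (z : Z) :
    dyadKernel ν m a b e f z ≤ (∫⁻ ω, m ω ∂ν) * (‖e‖ₑ * ‖f‖ₑ) := by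
  rw [← lintegral_mul_const _ hm]
  refine lintegral_mono fun ω => ?_
  gcongr
  · exact (enorm_inner_le _ _).trans (mul_le_of_le_one_left' (ha.norm_le_one _))
  · exact (enorm_inner_le _ _).trans (mul_le_of_le_one_right' (hb.norm_le_one _))

/-- First Schur hypothesis. For each ω, Cauchy–Schwarz in z and Bessel's inequality for both
families bound the inner integral by ‖e‖‖f‖; then `m` is integrated. -/
theorem lintegral_dyadKernel_le [SFinite μ] [SFinite ν] (ha : IsBesselFamily μ a)
    (hb : IsBesselFamily μ b) (hm : Measurable m) (e f : H) :
    ∫⁻ z, dyadKernel ν m a b e f z ∂μ ≤ (∫⁻ ω, m ω ∂ν) * (‖e‖ₑ * ‖f‖ₑ) := by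
  unfold dyadKernel
  rw [lintegral_lintegral_swap (measurable_dyad_integrand ha hb hm e f).aemeasurable,
    ← lintegral_mul_const _ hm]
  refine lintegral_mono fun ω => ?_
  have h1 : Measurable fun z => ‖inner ℂ (a (z, ω)) e‖ₑ :=
    (ha.measurable_inner_left e).comp measurable_prodMk_right
  have h2 : Measurable fun z => ‖inner ℂ f (b (z, ω))‖ₑ :=
    (hb.measurable_inner_right f).comp measurable_prodMk_right
  rw [lintegral_const_mul _ (show Measurable fun z =>
    ‖inner ℂ (a (z, ω)) e‖ₑ * ‖inner ℂ f (b (z, ω))‖ₑ from h1.mul h2)]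
  gcongr
  refine lintegral_mul_le_of_lintegral_sq_le h1 h2 (ha.lintegral_le ω e) ?_
  simp_rw [enorm_inner_symm f]
  exact hb.lintegral_le ω f

theorem tsum_enorm_inner_sq_le {ι : Type} {e : ι → H} (he : Orthonormal ℂ e) (x : H) :
    ∑' i, ‖inner ℂ (e i) x‖ₑ ^ 2 ≤ ‖x‖ₑ ^ 2 := by
  have h : ∀ i, ‖inner ℂ (e i) x‖ₑ ^ 2 = ENNReal.ofReal (‖inner ℂ (e i) x‖ ^ 2) := fun i => by
    rw [← ofReal_norm, ENNReal.ofReal_pow (norm_nonneg _)]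
  simp_rw [h]
  rw [← ENNReal.ofReal_tsum_of_nonneg (fun i => by positivity) (he.inner_products_summable x),
    ← ofReal_norm, ← ENNReal.ofReal_pow (norm_nonneg _)]
  exact ENNReal.ofReal_le_ofReal (he.tsum_inner_products_le x)

/-- Second Schur hypothesis. The Bessel inequality is now that of the orthonormal families `e` and
`f`, tested on the vectors a(z, ω) and b(z, ω) of norm at most one. -/
theorem tsum_dyadKernel_le {ι : Type} [Countable ι] (ha : IsBesselFamily μ a)
    (hb : IsBesselFamily μ b) (hm : Measurable m) {e f : ι → H} (he : Orthonormal ℂ e)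
    (hf : Orthonormal ℂ f) (z : Z) :
    ∑' i, dyadKernel ν m a b (e i) (f i) z ≤ ∫⁻ ω, m ω ∂ν := by
  unfold dyadKernel
  have hmeas : ∀ i, Measurable fun ω =>
      m ω * (‖inner ℂ (a (z, ω)) (e i)‖ₑ * ‖inner ℂ (f i) (b (z, ω))‖ₑ) := fun i =>
    (measurable_dyad_integrand ha hb hm (e i) (f i)).comp measurable_prodMk_left
  rw [← lintegral_tsum fun i => (hmeas i).aemeasurable]
  refine lintegral_mono fun ω => ?_
  rw [ENNReal.tsum_mul_left]
  refine mul_le_of_le_one_right' ?_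
  -- Sums over `ι` become integrals for the counting measure, so the integral form of Cauchy–Schwarz
  -- serves for them as well.
  let _ : MeasurableSpace ι := ⊤
  have := lintegral_mul_le_of_lintegral_sq_le (μ := (Measure.count : Measure ι))
    (f := fun i => ‖inner ℂ (a (z, ω)) (e i)‖ₑ) (g := fun i => ‖inner ℂ (f i) (b (z, ω))‖ₑ)
    (A := 1) (B := 1) (measurable_from_top) (measurable_from_top) ?_ ?_
  · simpa [lintegral_count] using this
  · simp_rw [enorm_inner_symm (a (z, ω))]
    rw [lintegral_count]
    exact (tsum_enorm_inner_sq_le he _).trans (by gcongr; exact ha.norm_le_one _)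
  · rw [lintegral_count]
    exact (tsum_enorm_inner_sq_le hf _).trans (by gcongr; exact hb.norm_le_one _)

end Subframe

/-! ### Schatten and L^p estimates for superpositions of rank-one operators. -/

section DyadOperator

variable {H : Type} [NormedAddCommGroup H] [InnerProductSpace ℂ H] [CompleteSpace H]
  {Z Ω : Type} [MeasurableSpace Z] [MeasurableSpace Ω]
  {μ : Measure Z} {ν : Measure Ω} [SFinite μ] [SFinite ν] {m : Ω → ℝ≥0∞} {a b : Z × Ω → H}
  {M : Z × Ω → ℂ}

theorem measurable_uncurry_dyadKernel {ι : Type} [Countable ι] [MeasurableSpace ι]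
    [MeasurableSingletonClass ι] (ha : IsBesselFamily μ a) (hb : IsBesselFamily μ b)
    (hm : Measurable m) (e f : ι → H) :
    Measurable (Function.uncurry fun z i => dyadKernel ν m a b (e i) (f i) z) :=
  measurable_from_prod_countable_left fun i => measurable_dyadKernel ha hb hm (e i) (f i)

/-- A kernel bounded by c in both L^1 and L^∞ has every dual L^q norm at most c. For finite p this
is Schur's test with a one-point second space. -/
theorem lintegral_enorm_mul_le {p : ℝ≥0∞} (hp : 1 ≤ p) {F : Z → ℂ} (hF : StronglyMeasurable F)
    {k : Z → ℝ≥0∞} (hk : Measurable k) {c : ℝ≥0∞} (h1 : ∀ z, k z ≤ c) (h2 : ∫⁻ z, k z ∂μ ≤ c) :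
    ∫⁻ z, ‖F z‖ₑ * k z ∂μ ≤ c * eLpNorm F p μ := by
  by_cases hpt : p = ⊤
  · subst hpt
    calc ∫⁻ z, ‖F z‖ₑ * k z ∂μ ≤ ∫⁻ z, eLpNorm F ⊤ μ * k z ∂μ := by
          refine lintegral_mono_ae ?_
          rw [eLpNorm_exponent_top]
          filter_upwards [ae_le_eLpNormEssSup (f := F) (μ := μ)] with z hz
          gcongr
      _ ≤ _ := by
          rw [lintegral_const_mul _ hk, mul_comm]
          gcongr
  · have hr : 1 ≤ p.toReal := by
      rw [← ENNReal.toReal_one]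
      exact ENNReal.toReal_mono hpt hp
    have hr0 : 0 < p.toReal := by linarith
    have := lintegral_rpow_lintegral_mul_le (μ := μ) (ν := Measure.dirac ())
      (k := fun z _ => k z) (hk.comp measurable_fst) (fun _ => h2)
      (fun z => by simpa using h1 z) hF.enorm hr
    rw [lintegral_dirac] at this
    rw [eLpNorm_eq_lintegral_rpow_enorm_toReal (by positivity) hpt]
    calc ∫⁻ z, ‖F z‖ₑ * k z ∂μ = ((∫⁻ z, ‖F z‖ₑ * k z ∂μ) ^ p.toReal) ^ (1 / p.toReal) := by
          rw [← ENNReal.rpow_mul, mul_one_div_cancel hr0.ne', ENNReal.rpow_one]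
      _ ≤ (c ^ p.toReal * ∫⁻ z, ‖F z‖ₑ ^ p.toReal ∂μ) ^ (1 / p.toReal) := by gcongr
      _ = _ := by
          rw [ENNReal.mul_rpow_of_nonneg _ _ (by positivity), ← ENNReal.rpow_mul,
            mul_one_div_cancel hr0.ne', ENNReal.rpow_one]

theorem lintegral_dyad_le (ha : IsBesselFamily μ a) (hb : IsBesselFamily μ b) (hm : Measurable m)
    (hMm : ∀ q, ‖M q‖ₑ ≤ m q.2) {F : Z → ℂ} (hF : StronglyMeasurable F) (e f : H) :
    ∫⁻ q, ‖F q.1 * (M q * (inner ℂ (a q) e * inner ℂ f (b q)))‖ₑ ∂μ.prod ν ≤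
      ∫⁻ z, ‖F z‖ₑ * dyadKernel ν m a b e f z ∂μ := by
  have h1 : Measurable fun q : Z × Ω =>
      ‖F q.1‖ₑ * (m q.2 * (‖inner ℂ (a q) e‖ₑ * ‖inner ℂ f (b q)‖ₑ)) :=
    (hF.enorm.comp measurable_fst).mul (measurable_dyad_integrand ha hb hm e f)
  calc _ ≤ ∫⁻ q, ‖F q.1‖ₑ * (m q.2 * (‖inner ℂ (a q) e‖ₑ * ‖inner ℂ f (b q)‖ₑ)) ∂μ.prod ν := by
        refine lintegral_mono fun q => ?_
        rw [enorm_mul, enorm_mul, enorm_mul]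
        gcongr
        exact hMm q
    _ = _ := by
        rw [lintegral_prod _ h1.aemeasurable]
        refine lintegral_congr fun z => ?_
        rw [dyadKernel, ← lintegral_const_mul]
        exact (measurable_dyad_integrand ha hb hm e f).comp measurable_prodMk_left

theorem stronglyMeasurable_dyad (ha : IsBesselFamily μ a) (hb : IsBesselFamily μ b)
    (hM : StronglyMeasurable M) {F : Z → ℂ} (hF : StronglyMeasurable F) (e f : H) :
    StronglyMeasurable fun q : Z × Ω => F q.1 * (M q * (inner ℂ (a q) e * inner ℂ f (b q))) :=
  (hF.comp_measurable measurable_fst).mul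
    (hM.mul ((ha.stronglyMeasurable.inner stronglyMeasurable_const).mul
      (stronglyMeasurable_const.inner hb.stronglyMeasurable)))

/-- The operator `∫∫ F(z) M(z, ω) ⟨a(z, ω), ·⟩ b(z, ω) dω dz` and its Schatten norms. -/
theorem exists_dyadOperator (ha : IsBesselFamily μ a) (hb : IsBesselFamily μ b)
    (hm : Measurable m) (hM : StronglyMeasurable M) (hMm : ∀ q, ‖M q‖ₑ ≤ m q.2)
    (hc : ∫⁻ ω, m ω ∂ν ≠ ⊤) {p : ℝ≥0∞} (hp : 1 ≤ p) {F : Z → ℂ} (hF : StronglyMeasurable F)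
    (hFp : eLpNorm F p μ ≠ ⊤) :
    ∃ T : H →L[ℂ] H,
      (∀ e f, inner ℂ f (T e) =
        ∫ z, F z * ∫ ω, M (z, ω) * (inner ℂ (a (z, ω)) e * inner ℂ f (b (z, ω))) ∂ν ∂μ) ∧
      schattenNorm p T ≤ (∫⁻ ω, m ω ∂ν) * eLpNorm F p μ := by
  set c := ∫⁻ ω, m ω ∂ν with hcdef
  have hint_le : ∀ e f : H, ∫⁻ z, ‖F z‖ₑ * dyadKernel ν m a b e f z ∂μ ≤
      c * (‖e‖ₑ * ‖f‖ₑ) * eLpNorm F p μ := fun e f =>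
    lintegral_enorm_mul_le hp hF (measurable_dyadKernel ha hb hm e f)
      (dyadKernel_le ha hb hm e f) (lintegral_dyadKernel_le ha hb hm e f)
  have htop : c * eLpNorm F p μ ≠ ⊤ := ENNReal.mul_ne_top hc hFp
  have hle : ∀ e f : H, ∫⁻ q, ‖F q.1 * (M q * (inner ℂ (a q) e * inner ℂ f (b q)))‖ₑ ∂μ.prod ν ≤
      c * eLpNorm F p μ * (‖e‖ₑ * ‖f‖ₑ) := fun e f => by
    rw [mul_right_comm]
    exact (lintegral_dyad_le ha hb hm hMm hF e f).trans (hint_le e f)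
  have hint : ∀ e f : H, Integrable
      (fun q : Z × Ω => F q.1 * (M q * (inner ℂ (a q) e * inner ℂ f (b q)))) (μ.prod ν) :=
    fun e f => ⟨(stronglyMeasurable_dyad ha hb hM hF e f).aestronglyMeasurable,
      (hle e f).trans_lt (ENNReal.mul_lt_top htop.lt_top
        (ENNReal.mul_lt_top enorm_lt_top enorm_lt_top))⟩
  -- The operator is defined weakly, from its bounded sesquilinear form. Riesz representation puts
  -- the operator into the first slot of the inner product, hence the adjoint in `T`.
  let B : H →ₗ⋆[ℂ] H →ₗ[ℂ] ℂ := LinearMap.mk₂'ₛₗ (starRingEnd ℂ) (RingHom.id ℂ)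
    (fun f e => ∫ q, F q.1 * (M q * (inner ℂ (a q) e * inner ℂ f (b q))) ∂μ.prod ν)
    (fun f f' e => by
      rw [← integral_add (hint e f) (hint e f')]
      congr 1; ext q; rw [inner_add_left]; ring)
    (fun r f e => by
      rw [smul_eq_mul, ← integral_const_mul]
      congr 1; ext q; rw [inner_smul_left]; ring)
    (fun f e e' => by
      rw [← integral_add (hint e f) (hint e' f)]
      congr 1; ext q; rw [inner_add_right]; ring)
    (fun r f e => by
      rw [smul_eq_mul, ← integral_const_mul]
      congr 1; ext q; rw [inner_smul_right]; simp only [RingHom.id_apply]; ring)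
  have hB : ∀ f e, ‖B f e‖ ≤ (c * eLpNorm F p μ).toReal * ‖f‖ * ‖e‖ := fun f e => by
    have h1 : ‖B f e‖ₑ ≤ c * eLpNorm F p μ * (‖e‖ₑ * ‖f‖ₑ) :=
      (enorm_integral_le_lintegral_enorm _).trans (hle e f)
    have h2 := ENNReal.toReal_mono (ENNReal.mul_ne_top htop
      (ENNReal.mul_ne_top enorm_ne_top enorm_ne_top)) h1
    rw [ENNReal.toReal_mul (a := c * eLpNorm F p μ), ENNReal.toReal_mul (a := ‖e‖ₑ)] at h2
    simp only [toReal_enorm] at h2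
    linarith
  let Bc : H →L⋆[ℂ] H →L[ℂ] ℂ := B.mkContinuous₂ _ hB
  set T : H →L[ℂ] H := ContinuousLinearMap.adjoint (InnerProductSpace.continuousLinearMapOfBilin Bc)
    with hTdef
  have hT : ∀ e f, inner ℂ f (T e) =
      ∫ q, F q.1 * (M q * (inner ℂ (a q) e * inner ℂ f (b q))) ∂μ.prod ν := fun e f => by
    rw [hTdef, ContinuousLinearMap.adjoint_inner_right,
      InnerProductSpace.continuousLinearMapOfBilin_apply]
    rfl
  refine ⟨T, fun e f => ?_, ?_⟩
  · rw [hT, integral_prod _ (hint e f)]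
    congr 1; ext z
    simp only [integral_const_mul]
  have hTle : ∀ e f, ‖inner ℂ f (T e)‖ₑ ≤ ∫⁻ z, ‖F z‖ₑ * dyadKernel ν m a b e f z ∂μ :=
    fun e f => by
      rw [hT]
      exact (enorm_integral_le_lintegral_enorm _).trans (lintegral_dyad_le ha hb hm hMm hF e f)
  by_cases hpt : p = ⊤
  · rw [schattenNorm, if_pos hpt, ← ofReal_norm, ENNReal.ofReal_le_iff_le_toReal htop]
    refine ContinuousLinearMap.opNorm_le_bound _ ENNReal.toReal_nonneg fun x => ?_
    -- For p = ∞ the operator norm comes from testing the form on the pair (T x, x) and cancelling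
    -- ‖T x‖.
    have h1 := hB (T x) x
    have h2 : B (T x) x = inner ℂ (T x) (T x) := (hT x (T x)).symm
    rw [h2, inner_self_eq_norm_sq_to_K, norm_pow, RCLike.norm_ofReal, abs_norm] at h1
    rcases (norm_nonneg (T x)).eq_or_lt with h0 | h0
    · rw [← h0]; positivity
    · exact le_of_mul_le_mul_right (by linarith) h0
  · have hr : 1 ≤ p.toReal := by
      rw [← ENNReal.toReal_one]
      exact ENNReal.toReal_mono hpt hp
    refine schattenNorm_le_of_sum_inner_le hp hpt htop fun ι _ e f he hf => ?_
    let _ : MeasurableSpace ι := ⊤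
    have := lintegral_rpow_lintegral_mul_le (μ := μ) (ν := (Measure.count : Measure ι))
      (measurable_uncurry_dyadKernel (ν := ν) ha hb hm e f) (c := c)
      (fun i => (lintegral_dyadKernel_le ha hb hm (e i) (f i)).trans (by
        rw [← ofReal_norm, ← ofReal_norm, he.1, hf.1]; simp [hcdef]))
      (fun z => by
        rw [lintegral_count]
        exact tsum_dyadKernel_le ha hb hm he hf z) hF.enorm hr
    rw [lintegral_count, tsum_fintype] at this
    refine le_trans (Finset.sum_le_sum fun i _ => ?_) (this.trans (le_of_eq ?_))
    · gcongr
      exact hTle _ _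
    · rw [ENNReal.mul_rpow_of_nonneg _ _ (by positivity),
        eLpNorm_eq_lintegral_rpow_enorm_toReal (by positivity) hpt, ← ENNReal.rpow_mul,
        one_div_mul_cancel (by positivity), ENNReal.rpow_one]

/-- The `L^p` norms of `z ↦ ∫ M(z, ω) ⟨b(z, ω), T a(z, ω)⟩ dω`. -/
theorem eLpNorm_integral_inner_le (ha : IsBesselFamily μ a) (hb : IsBesselFamily μ b)
    (hm : Measurable m) (hMm : ∀ q, ‖M q‖ₑ ≤ m q.2)
    {p : ℝ≥0∞} (hp : 1 ≤ p) {T : H →L[ℂ] H} (hT : schattenNorm p T ≠ ⊤) :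
    eLpNorm (fun z => ∫ ω, M (z, ω) * inner ℂ (b (z, ω)) (T (a (z, ω))) ∂ν) p μ ≤
      (∫⁻ ω, m ω ∂ν) * schattenNorm p T := by
  set c := ∫⁻ ω, m ω ∂ν with hcdef
  have h1 : ∀ z, ‖∫ ω, M (z, ω) * inner ℂ (b (z, ω)) (T (a (z, ω))) ∂ν‖ₑ ≤
      ∫⁻ ω, m ω * ‖inner ℂ (b (z, ω)) (T (a (z, ω)))‖ₑ ∂ν := fun z => by
    refine (enorm_integral_le_lintegral_enorm _).trans (lintegral_mono fun ω => ?_)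
    rw [enorm_mul]
    gcongr
    exact hMm (z, ω)
  by_cases hpt : p = ⊤
  · subst hpt
    rw [schattenNorm, if_pos rfl, eLpNorm_exponent_top]
    refine eLpNormEssSup_le_of_ae_enorm_bound (Filter.Eventually.of_forall fun z => (h1 z).trans ?_)
    rw [hcdef, ← lintegral_mul_const _ hm]
    refine lintegral_mono fun ω => ?_
    gcongr
    refine (enorm_inner_le _ _).trans ((mul_le_of_le_one_left' (hb.norm_le_one _)).trans ?_)
    refine (T.le_opENorm _).trans (mul_le_of_le_one_right' (ha.norm_le_one _))
  · have hr : 1 ≤ p.toReal := by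
      rw [← ENNReal.toReal_one]
      exact ENNReal.toReal_mono hpt hp
    have hr0 : 0 < p.toReal := by linarith
    obtain ⟨ι, _, e, f, s, he, hf, hTs, hs⟩ := exists_singularValues hp hpt hT
    let _ : MeasurableSpace ι := ⊤
    have hk : Measurable (Function.uncurry fun i z => dyadKernel ν m a b (e i) (f i) z) :=
      measurable_from_prod_countable_right fun i => measurable_dyadKernel ha hb hm (e i) (f i)
    -- The same kernel as in the Schatten estimate with the two variables exchanged: the input is
    -- the sequence of singular values and the output a function of z.
    have := lintegral_rpow_lintegral_mul_le (μ := (Measure.count : Measure ι)) (ν := μ)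
      (k := fun i z => dyadKernel ν m a b (e i) (f i) z)
      hk (c := c)
      (fun z => by
        rw [lintegral_count]
        exact tsum_dyadKernel_le ha hb hm he hf z)
      (fun i => (lintegral_dyadKernel_le ha hb hm (e i) (f i)).trans (by
        rw [← ofReal_norm, ← ofReal_norm, he.1, hf.1]; simp [hcdef]))
      (measurable_from_top (f := s)) hr
    simp_rw [lintegral_count] at this
    rw [eLpNorm_eq_lintegral_rpow_enorm_toReal (by positivity) hpt]
    have h2 : ∀ z, ‖∫ ω, M (z, ω) * inner ℂ (b (z, ω)) (T (a (z, ω))) ∂ν‖ₑ ≤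
        ∑' i, s i * dyadKernel ν m a b (e i) (f i) z := fun z => by
      refine (h1 z).trans ?_
      have hmeas : ∀ i, Measurable fun ω =>
          m ω * (‖inner ℂ (a (z, ω)) (e i)‖ₑ * ‖inner ℂ (f i) (b (z, ω))‖ₑ) := fun i =>
        (measurable_dyad_integrand ha hb hm (e i) (f i)).comp measurable_prodMk_left
      calc _ ≤ ∫⁻ ω, ∑' i, s i * (m ω * (‖inner ℂ (a (z, ω)) (e i)‖ₑ *
              ‖inner ℂ (f i) (b (z, ω))‖ₑ)) ∂ν := by
            refine lintegral_mono fun ω => ?_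
            refine (mul_le_mul_right (hTs _ _) (m ω)).trans (le_of_eq ?_)
            rw [← ENNReal.tsum_mul_left]
            refine tsum_congr fun i => ?_
            rw [enorm_inner_symm (a (z, ω)), enorm_inner_symm (f i), mul_left_comm]
        _ = _ := by
            rw [lintegral_tsum fun i => ((hmeas i).const_mul (s i)).aemeasurable]
            exact tsum_congr fun i => lintegral_const_mul _ (hmeas i)
    calc _ ≤ (c ^ p.toReal * schattenNorm p T ^ p.toReal) ^ (1 / p.toReal) := by
          gcongr
          refine (lintegral_mono fun z => ENNReal.rpow_le_rpow (h2 z) hr0.le).trans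
            (this.trans ?_)
          gcongr
      _ = _ := by
          rw [← ENNReal.mul_rpow_of_nonneg _ _ hr0.le, ← ENNReal.rpow_mul,
            mul_one_div_cancel hr0.ne', ENNReal.rpow_one]

end DyadOperator

/-! ### Tempered distributions applied under an integral sign. -/

section Slice

open scoped BoundedContinuousFunction

variable {X Y : Type} [NormedAddCommGroup X] [NormedSpace ℝ X]
  [NormedAddCommGroup Y] [InnerProductSpace ℝ Y] [FiniteDimensional ℝ Y]
  [MeasurableSpace Y] [BorelSpace Y]

/-- The Schwartz function `y ↦ Φ(x, y)`. -/
def slice {F : Type} [NormedAddCommGroup F] [NormedSpace ℂ F] (Φ : 𝓢(X × Y, F)) (x : X) :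
    𝓢(Y, F) where
  toFun y := Φ (x, y)
  smooth' := slice_smooth Φ x ⊤
  decay' k n := ⟨SchwartzMap.seminorm ℂ k n Φ, fun y => by simpa using slice_bound Φ 0 k n x y⟩

@[simp]
theorem slice_apply {F : Type} [NormedAddCommGroup F] [NormedSpace ℂ F] (Φ : 𝓢(X × Y, F)) (x : X)
    (y : Y) : slice Φ x y = Φ (x, y) := rfl

/-- Bounded continuous functions, with the metric coming from the norm of the codomain. -/
abbrev BoundedMap (Y W : Type) [TopologicalSpace Y] [NormedAddCommGroup W] : Type :=
  BoundedContinuousFunction Y W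

/-- The function `y ↦ ‖y‖ ^ k • D^n f(y)`. -/
def weightedDeriv (k n : ℕ) (f : 𝓢(Y, ℂ)) : BoundedMap Y (Y [×n]→L[ℝ] ℂ) :=
  BoundedContinuousFunction.ofNormedAddCommGroup (fun y => (‖y‖ ^ k : ℝ) • iteratedFDeriv ℝ n f y)
    ((continuous_norm.pow k).smul ((f.smooth n).continuous_iteratedFDeriv le_rfl))
    (SchwartzMap.seminorm ℂ k n f) fun y => by
      rw [norm_smul, norm_pow, norm_norm]
      exact f.le_seminorm ℂ k n y

@[simp]
theorem weightedDeriv_apply (k n : ℕ) (f : 𝓢(Y, ℂ)) (y : Y) :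
    weightedDeriv k n f y = (‖y‖ ^ k : ℝ) • iteratedFDeriv ℝ n f y := rfl

theorem norm_weightedDeriv (k n : ℕ) (f : 𝓢(Y, ℂ)) :
    ‖weightedDeriv k n f‖ = SchwartzMap.seminorm ℂ k n f := by
  apply le_antisymm
  · exact BoundedContinuousFunction.norm_ofNormedAddCommGroup_le _ (apply_nonneg _ _) _
  · refine f.seminorm_le_bound ℂ k n (by positivity) fun y => ?_
    have := (weightedDeriv k n f).norm_coe_le_norm y
    rwa [weightedDeriv_apply, norm_smul, norm_pow, norm_norm] at this

theorem weightedDeriv_add (k n : ℕ) (f g : 𝓢(Y, ℂ)) (y : Y) :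
    weightedDeriv k n (f + g) y = weightedDeriv k n f y + weightedDeriv k n g y := by
  simp only [weightedDeriv_apply]
  rw [FunLike.coe_add, iteratedFDeriv_add_apply (f.smooth n).contDiffAt (g.smooth n).contDiffAt,
    smul_add (‖y‖ ^ k : ℝ)]

theorem weightedDeriv_smul (k n : ℕ) (c : ℂ) (f : 𝓢(Y, ℂ)) (y : Y) :
    weightedDeriv k n (c • f) y = c • weightedDeriv k n f y := by
  simp only [weightedDeriv_apply]
  rw [FunLike.coe_smul, iteratedFDeriv_const_smul_apply (f.smooth n).contDiffAt,
    smul_comm (‖y‖ ^ k : ℝ) c]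

/-- The derivative in the second variable. -/
def derivSnd (F : Type) [NormedAddCommGroup F] [NormedSpace ℂ F] (Φ : 𝓢(X × Y, F)) :
    𝓢(X × Y, Y →L[ℝ] F) :=
  postcompCLM ((ContinuousLinearMap.compL ℝ Y (X × Y) F).flip (ContinuousLinearMap.inr ℝ X Y))
    (fderivCLM ℝ (X × Y) F Φ)

theorem hasFDerivAt_slice {F : Type} [NormedAddCommGroup F] [NormedSpace ℂ F] (Φ : 𝓢(X × Y, F))
    (x : X) (y : Y) : HasFDerivAt (fun y => Φ (x, y)) (derivSnd F Φ (x, y)) y :=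
  (Φ.hasFDerivAt (x, y)).comp y ((hasFDerivAt_const x y).prodMk (hasFDerivAt_id y))

variable [MeasurableSpace X] [BorelSpace X] {μ : Measure X} [μ.HasTemperateGrowth]

theorem continuous_fst_slice {F : Type} [NormedAddCommGroup F] [NormedSpace ℂ F]
    (Φ : 𝓢(X × Y, F)) (y : Y) : Continuous fun x => Φ (x, y) := by
  have := Φ.continuous
  fun_prop

variable [FiniteDimensional ℝ X]

theorem norm_le_of_fst {F : Type} [NormedAddCommGroup F] [NormedSpace ℂ F] (μ : Measure X)
    (Φ : 𝓢(X × Y, F)) : ∃ C, ∀ x y, ‖Φ (x, y)‖ ≤ C * (1 + ‖x‖) ^ (-(μ.integrablePower : ℝ)) := by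
  refine ⟨2 ^ μ.integrablePower *
    ((Finset.Iic (μ.integrablePower, 0)).sup fun m => SchwartzMap.seminorm ℂ m.1 m.2) Φ,
    fun x y => ?_⟩
  have := one_add_le_sup_seminorm_apply (𝕜 := ℂ) (m := (μ.integrablePower, 0)) le_rfl le_rfl Φ (x, y)
  rw [norm_iteratedFDeriv_zero] at this
  rw [Real.rpow_neg (by positivity), Real.rpow_natCast, ← div_eq_mul_inv,
    le_div_iff₀ (by positivity), mul_comm]
  refine le_trans ?_ this
  gcongr
  exact norm_fst_le (x, y)

theorem integrable_fst {F : Type} [NormedAddCommGroup F] [NormedSpace ℂ F]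
    (Φ : 𝓢(X × Y, F)) (y : Y) : Integrable (fun x => Φ (x, y)) μ := by
  obtain ⟨C, hC⟩ := norm_le_of_fst μ Φ
  exact (μ.integrable_pow_neg_integrablePower.const_mul C).mono'
    (continuous_fst_slice Φ y).aestronglyMeasurable (Filter.Eventually.of_forall fun x => hC x y)

theorem hasFDerivAt_integral_fst {F : Type} [NormedAddCommGroup F] [NormedSpace ℂ F]
    (Φ : 𝓢(X × Y, F)) (y : Y) :
    HasFDerivAt (fun y => ∫ x, Φ (x, y) ∂μ) (∫ x, derivSnd F Φ (x, y) ∂μ) y := by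
  obtain ⟨C, hC⟩ := norm_le_of_fst μ (derivSnd F Φ)
  exact hasFDerivAt_integral_of_dominated_of_fderiv_le (s := Set.univ)
    (F' := fun y x => derivSnd F Φ (x, y)) Filter.univ_mem
    (Filter.Eventually.of_forall fun y => (continuous_fst_slice Φ y).aestronglyMeasurable)
    (integrable_fst Φ y) (continuous_fst_slice (derivSnd F Φ) y).aestronglyMeasurable
    (Filter.Eventually.of_forall fun x y _ => hC x y)
    (μ.integrable_pow_neg_integrablePower.const_mul C)
    (Filter.Eventually.of_forall fun x y _ => hasFDerivAt_slice Φ x y)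

theorem integral_linearIsometryEquiv {A B : Type} [NormedAddCommGroup A] [NormedSpace ℝ A]
    [CompleteSpace A] [NormedAddCommGroup B] [NormedSpace ℝ B] (e : A ≃ₗᵢ[ℝ] B) {f : X → A}
    (hf : Integrable f μ) {g : X → B} (hg : ∀ x, g x = e (f x)) :
    Integrable g μ ∧ e (∫ x, f x ∂μ) = ∫ x, g x ∂μ := by
  simp only [funext hg]
  exact ⟨e.toContinuousLinearEquiv.toContinuousLinearMap.integrable_comp hf,
    (e.toContinuousLinearEquiv.integral_comp_comm f).symm⟩

/-- Differentiation under the integral, by induction on the order. The target space has to vary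
because each step replaces Φ by its derivative in the second variable; currying isometries pass
through the Bochner integral. -/
theorem iteratedFDeriv_integral_fst (n : ℕ) : ∀ {F : Type} [NormedAddCommGroup F] [NormedSpace ℂ F]
    [CompleteSpace F] (Φ : 𝓢(X × Y, F)) (y : Y),
    Integrable (fun x => iteratedFDeriv ℝ n (slice Φ x) y) μ ∧
      iteratedFDeriv ℝ n (fun y => ∫ x, Φ (x, y) ∂μ) y =
        ∫ x, iteratedFDeriv ℝ n (slice Φ x) y ∂μ := by
  induction n with
  | zero =>
    intro F _ _ _ Φ y
    exact integral_linearIsometryEquiv (continuousMultilinearCurryFin0 ℝ Y F).symm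
      (integrable_fst (μ := μ) Φ y) fun x => rfl
  | succ n ih =>
    intro F _ _ _ Φ y
    have h1 : fderiv ℝ (fun y => ∫ x, Φ (x, y) ∂μ) = fun y => ∫ x, derivSnd F Φ (x, y) ∂μ :=
      funext fun y => (hasFDerivAt_integral_fst Φ y).fderiv
    have h2 : ∀ x, fderiv ℝ (slice Φ x) = slice (derivSnd F Φ) x :=
      fun x => funext fun y => (hasFDerivAt_slice Φ x y).fderiv
    obtain ⟨i1, i2⟩ := ih (derivSnd F Φ) y
    have h3 : ∀ f : Y → F, iteratedFDeriv ℝ (n + 1) f y =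
        (continuousMultilinearCurryRightEquiv' ℝ n Y F).symm (iteratedFDeriv ℝ n (fderiv ℝ f) y) :=
      fun f => by rw [iteratedFDeriv_succ_eq_comp_right]; rfl
    rw [h3, h1, i2]
    exact integral_linearIsometryEquiv (continuousMultilinearCurryRightEquiv' ℝ n Y F).symm
      i1 (g := fun x => iteratedFDeriv ℝ (n + 1) (slice Φ x) y) fun x => by rw [h3, h2]

theorem iteratedFDeriv_slice (n : ℕ) (Φ : 𝓢(X × Y, ℂ)) (x : X) (y : Y) :
    iteratedFDeriv ℝ n (slice Φ x) y = (iteratedFDeriv ℝ n Φ (x, y)).compContinuousLinearMap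
      fun _ => ContinuousLinearMap.inr ℝ X Y := by
  have h1 : (slice Φ x : Y → ℂ) =
      (fun z : X × Y => Φ ((x, 0) + z)) ∘ (ContinuousLinearMap.inr ℝ X Y) := by
    ext s; simp
  have h2 : ContDiff ℝ n (fun z : X × Y => Φ ((x, 0) + z)) :=
    (Φ.smooth n).comp (contDiff_const.add contDiff_id)
  rw [h1, ContinuousLinearMap.iteratedFDeriv_comp_right _ h2 y le_rfl,
    iteratedFDeriv_comp_add_left]
  simp

/-- Mean value inequality in x; one more derivative of Φ bounds the Lipschitz constant uniformly in
y. -/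
theorem norm_iteratedFDeriv_sub_le (k n : ℕ) (Φ : 𝓢(X × Y, ℂ)) (x x' : X) (y : Y) :
    ‖y‖ ^ k * ‖iteratedFDeriv ℝ n Φ (x, y) - iteratedFDeriv ℝ n Φ (x', y)‖ ≤
      SchwartzMap.seminorm ℂ k (n + 1) Φ * ‖x - x'‖ := by
  have hd : ∀ a : X, HasFDerivAt (fun a : X => (‖y‖ ^ k : ℝ) • iteratedFDeriv ℝ n Φ (a, y))
      ((‖y‖ ^ k : ℝ) • (fderiv ℝ (iteratedFDeriv ℝ n Φ) (a, y) ∘L ContinuousLinearMap.inl ℝ X Y))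
      a := fun a => by
    have h1 : HasFDerivAt (iteratedFDeriv ℝ n Φ) (fderiv ℝ (iteratedFDeriv ℝ n Φ) (a, y)) (a, y) :=
      (((Φ.smooth (n + 1)).differentiable_iteratedFDeriv (m := n)
        (by exact_mod_cast Nat.lt_succ_self n)) (a, y)).hasFDerivAt
    have h2 : HasFDerivAt (fun a : X => iteratedFDeriv ℝ n Φ (a, y))
        (fderiv ℝ (iteratedFDeriv ℝ n Φ) (a, y) ∘L ContinuousLinearMap.inl ℝ X Y) a :=
      HasFDerivAt.comp a h1 (f := fun a => (a, y)) (hasFDerivAt_prodMk_left a y)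
    exact h2.const_smul (‖y‖ ^ k : ℝ)
  have := (convex_univ (𝕜 := ℝ) (E := X)).norm_image_sub_le_of_norm_hasFDerivWithin_le
    (C := SchwartzMap.seminorm ℂ k (n + 1) Φ) (fun a _ => (hd a).hasFDerivWithinAt)
    (fun a _ => ?_) (Set.mem_univ x') (Set.mem_univ x)
  · rwa [← smul_sub, norm_smul, norm_pow, norm_norm] at this
  · rw [norm_smul, norm_pow, norm_norm]
    refine le_trans ?_ (Φ.le_seminorm ℂ k (n + 1) (a, y))
    rw [← norm_fderiv_iteratedFDeriv]
    gcongr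
    · exact norm_snd_le (a, y)
    · refine (ContinuousLinearMap.opNorm_comp_le _ _).trans ?_
      exact mul_le_of_le_one_right (norm_nonneg _) (ContinuousLinearMap.norm_inl_le_one ℝ X Y)

/-- Continuity in the sup norm gives strong measurability although the space of bounded continuous
functions need not be separable. -/
theorem continuous_weightedDeriv_slice (k n : ℕ) (Φ : 𝓢(X × Y, ℂ)) :
    Continuous fun x => weightedDeriv k n (slice Φ x) := by
  refine (LipschitzWith.of_dist_le_mul
    (K := Real.toNNReal (SchwartzMap.seminorm ℂ k (n + 1) Φ)) fun x x' => ?_).continuous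
  rw [Real.coe_toNNReal _ (apply_nonneg _ _)]
  refine (BoundedContinuousFunction.dist_le (by positivity)).2 fun y => ?_
  rw [dist_eq_norm, dist_eq_norm, weightedDeriv_apply, weightedDeriv_apply]
  rw [← smul_sub (‖y‖ ^ k : ℝ) (iteratedFDeriv ℝ n (slice Φ x) y), norm_smul, norm_pow, norm_norm]
  refine le_trans ?_ (norm_iteratedFDeriv_sub_le k n Φ x x' y)
  gcongr
  rw [iteratedFDeriv_slice, iteratedFDeriv_slice]
  have h3 : ‖ContinuousLinearMap.inr ℝ X Y‖ ≤ 1 := ContinuousLinearMap.norm_inr_le_one ℝ X Y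
  refine le_trans (le_of_eq ?_) ((ContinuousMultilinearMap.norm_compContinuousLinearMap_le
    (iteratedFDeriv ℝ n Φ (x, y) - iteratedFDeriv ℝ n Φ (x', y))
    fun _ => ContinuousLinearMap.inr ℝ X Y).trans (mul_le_of_le_one_right (norm_nonneg _)
      (Finset.prod_le_one (fun _ _ => by positivity) (fun _ _ => h3))))
  rfl

theorem integrable_weightedDeriv_slice (k n : ℕ) (Φ : 𝓢(X × Y, ℂ)) :
    Integrable (fun x => weightedDeriv k n (slice Φ x)) μ := by
  refine (μ.integrable_pow_neg_integrablePower.const_mul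
    (2 ^ μ.integrablePower * (SchwartzMap.seminorm ℂ k n Φ +
      SchwartzMap.seminorm ℂ (μ.integrablePower + k) n Φ))).mono'
    (continuous_weightedDeriv_slice k n Φ).aestronglyMeasurable
    (Filter.Eventually.of_forall fun x => ?_)
  refine (BoundedContinuousFunction.norm_le (by positivity)).2 fun y => ?_
  rw [weightedDeriv_apply, norm_smul, norm_pow, norm_norm]
  have := pow_mul_le_of_le_of_pow_mul_le (k := 0) (l := μ.integrablePower) (norm_nonneg x)
    (f := ‖y‖ ^ k * ‖iteratedFDeriv ℝ n (slice Φ x) y‖) (by positivity)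
    (C₁ := SchwartzMap.seminorm ℂ k n Φ)
    (C₂ := SchwartzMap.seminorm ℂ (μ.integrablePower + k) n Φ)
    (by have := slice_bound Φ 0 k n x y; rwa [pow_zero, one_mul, zero_add] at this)
    (by rw [zero_add]; exact slice_bound Φ _ k n x y)
  rwa [pow_zero, one_mul] at this

/-- A tempered distribution commutes with integration over a parameter. -/
theorem integral_apply_slice (u : 𝓢(Y, ℂ) →L[ℂ] ℂ) (Φ : 𝓢(X × Y, ℂ)) (θ : 𝓢(Y, ℂ))
    (hθ : ∀ y, θ y = ∫ x, Φ (x, y) ∂μ) : u θ = ∫ x, u (slice Φ x) ∂μ := by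
  classical
  obtain ⟨t, C, _, hC⟩ := Seminorm.bound_of_continuous (schwartz_withSeminorms ℂ Y ℂ)
    ((normSeminorm ℂ ℂ).comp u.toLinearMap) (continuous_norm.comp u.continuous)
  -- Continuity of `u` involves finitely many seminorms, so `u` factors through a Banach space of
  -- weighted derivatives. Hahn–Banach extends it there, and a bounded functional commutes with the
  -- Bochner integral. The index (0, 0) is added to make `J` injective.
  let E := (i : (insert (0, 0) t : Finset (ℕ × ℕ))) → BoundedMap Y (Y [×i.1.2]→L[ℝ] ℂ)
  let J : 𝓢(Y, ℂ) →ₗ[ℂ] E :=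
    { toFun := fun f i => weightedDeriv i.1.1 i.1.2 f
      map_add' := fun f g => by
        ext1 i; ext1 y
        exact weightedDeriv_add _ _ f g y
      map_smul' := fun c f => by
        ext1 i; ext1 y
        exact weightedDeriv_smul _ _ c f y }
  have hJ : ∀ f, ‖u f‖ ≤ C * ‖J f‖ := fun f => by
    refine (hC f).trans ?_
    rw [smul_apply, NNReal.smul_def, smul_eq_mul]
    gcongr
    refine Seminorm.finset_sup_apply_le (norm_nonneg _) fun i hi => ?_
    rw [schwartzSeminormFamily_apply, ← norm_weightedDeriv]
    exact norm_le_pi_norm (J f) ⟨i, Finset.mem_insert_of_mem hi⟩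
  have hinj : Function.Injective J := by
    rw [injective_iff_map_eq_zero]
    intro f hf
    have h1 := norm_weightedDeriv 0 0 f
    rw [show weightedDeriv 0 0 f = 0 from congrFun hf ⟨(0, 0), Finset.mem_insert_self _ _⟩,
      norm_zero] at h1
    ext y
    have h2 := f.norm_le_seminorm ℂ y
    rw [← h1] at h2
    simpa using h2
  let e := LinearEquiv.ofInjective J hinj
  let g : LinearMap.range J →L[ℂ] ℂ := (u.toLinearMap ∘ₗ e.symm.toLinearMap).mkContinuous C
    fun v => by
      have := hJ (e.symm v)
      rwa [show J (e.symm v) = v from congrArg Subtype.val (e.apply_symm_apply v)] at this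
  obtain ⟨U, hU, -⟩ := exists_extension_norm_eq (LinearMap.range J) g
  have hUJ : ∀ f, U (J f) = u f := fun f => by
    rw [show J f = (e f : E) from rfl, hU]
    change u (e.symm (e f)) = _
    rw [e.symm_apply_apply]
  have hint : Integrable (fun x => J (slice Φ x)) μ :=
    Integrable.of_eval fun i => integrable_weightedDeriv_slice _ _ Φ
  have key : J θ = ∫ x, J (slice Φ x) ∂μ := by
    ext1 i
    rw [eval_integral (f := fun x => J (slice Φ x)) fun i => integrable_weightedDeriv_slice _ _ Φ]
    ext1 y
    have h1 : (∫ x, J (slice Φ x) i ∂μ) y = ∫ x, J (slice Φ x) i y ∂μ :=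
      ((BoundedContinuousFunction.evalCLM ℝ y).integral_comp_comm
        (integrable_weightedDeriv_slice _ _ Φ)).symm
    rw [h1]
    change (‖y‖ ^ i.1.1 : ℝ) • iteratedFDeriv ℝ i.1.2 θ y =
      ∫ x, (‖y‖ ^ i.1.1 : ℝ) • iteratedFDeriv ℝ i.1.2 (slice Φ x) y ∂μ
    rw [integral_smul, ← (iteratedFDeriv_integral_fst i.1.2 Φ y).2, ← funext hθ]
  rw [← hUJ, key, ← U.integral_comp_comm hint]
  simp_rw [hUJ]

end Slice

/-! ### Exponentials of functions of temperate growth, and Gaussians. -/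

section ExpGrowth

variable {E : Type} [NormedAddCommGroup E] [NormedSpace ℝ E]

theorem iteratedFDeriv_cexp (n : ℕ) (z : ℂ) :
    iteratedFDeriv ℝ n Complex.exp z = Complex.exp z • iteratedFDeriv ℝ n Complex.exp 0 := by
  have h1 : (fun w => Complex.exp (z + w)) = Complex.exp z • Complex.exp := by
    ext w; simp [Complex.exp_add]
  have h2 := iteratedFDeriv_comp_add_left (𝕜 := ℝ) (f := Complex.exp) n z
  rw [h1] at h2
  have h3 := h2 0
  rw [add_zero, iteratedFDeriv_const_smul_apply
    (Complex.contDiff_exp).contDiffAt] at h3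
  exact h3.symm

/-- Keeping the factor e^{Re Q} lets one bound serve twice: it equals 1 for characters, and it is
the decay for Gaussians. -/
theorem norm_iteratedFDeriv_cexp_comp_le {Q : E → ℂ} (hQ : Q.HasTemperateGrowth) (n : ℕ) :
    ∃ (k : ℕ) (C : ℝ), 0 ≤ C ∧ ∀ x, ‖iteratedFDeriv ℝ n (fun x => Complex.exp (Q x)) x‖ ≤
      C * (1 + ‖x‖) ^ k * Real.exp (Q x).re := by
  obtain ⟨k, C, hC0, hC⟩ := hQ.norm_iteratedFDeriv_le_uniform n
  set A := ∑ i ∈ Finset.range (n + 1), ‖iteratedFDeriv ℝ i Complex.exp 0‖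
  refine ⟨k * n, n.factorial * A * (1 + C) ^ n, by positivity, fun x => ?_⟩
  have he : ContDiff ℝ n Complex.exp := Complex.contDiff_exp
  refine (norm_iteratedFDeriv_comp_le (N := n) (g := Complex.exp) (f := Q)
    he (hQ.1.of_le (by exact_mod_cast le_top)) le_rfl x
    (C := A * Real.exp (Q x).re) (D := (1 + C) * (1 + ‖x‖) ^ k) (fun i hi => ?_)
    (fun i hi1 hi => ?_)).trans (le_of_eq ?_)
  · rw [iteratedFDeriv_cexp, norm_smul, Complex.norm_exp, mul_comm]
    gcongr
    exact Finset.single_le_sum (f := fun i => ‖iteratedFDeriv ℝ i Complex.exp 0‖)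
      (fun _ _ => norm_nonneg _) (Finset.mem_range.2 (Nat.lt_succ_of_le hi))
  · have h1 : (1 : ℝ) ≤ (1 + ‖x‖) ^ k := one_le_pow₀ (by linarith [norm_nonneg x])
    have h2 : (1 : ℝ) ≤ (1 + C) * (1 + ‖x‖) ^ k := by nlinarith
    -- The chain-rule bound requires the i-th derivative to be at most the i-th power of one number;
    -- using 1 + C makes that number at least 1, and i ≥ 1.
    refine (hC i hi x).trans (le_trans ?_ (le_self_pow₀ h2 (by omega)))
    gcongr
    linarith
  · rw [mul_pow, ← pow_mul]; ring

theorem hasTemperateGrowth_cexp_mul_I {q : E → ℝ} (hq : q.HasTemperateGrowth) :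
    (fun x => Complex.exp (q x * Complex.I)).HasTemperateGrowth := by
  have hQ : (fun x => (q x : ℂ) * Complex.I).HasTemperateGrowth :=
    (Function.HasTemperateGrowth.comp Function.Complex.hasTemperateGrowth_ofReal hq).mul (.const _)
  refine ⟨Complex.contDiff_exp.comp hQ.1, fun n => ?_⟩
  obtain ⟨k, C, -, h⟩ := norm_iteratedFDeriv_cexp_comp_le hQ n
  exact ⟨k, C, fun x => by simpa using h x⟩

variable {H : Type} [NormedAddCommGroup H] [InnerProductSpace ℝ H]

theorem pow_mul_exp_neg_sq_le (n : ℕ) {c r : ℝ} (hc : 1 ≤ c) (hr : 0 ≤ r) :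
    (1 + r) ^ n * Real.exp (-c * r ^ 2) ≤ n.factorial * Real.exp 2 := by
  have h := Real.pow_div_factorial_le_exp (1 + r) (by positivity) n
  rw [div_le_iff₀ (by positivity)] at h
  calc (1 + r) ^ n * Real.exp (-c * r ^ 2)
      ≤ (Real.exp (1 + r) * n.factorial) * Real.exp (-c * r ^ 2) := by gcongr
    _ = n.factorial * Real.exp (1 + r - c * r ^ 2) := by
        rw [sub_eq_add_neg, Real.exp_add (1 + r), neg_mul]; ring
    _ ≤ _ := by
        gcongr
        nlinarith [sq_nonneg (r - 1), sq_nonneg r, mul_nonneg (sub_nonneg.2 hc) (sq_nonneg r)]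

/-- The Gaussian `x ↦ e^{-c‖x‖²}` as a Schwartz function. -/
def gaussianSchwartz (H : Type) [NormedAddCommGroup H] [InnerProductSpace ℝ H] (c : ℝ)
    (hc : 1 ≤ c) : 𝓢(H, ℂ) where
  toFun x := Complex.exp (((-c * ‖x‖ ^ 2 : ℝ) : ℂ))
  smooth' := by
    have hQ : (fun x : H => ((-c * ‖x‖ ^ 2 : ℝ) : ℂ)).HasTemperateGrowth :=
      Function.HasTemperateGrowth.comp Function.Complex.hasTemperateGrowth_ofReal
        ((Function.HasTemperateGrowth.const _).mul (Function.hasTemperateGrowth_norm_sq H))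
    exact Complex.contDiff_exp.comp hQ.1
  decay' k n := by
    have hQ : (fun x : H => ((-c * ‖x‖ ^ 2 : ℝ) : ℂ)).HasTemperateGrowth :=
      Function.HasTemperateGrowth.comp Function.Complex.hasTemperateGrowth_ofReal
        ((Function.HasTemperateGrowth.const _).mul (Function.hasTemperateGrowth_norm_sq H))
    obtain ⟨l, C, hC0, h⟩ := norm_iteratedFDeriv_cexp_comp_le hQ n
    refine ⟨C * ((k + l).factorial * Real.exp 2), fun x => ?_⟩
    calc _ ≤ (1 + ‖x‖) ^ k * (C * (1 + ‖x‖) ^ l * Real.exp (-c * ‖x‖ ^ 2)) := by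
          gcongr
          · linarith
          · exact h x
      _ = C * ((1 + ‖x‖) ^ (k + l) * Real.exp (-c * ‖x‖ ^ 2)) := by rw [pow_add]; ring
      _ ≤ _ := by
          exact mul_le_mul_of_nonneg_left (pow_mul_exp_neg_sq_le _ hc (norm_nonneg x)) hC0

@[simp]
theorem gaussianSchwartz_apply (c : ℝ) (hc : 1 ≤ c) (x : H) :
    gaussianSchwartz H c hc x = Complex.exp (((-c * ‖x‖ ^ 2 : ℝ) : ℂ)) := rfl

end ExpGrowth

/-! ### A distribution vanishes on test functions supported away from its support. -/

section Cutoff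

variable {Y : Type} [NormedAddCommGroup Y] [InnerProductSpace ℝ Y] [FiniteDimensional ℝ Y]
  [MeasurableSpace Y] [BorelSpace Y]

/-- A smooth bump function as a complex valued Schwartz function. -/
def bump {c : Y} (f : ContDiffBump c) : 𝓢(Y, ℂ) :=
  HasCompactSupport.toSchwartzMap (f := fun y => (f y : ℂ))
    (f.hasCompactSupport.comp_left Complex.ofReal_zero)
    (Complex.ofRealCLM.contDiff.comp f.contDiff)

@[simp]
theorem bump_apply {c : Y} (f : ContDiffBump c) (y : Y) : bump f y = (f y : ℂ) := rfl

theorem integral_bump_ne_zero {c : Y} (f : ContDiffBump c) : ∫ y, bump f y ≠ 0 := by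
  simp only [bump_apply]
  rw [integral_complex_ofReal]
  exact_mod_cast f.integral_pos.ne'

/-- The shear `(x, y) ↦ (y - x, y)`. -/
def subSnd (Y : Type) [NormedAddCommGroup Y] [InnerProductSpace ℝ Y] [FiniteDimensional ℝ Y] :
    (Y × Y) ≃L[ℝ] Y × Y :=
  LinearEquiv.toContinuousLinearEquiv
    { toFun := fun z => (z.2 - z.1, z.2)
      invFun := fun z => (z.2 - z.1, z.2)
      map_add' := fun z w => by
        ext1
        · simp only [Prod.fst_add, Prod.snd_add]; abel
        · simp only [Prod.snd_add]
      map_smul' := fun c z => by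
        ext1 <;> simp only [Prod.smul_fst, Prod.smul_snd, RingHom.id_apply, smul_sub]
      left_inv := fun z => by simp
      right_inv := fun z => by simp }

/-- The Schwartz function `(x, y) ↦ b(y - x) g(y)`. -/
def localize (b g : 𝓢(Y, ℂ)) : 𝓢(Y × Y, ℂ) :=
  compCLMOfContinuousLinearEquiv ℂ (subSnd Y) (tensor g b)

theorem localize_apply (b g : 𝓢(Y, ℂ)) (x y : Y) : localize b g (x, y) = b (y - x) * g y := rfl

/-- A continuous partition of unity: integrating b(y - x) g(y) over x gives (∫ b) g(y), and `u` may
be applied under the integral. -/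
theorem apply_eq_zero_of_localize (u : 𝓢(Y, ℂ) →L[ℂ] ℂ) (g : 𝓢(Y, ℂ)) {c : Y} (f : ContDiffBump c)
    (h : ∀ x, u (slice (localize (bump f) g) x) = 0) : u g = 0 := by
  have h1 := integral_apply_slice (μ := volume) u (localize (bump f) g) ((∫ y, bump f y) • g)
    fun y => by
      simp only [localize_apply, smul_apply, smul_eq_mul]
      rw [integral_mul_const, integral_sub_left_eq_self (fun y => bump f y)]
  simp only [h, integral_zero, map_smul, smul_eq_mul] at h1
  exact (mul_eq_zero.1 h1).resolve_left (integral_bump_ne_zero f)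

theorem tsupport_slice_localize_subset (g : 𝓢(Y, ℂ)) (f : ContDiffBump (0 : Y)) (x : Y) :
    tsupport (slice (localize (bump f) g) x) ⊆ Metric.closedBall x f.rOut ∩ tsupport g := by
  refine closure_minimal (fun y hy => ?_)
    (Metric.isClosed_closedBall.inter (isClosed_tsupport _))
  rw [Function.mem_support, slice_apply, localize_apply, mul_ne_zero_iff, bump_apply,
    Complex.ofReal_ne_zero] at hy
  refine ⟨?_, subset_closure hy.2⟩
  have h1 : y - x ∈ Function.support f := hy.1
  rw [f.support_eq, mem_ball_zero_iff] at h1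
  rw [Metric.mem_closedBall, dist_eq_norm]
  exact h1.le

theorem apply_eq_zero_of_hasCompactSupport (u : 𝓢'(Y, ℂ)) (g : 𝓢(Y, ℂ))
    (hg : Disjoint (tsupport g) (Distribution.dsupport u)) (hc : HasCompactSupport g) :
    u g = 0 := by
  have hcov : tsupport g ⊆ ⋃₀ {a | Distribution.IsVanishingOn u a ∧ IsOpen a} := by
    rw [← Distribution.dsupport_compl_eq]
    exact Set.subset_compl_iff_disjoint_right.2 hg
  obtain ⟨δ, hδ, h⟩ := lebesgue_number_lemma_of_metric_sUnion hc.isCompact (fun a ha => ha.2) hcov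
  -- With outer radius δ/4, a localised piece whose ball meets the support of `g` at y lies in the
  -- ball of radius δ about y, hence in a single open set on which `u` vanishes.
  let f : ContDiffBump (0 : Y) := ⟨δ / 8, δ / 4, by positivity, by linarith⟩
  refine apply_eq_zero_of_localize u g f fun x => ?_
  by_cases hx : ∃ y ∈ tsupport g, dist y x ≤ δ / 4
  · obtain ⟨y, hy, hyx⟩ := hx
    obtain ⟨a, ha, hya⟩ := h y hy
    refine ha.1 _ (((tsupport_slice_localize_subset g f x).trans Set.inter_subset_left).trans
      (Set.Subset.trans (fun z hz => ?_) hya))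
    have hz' : dist z x ≤ δ / 4 := hz
    rw [Metric.mem_ball]
    linarith [dist_triangle_right z y x]
  · push Not at hx
    have : slice (localize (bump f) g) x = 0 := by
      ext y
      by_contra hne
      have := tsupport_slice_localize_subset g f x (subset_closure hne)
      exact absurd (hx y this.2) (not_lt.2 this.1)
    rw [this]
    exact map_zero (u : 𝓢(Y, ℂ) →L[ℂ] ℂ)

/-- A tempered distribution vanishes on the Schwartz functions supported away from its support. -/
theorem apply_eq_zero_of_disjoint_dsupport (u : 𝓢'(Y, ℂ)) (g : 𝓢(Y, ℂ))
    (hg : Disjoint (tsupport g) (Distribution.dsupport u)) : u g = 0 := by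
  -- The same localisation at unit scale reduces a general `g` to compactly supported ones.
  let f : ContDiffBump (0 : Y) := ⟨1, 2, by norm_num, by norm_num⟩
  refine apply_eq_zero_of_localize u g f fun x => ?_
  have h1 := tsupport_slice_localize_subset g f x
  refine apply_eq_zero_of_hasCompactSupport u _ (hg.mono_left (h1.trans Set.inter_subset_right)) ?_
  exact (isCompact_closedBall x f.rOut).of_isClosed_subset (isClosed_tsupport _)
    (h1.trans Set.inter_subset_left)

end Cutoff

/-! ### Characters and elementary operations on Schwartz functions. -/

section Phases

/-- The character `r ↦ e^{2πir}` with values in `ℂ`. -/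
def ch (r : ℝ) : ℂ := ((𝐞 r : Circle) : ℂ)

theorem ch_eq (r : ℝ) : ch r = Complex.exp (((2 * Real.pi * r : ℝ) : ℂ) * Complex.I) :=
  Real.fourierChar_apply r

theorem ch_add (r s : ℝ) : ch (r + s) = ch r * ch s := by
  rw [ch, AddChar.map_add_eq_mul]; rfl

@[simp] theorem ch_zero : ch 0 = 1 := by simp [ch]

@[simp] theorem norm_ch (r : ℝ) : ‖ch r‖ = 1 := Circle.norm_coe _

theorem conj_ch (r : ℝ) : starRingEnd ℂ (ch r) = ch (-r) := by
  rw [ch, ch, AddChar.map_neg_eq_inv, Circle.coe_inv_eq_conj]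

theorem continuous_ch : Continuous ch :=
  continuous_subtype_val.comp Real.continuous_fourierChar

theorem hasTemperateGrowth_ch {E : Type} [NormedAddCommGroup E] [NormedSpace ℝ E] {q : E → ℝ}
    (hq : q.HasTemperateGrowth) : (fun x => ch (q x)).HasTemperateGrowth := by
  simp only [ch_eq]
  exact hasTemperateGrowth_cexp_mul_I ((Function.HasTemperateGrowth.const _).mul hq)

/-- The pointwise complex conjugate of a Schwartz function. -/
def conjS {E : Type} [NormedAddCommGroup E] [NormedSpace ℝ E] (f : 𝓢(E, ℂ)) : 𝓢(E, ℂ) :=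
  postcompCLM (𝕜 := ℝ) (Complex.conjCLE : ℂ →L[ℝ] ℂ) f

@[simp]
theorem conjS_apply {E : Type} [NormedAddCommGroup E] [NormedSpace ℝ E] (f : 𝓢(E, ℂ)) (x : E) :
    conjS f x = starRingEnd ℂ (f x) := rfl

@[simp]
theorem conjS_conjS {E : Type} [NormedAddCommGroup E] [NormedSpace ℝ E] (f : 𝓢(E, ℂ)) :
    conjS (conjS f) = f := by ext x; simp

/-- The reflection `x ↦ f(-x)` of a Schwartz function. -/
def negS {E : Type} [NormedAddCommGroup E] [NormedSpace ℝ E] (f : 𝓢(E, ℂ)) : 𝓢(E, ℂ) :=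
  compCLMOfContinuousLinearEquiv ℂ (ContinuousLinearEquiv.neg ℝ) f

@[simp]
theorem negS_apply {E : Type} [NormedAddCommGroup E] [NormedSpace ℝ E] (f : 𝓢(E, ℂ)) (x : E) :
    negS f x = f (-x) := rfl

end Phases

/-! ### The symplectic form and the symplectic Fourier transform. -/

section Symp

variable {d : ℕ}

theorem symp_add_left (a b c : Phase d) : symp (a + b) c = symp a c + symp b c := by
  simp only [symp, WithLp.add_fst, WithLp.add_snd, inner_add_left, inner_add_right]; ring

theorem symp_add_right (a b c : Phase d) : symp a (b + c) = symp a b + symp a c := by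
  simp only [symp, WithLp.add_fst, WithLp.add_snd, inner_add_left, inner_add_right]; ring

theorem symp_smul_left (r : ℝ) (a b : Phase d) : symp (r • a) b = r * symp a b := by
  simp only [symp, WithLp.smul_fst, WithLp.smul_snd, real_inner_smul_left, real_inner_smul_right]
  ring

theorem symp_smul_right (r : ℝ) (a b : Phase d) : symp a (r • b) = r * symp a b := by
  simp only [symp, WithLp.smul_fst, WithLp.smul_snd, real_inner_smul_left, real_inner_smul_right]
  ring

theorem symp_neg_left (a b : Phase d) : symp (-a) b = -symp a b := by
  rw [← neg_one_smul ℝ a, symp_smul_left]; ring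

theorem symp_neg_right (a b : Phase d) : symp a (-b) = -symp a b := by
  rw [← neg_one_smul ℝ b, symp_smul_right]; ring

theorem symp_sub_left (a b c : Phase d) : symp (a - b) c = symp a c - symp b c := by
  rw [sub_eq_add_neg, symp_add_left, symp_neg_left]; ring

theorem symp_sub_right (a b c : Phase d) : symp a (b - c) = symp a b - symp a c := by
  rw [sub_eq_add_neg, symp_add_right, symp_neg_right]; ring

@[simp] theorem symp_self (a : Phase d) : symp a a = 0 := by simp [symp]

theorem symp_swap (a b : Phase d) : symp a b = -symp b a := by
  simp only [symp]; ring

theorem continuous_symp : Continuous fun p : Phase d × Phase d => symp p.1 p.2 := by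
  simp only [← inner_sympJ]
  exact continuous_fst.inner ((sympJ d).continuous.comp continuous_snd)

/-- `sympJ` as an isometry. -/
def sympJIsometry (d : ℕ) : Phase d ≃ₗᵢ[ℝ] Phase d where
  toLinearEquiv := (sympJ d).toLinearEquiv
  norm_map' z := by
    have h : ‖sympJ d z‖ ^ 2 = ‖z‖ ^ 2 := by
      rw [WithLp.prod_norm_sq_eq_of_L2, WithLp.prod_norm_sq_eq_of_L2]
      change ‖-z.snd‖ ^ 2 + ‖z.fst‖ ^ 2 = _
      rw [norm_neg, add_comm]
    exact (sq_eq_sq₀ (norm_nonneg _) (norm_nonneg _)).1 h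

/-- The symplectic Fourier transform is an involution: J is an isometry with J² = -1, and this sign
turns the second Fourier transform into the inverse one. -/
theorem sympFourierTest_sympFourierTest (φ : 𝓢(Phase d, ℂ)) :
    sympFourierTest d (sympFourierTest d φ) = φ := by
  ext z
  change 𝓕 ((𝓕 φ : 𝓢(Phase d, ℂ)) ∘ sympJIsometry d) (sympJIsometry d z) = φ z
  rw [Real.fourier_comp_linearIsometry]
  have h : sympJIsometry d (sympJIsometry d z) = -z := rfl
  rw [h, ← Real.fourierInv_eq_fourier_neg, ← fourierInv_coe, FourierTransform.fourierInv_fourier_eq]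

theorem sympFourier_sympFourier (u : 𝓢'(Phase d, ℂ)) : sympFourier (sympFourier u) = u := by
  ext φ
  change u (sympFourierTest d (sympFourierTest d φ)) = u φ
  rw [sympFourierTest_sympFourierTest]

end Symp

/-! ### Coherent states and their overlaps. -/

section CoherentStates

variable {d : ℕ}

theorem schrodinger_eq (z : Phase d) (g : Pos d → ℂ) (t : Pos d) :
    schrodinger z g t = ch (⟪t, z.snd⟫ - ⟪z.fst, z.snd⟫ / 2) * g (t - z.fst) := by
  rw [schrodinger, ch_eq]
  congr 2
  push_cast; ring

/-- The Gaussian `2^{d/4} e^{-π|t|²}` of unit norm. -/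
def window (d : ℕ) : 𝓢(Pos d, ℂ) :=
  (((2 : ℝ) ^ ((d : ℝ) / 4) : ℝ) : ℂ) •
    gaussianSchwartz (Pos d) Real.pi (by linarith [Real.pi_gt_three])

theorem window_apply (t : Pos d) :
    window d t = ((2 : ℝ) ^ ((d : ℝ) / 4) * Real.exp (-Real.pi * ‖t‖ ^ 2) : ℝ) := by
  simp [window]

/-- The Gaussian `e^{-π|v|²/2}`. -/
def ambiguity (d : ℕ) : 𝓢(Phase d, ℂ) :=
  gaussianSchwartz (Phase d) (Real.pi / 2) (by linarith [Real.pi_gt_three])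

theorem ambiguity_apply (v : Phase d) :
    ambiguity d v = (Real.exp (-(Real.pi / 2) * ‖v‖ ^ 2) : ℝ) := by
  simp [ambiguity]

theorem norm_ambiguity_le (v : Phase d) : ‖ambiguity d v‖ ≤ 1 := by
  rw [ambiguity_apply, Complex.norm_real, Real.norm_of_nonneg (Real.exp_pos _).le,
    Real.exp_le_one_iff]
  have := Real.pi_pos
  nlinarith [sq_nonneg ‖v‖]

theorem hasTemperateGrowth_coh_phase (z : Phase d) :
    (fun t : Pos d => ch (⟪t, z.snd⟫ - ⟪z.fst, z.snd⟫ / 2)).HasTemperateGrowth :=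
  hasTemperateGrowth_ch (by fun_prop)

/-- The coherent state `ρ(z)γ`, where `γ` is the Gaussian `window`. -/
def coh (z : Phase d) : 𝓢(Pos d, ℂ) :=
  smulLeftCLM ℂ (fun t : Pos d => ch (⟪t, z.snd⟫ - ⟪z.fst, z.snd⟫ / 2))
    (compSubConstCLM ℂ z.fst (window d))

theorem coh_apply (z : Phase d) (t : Pos d) :
    coh z t = ch (⟪t, z.snd⟫ - ⟪z.fst, z.snd⟫ / 2) * window d (t - z.fst) := by
  rw [coh, smulLeftCLM_apply_apply (hasTemperateGrowth_coh_phase z)]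
  rfl

theorem coh_neg (z : Phase d) (t : Pos d) : coh (-z) t = coh z (-t) := by
  rw [coh_apply, coh_apply, window_apply, window_apply]
  simp only [WithLp.neg_fst, WithLp.neg_snd, inner_neg_left, inner_neg_right, neg_neg, sub_neg_eq_add]
  rw [show -t - z.fst = -(t + z.fst) by abel, norm_neg]

/-- The projective composition law ρ(v)ρ(a) = e^{πiσ(v,a)} ρ(v + a), evaluated on the Gaussian
window. -/
theorem schrodinger_coh (v a : Phase d) (t : Pos d) :
    schrodinger v (coh a) t = ch (symp v a / 2) * coh (v + a) t := by
  rw [schrodinger_eq, coh_apply, coh_apply, ← mul_assoc, ← mul_assoc, ← ch_add, ← ch_add]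
  congr 2
  · simp only [symp, WithLp.add_fst, WithLp.add_snd, inner_add_left, inner_add_right,
      inner_sub_left]
    ring
  · rw [WithLp.add_fst]; abel_nf

theorem integral_coh_mul_conj_coh (c b : Phase d) :
    ∫ t, coh c t * starRingEnd ℂ (coh b t) = ch (symp c b / 2) * ambiguity d (c - b) := by
  have hpi := Real.pi_pos
  have hG := GaussianFourier.integral_cexp_neg_mul_sq_norm_add (V := Pos d)
    (b := ((2 * Real.pi : ℝ) : ℂ)) (by rw [Complex.ofReal_re]; positivity)
    (2 * Real.pi * Complex.I) (c.snd - b.snd)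
  have h2 : (((2 : ℝ) ^ ((d : ℝ) / 4) * (2 : ℝ) ^ ((d : ℝ) / 4) : ℝ) : ℂ) *
      ((Real.pi / ((2 * Real.pi : ℝ) : ℂ)) ^ ((Module.finrank ℝ (Pos d) : ℂ) / 2)) = 1 := by
    have e1 : (Real.pi / ((2 * Real.pi : ℝ) : ℂ)) = ((1 / 2 : ℝ) : ℂ) := by
      rw [← Complex.ofReal_div]
      congr 1; field_simp
    rw [e1, finrank_euclideanSpace_fin, show ((d : ℂ) / 2) = (((d : ℝ) / 2 : ℝ) : ℂ) by push_cast; rfl,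
      ← Complex.ofReal_cpow (by norm_num), ← Complex.ofReal_mul, ← Real.rpow_add (by norm_num),
      show (d : ℝ) / 4 + d / 4 = d / 2 by ring, ← Real.mul_rpow (by norm_num) (by norm_num)]
    norm_num
  -- Centring at the midpoint of the two positions decouples the Gaussians, leaving the Fourier
  -- transform of e^{-2π|t|²} at the difference of momenta.
  rw [← integral_add_right_eq_self _ ((1 / 2 : ℝ) • (c.fst + b.fst))]
  have key : ∀ t : Pos d, coh c (t + (1 / 2 : ℝ) • (c.fst + b.fst)) *
      starRingEnd ℂ (coh b (t + (1 / 2 : ℝ) • (c.fst + b.fst))) =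
      (((2 : ℝ) ^ ((d : ℝ) / 4) * (2 : ℝ) ^ ((d : ℝ) / 4) : ℝ) : ℂ) *
      (ch (symp c b / 2) * (Real.exp (-(Real.pi / 2) * ‖c.fst - b.fst‖ ^ 2) : ℝ)) *
      Complex.exp (-((2 * Real.pi : ℝ) : ℂ) * ‖t‖ ^ 2 +
        2 * Real.pi * Complex.I * (⟪c.snd - b.snd, t⟫ : ℝ)) := fun t => by
    have n1 : ‖t + (1 / 2 : ℝ) • (c.fst + b.fst) - c.fst‖ ^ 2 +
        ‖t + (1 / 2 : ℝ) • (c.fst + b.fst) - b.fst‖ ^ 2 =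
        2 * ‖t‖ ^ 2 + 1 / 2 * ‖c.fst - b.fst‖ ^ 2 := by
      rw [show t + (1 / 2 : ℝ) • (c.fst + b.fst) - c.fst = t - (1 / 2 : ℝ) • (c.fst - b.fst) by module,
        show t + (1 / 2 : ℝ) • (c.fst + b.fst) - b.fst = t + (1 / 2 : ℝ) • (c.fst - b.fst) by module,
        norm_sub_sq_real, norm_add_sq_real, norm_smul]
      norm_num
      ring
    rw [coh_apply, coh_apply, map_mul, conj_ch, window_apply, window_apply, Complex.conj_ofReal,
      mul_mul_mul_comm, ← ch_add, ← Complex.ofReal_mul, mul_mul_mul_comm, ← Real.exp_add,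
      ← mul_add, n1, Complex.exp_add]
    have e1 : Complex.exp (2 * Real.pi * Complex.I * (⟪c.snd - b.snd, t⟫ : ℝ)) =
        ch ⟪c.snd - b.snd, t⟫ := by
      rw [ch_eq]; congr 1; push_cast; ring
    have e2 : Complex.exp (-((2 * Real.pi : ℝ) : ℂ) * ‖t‖ ^ 2) =
        (Real.exp (-(2 * Real.pi) * ‖t‖ ^ 2) : ℝ) := by
      push_cast; rfl
    rw [e1, e2, show -Real.pi * (2 * ‖t‖ ^ 2 + 1 / 2 * ‖c.fst - b.fst‖ ^ 2) =
      -(Real.pi / 2) * ‖c.fst - b.fst‖ ^ 2 + -(2 * Real.pi) * ‖t‖ ^ 2 by ring, Real.exp_add]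
    rw [show ⟪t + (1 / 2 : ℝ) • (c.fst + b.fst), c.snd⟫ - ⟪c.fst, c.snd⟫ / 2 +
      -(⟪t + (1 / 2 : ℝ) • (c.fst + b.fst), b.snd⟫ - ⟪b.fst, b.snd⟫ / 2) =
      symp c b / 2 + ⟪c.snd - b.snd, t⟫ by
        simp only [symp, inner_add_left, inner_sub_left, real_inner_smul_left]
        rw [real_inner_comm t c.snd, real_inner_comm t b.snd]
        ring, ch_add]
    push_cast
    ring
  simp_rw [key]
  rw [integral_const_mul, hG]
  calc _ = ((((2 : ℝ) ^ ((d : ℝ) / 4) * (2 : ℝ) ^ ((d : ℝ) / 4) : ℝ) : ℂ) *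
      ((Real.pi / ((2 * Real.pi : ℝ) : ℂ)) ^ ((Module.finrank ℝ (Pos d) : ℂ) / 2))) *
      (ch (symp c b / 2) * ((Real.exp (-(Real.pi / 2) * ‖c.fst - b.fst‖ ^ 2) : ℝ) *
      Complex.exp ((2 * Real.pi * Complex.I) ^ 2 * ‖c.snd - b.snd‖ ^ 2 /
        (4 * ((2 * Real.pi : ℝ) : ℂ))))) := by ring
    _ = _ := by
      have e : Complex.exp ((2 * Real.pi * Complex.I) ^ 2 * ‖c.snd - b.snd‖ ^ 2 /
          (4 * ((2 * Real.pi : ℝ) : ℂ))) =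
          (Real.exp (-(Real.pi / 2) * ‖c.snd - b.snd‖ ^ 2) : ℝ) := by
        rw [Complex.ofReal_exp]
        congr 1
        rw [mul_pow, Complex.I_sq]
        push_cast
        field_simp
        ring
      rw [h2, one_mul, e, ambiguity_apply, WithLp.prod_norm_sq_eq_of_L2, mul_add, Real.exp_add,
        ← Complex.ofReal_mul]
      rfl

end CoherentStates

/-! ### Moyal's identity. -/

section Moyal

variable {d : ℕ}

/-- The pointwise product of Schwartz functions. -/
def mulS {E : Type} [NormedAddCommGroup E] [NormedSpace ℝ E] (f g : 𝓢(E, ℂ)) : 𝓢(E, ℂ) :=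
  smulLeftCLM ℂ f g

@[simp]
theorem mulS_apply {E : Type} [NormedAddCommGroup E] [NormedSpace ℝ E] (f g : 𝓢(E, ℂ)) (x : E) :
    mulS f g x = f x * g x :=
  smulLeftCLM_apply_apply f.hasTemperateGrowth g x

theorem integrable_mul {E : Type} [NormedAddCommGroup E] [NormedSpace ℝ E] [MeasurableSpace E]
    [BorelSpace E] [SecondCountableTopology E] {μ : Measure E} [μ.HasTemperateGrowth]
    (f g : 𝓢(E, ℂ)) : Integrable (fun x => f x * g x) μ :=
  (mulS f g).integrable.congr (Filter.Eventually.of_forall (mulS_apply f g))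

instance {X Y : Type} [NormedAddCommGroup X] [NormedSpace ℝ X] [FiniteDimensional ℝ X]
    [MeasureSpace X] [BorelSpace X] [(volume : Measure X).IsAddHaarMeasure]
    [NormedAddCommGroup Y] [NormedSpace ℝ Y] [FiniteDimensional ℝ Y]
    [MeasureSpace Y] [BorelSpace Y] [(volume : Measure Y).IsAddHaarMeasure] :
    (volume : Measure (X × Y)).IsAddHaarMeasure :=
  inferInstanceAs ((volume : Measure X).prod (volume : Measure Y)).IsAddHaarMeasure

/-- The function whose Fourier transform is `ξ ↦ kernelTest d (tensor ψ φ) (x, ξ)`. -/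
def kernelSlice (ψ φ : 𝓢(Pos d, ℂ)) (x : Pos d) : 𝓢(Pos d, ℂ) :=
  slice (compCLMOfContinuousLinearEquiv ℂ (kernelCoord d) (tensor ψ φ)) x

theorem kernelSlice_apply (ψ φ : 𝓢(Pos d, ℂ)) (x s : Pos d) :
    kernelSlice ψ φ x s = φ ((1 / 2 : ℝ) • x - s) * ψ (-(1 / 2 : ℝ) • x - s) := rfl

theorem kernelTest_toLp (ψ φ : 𝓢(Pos d, ℂ)) (x ξ : Pos d) :
    kernelTest d (tensor ψ φ) (WithLp.toLp 2 (x, ξ)) = 𝓕 (kernelSlice ψ φ x) ξ := by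
  rw [fourier_coe, Real.fourier_eq]
  rfl

theorem integral_fourier_mul_fourier (f g : 𝓢(Pos d, ℂ)) :
    ∫ ξ, 𝓕 f ξ * 𝓕 g ξ = ∫ s, f s * g (-s) := by
  rw [integral_fourier_mul_eq]
  congr 1; ext s
  have h := fourierInv_apply_eq (𝓕 g)
  rw [FourierTransform.fourierInv_fourier_eq] at h
  have h' : g (-s) = 𝓕 (𝓕 g) (-(-s)) := congrFun (congrArg DFunLike.coe h) (-s)
  rw [h', neg_neg]

theorem integral_phase {f : Phase d → ℂ} (hf : Integrable f) :
    ∫ z, f z = ∫ x, ∫ ξ, f (WithLp.toLp 2 (x, ξ)) := by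
  have hp := WithLp.volume_preserving_toLp (Pos d) (Pos d)
  have he : MeasurableEmbedding (WithLp.toLp 2 : Pos d × Pos d → Phase d) :=
    (MeasurableEquiv.toLp 2 (Pos d × Pos d)).measurableEmbedding
  rw [← hp.integral_comp he]
  exact integral_prod (fun z => f (WithLp.toLp 2 z)) ((hp.integrable_comp_emb he).2 hf)

/-- Moyal's identity for the matrix coefficients of the Schrödinger representation. -/
theorem integral_kernelTest_mul_kernelTest (ψ₁ φ₁ ψ₂ φ₂ : 𝓢(Pos d, ℂ)) :
    ∫ v, kernelTest d (tensor ψ₁ φ₁) v * kernelTest d (tensor ψ₂ φ₂) v =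
      (∫ p, φ₁ p * ψ₂ (-p)) * ∫ q, ψ₁ q * φ₂ (-q) := by
  have hint : Integrable fun v => kernelTest d (tensor ψ₁ φ₁) v * kernelTest d (tensor ψ₂ φ₂) v :=
    integrable_mul _ _
  set f := mulS φ₁ (negS ψ₂) with hf
  set g := mulS ψ₁ (negS φ₂) with hg
  -- Bilinear Plancherel in ξ for fixed x. The shift by x/2 separates the integrand into a function
  -- of s - x times a function of s, so Fubini yields a product of two integrals.
  have h1 : ∀ x : Pos d, ∫ ξ, 𝓕 (kernelSlice ψ₁ φ₁ x) ξ * 𝓕 (kernelSlice ψ₂ φ₂ x) ξ =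
      ∫ s, localize g f (x, s) := fun x => by
    rw [integral_fourier_mul_fourier, ← integral_sub_left_eq_self _ _ ((1 / 2 : ℝ) • x)]
    congr 1; ext s
    rw [kernelSlice_apply, kernelSlice_apply, localize_apply, hf, hg, mulS_apply, mulS_apply,
      negS_apply, negS_apply, sub_sub_cancel,
      show -(1 / 2 : ℝ) • x - ((1 / 2 : ℝ) • x - s) = s - x by module,
      show (1 / 2 : ℝ) • x - -((1 / 2 : ℝ) • x - s) = -(s - x) by module,
      show -(1 / 2 : ℝ) • x - -((1 / 2 : ℝ) • x - s) = -s by module]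
    ring
  rw [integral_phase hint]
  simp only [kernelTest_toLp, h1]
  rw [integral_integral_swap (f := fun x s => localize g f (x, s))
    ((localize g f).integrable (μ := volume))]
  simp only [localize_apply]
  have h2 : ∀ s, ∫ x, g (s - x) * f s = (∫ x, g x) * f s := fun s => by
    rw [integral_mul_const, integral_sub_left_eq_self (fun x => g x)]
  simp only [h2]
  rw [integral_const_mul, mul_comm]
  simp [hf, hg]

end Moyal

/-! ### Bessel's inequality for coherent states, and Gaussians as matrix coefficients. -/

section CoherentStatesL2

variable {d : ℕ}

/-- The coherent state as an element of `L²`. -/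
def cohL (z : Phase d) : Lp ℂ 2 (volume : Measure (Pos d)) := (coh z).toLp 2

theorem inner_toLp (f g : 𝓢(Pos d, ℂ)) :
    inner ℂ (f.toLp 2 : Lp ℂ 2 (volume : Measure (Pos d))) (g.toLp 2) =
      ∫ t, g t * starRingEnd ℂ (f t) := by
  exact inner_toL2_toL2_eq f g volume

theorem inner_cohL (b c : Phase d) :
    inner ℂ (cohL b) (cohL c) = ch (symp c b / 2) * ambiguity d (c - b) := by
  rw [cohL, cohL, inner_toLp, integral_coh_mul_conj_coh]

theorem norm_cohL (z : Phase d) : ‖cohL z‖ = 1 := by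
  have h := inner_self_eq_norm_sq_to_K (𝕜 := ℂ) (cohL z)
  rw [inner_cohL, symp_self, sub_self, ambiguity_apply] at h
  simp only [zero_div, ch_zero, norm_zero] at h
  norm_num at h
  have h2 : ‖cohL z‖ ^ 2 = 1 := by exact_mod_cast h.symm
  exact (pow_eq_one_iff_of_nonneg (norm_nonneg _) two_ne_zero).1 h2

theorem continuous_cohL : Continuous (cohL : Phase d → _) := by
  rw [continuous_iff_continuousAt]
  intro z₀
  rw [ContinuousAt, tendsto_iff_norm_sub_tendsto_zero]
  have h1 : ∀ z, ‖cohL z - cohL z₀‖ =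
      Real.sqrt (2 - 2 * (ch (symp z₀ z / 2) * ambiguity d (z₀ - z)).re) := fun z => by
    rw [← inner_cohL, ← Real.sqrt_sq (norm_nonneg (cohL z - cohL z₀)), norm_sub_sq (𝕜 := ℂ),
      norm_cohL, norm_cohL]
    congr 1
    simp only [RCLike.re_to_complex]
    ring
  have h2 : Continuous fun z : Phase d =>
      Real.sqrt (2 - 2 * (ch (symp z₀ z / 2) * ambiguity d (z₀ - z)).re) := by
    have c1 : Continuous fun z : Phase d => ch (symp z₀ z / 2) :=
      continuous_ch.comp ((continuous_symp.comp (continuous_const.prodMk continuous_id)).div_const 2)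
    have c2 : Continuous fun z : Phase d => ambiguity d (z₀ - z) :=
      (ambiguity d).continuous.comp (continuous_const.sub continuous_id)
    exact Real.continuous_sqrt.comp
      (continuous_const.sub (continuous_const.mul (Complex.continuous_re.comp (c1.mul c2))))
  simp only [h1]
  have := h2.tendsto z₀
  rw [← h1 z₀, sub_self, norm_zero] at this
  exact this

theorem schrodinger_window (z : Phase d) (t : Pos d) : schrodinger z (window d) t = coh z t := by
  rw [schrodinger_eq, coh_apply]

theorem kernelTest_window (g : 𝓢(Pos d, ℂ)) (z : Phase d) :
    kernelTest d (tensor (window d) (conjS g)) z =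
      starRingEnd ℂ (inner ℂ (cohL z) (g.toLp 2)) := by
  rw [kernelTest_tensor_apply, cohL, inner_toLp, ← integral_conj]
  congr 1; ext t
  rw [schrodinger_window, map_mul, Complex.conj_conj, conjS_apply, mul_comm]

/-- The Moyal identity above is bilinear, so squared moduli need the conjugate of a matrix
coefficient to be a matrix coefficient too; reflecting both functions achieves this. -/
theorem kernelTest_negS_window (g : 𝓢(Pos d, ℂ)) (z : Phase d) :
    kernelTest d (tensor (negS g) (negS (window d))) z = inner ℂ (cohL z) (g.toLp 2) := by
  rw [kernelTest_tensor_apply, cohL, inner_toLp, ← integral_sub_left_eq_self _ _ z.fst]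
  congr 1; ext t
  rw [schrodinger_eq, coh_apply, negS_apply, negS_apply, map_mul, conj_ch, window_apply (t - z.fst),
    Complex.conj_ofReal, ← window_apply, inner_sub_left,
    show -(z.fst - t - z.fst) = t by abel, show -(z.fst - t) = t - z.fst by abel,
    show ⟪z.fst, z.snd⟫ - ⟪t, z.snd⟫ - ⟪z.fst, z.snd⟫ / 2 =
      -(⟪t, z.snd⟫ - ⟪z.fst, z.snd⟫ / 2) by ring]
  ring

theorem coh_zero (t : Pos d) : coh (0 : Phase d) t = window d t := by
  rw [coh_apply]; simp

theorem integral_window_mul_window : ∫ q, window d q * window d q = 1 := by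
  have := integral_coh_mul_conj_coh (0 : Phase d) 0
  simp only [coh_zero, sub_self, symp_self, zero_div, ch_zero, one_mul, ambiguity_apply,
    norm_zero] at this
  norm_num at this
  rw [← this]
  congr 1; ext q
  rw [window_apply, Complex.conj_ofReal]

theorem integral_norm_sq_eq (g : 𝓢(Pos d, ℂ)) : ∫ p, (‖g p‖ : ℂ) ^ 2 =
    ((‖(g.toLp 2 : Lp ℂ 2 (volume : Measure (Pos d)))‖ ^ 2 : ℝ) : ℂ) := by
  have := inner_self_eq_norm_sq_to_K (𝕜 := ℂ) (g.toLp 2 : Lp ℂ 2 (volume : Measure (Pos d)))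
  rw [inner_toLp] at this
  simp only [Complex.mul_conj'] at this
  rw [this]
  norm_cast

theorem lintegral_enorm_sq_of_integral {α H : Type} [MeasurableSpace α] {μ : Measure α}
    [NormedAddCommGroup H] {f : α → ℂ} {g : H} (hf : Integrable (fun z => (‖f z‖ : ℂ) ^ 2) μ)
    (h : ∫ z, (‖f z‖ : ℂ) ^ 2 ∂μ = ((‖g‖ ^ 2 : ℝ) : ℂ)) :
    ∫⁻ z, ‖f z‖ₑ ^ 2 ∂μ = ‖g‖ₑ ^ 2 := by
  have hint : Integrable (fun z => ‖f z‖ ^ 2) μ :=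
    hf.re.congr (Filter.Eventually.of_forall fun z => by norm_cast)
  have h4 : ∫ z, ‖f z‖ ^ 2 ∂μ = ‖g‖ ^ 2 := by
    have h5 : ((∫ z, ‖f z‖ ^ 2 ∂μ : ℝ) : ℂ) = ((‖g‖ ^ 2 : ℝ) : ℂ) := by
      rw [← h, ← integral_complex_ofReal]
      push_cast
      rfl
    exact_mod_cast h5
  simp only [← ofReal_norm, ← ENNReal.ofReal_pow (norm_nonneg _)]
  rw [← ofReal_integral_eq_lintegral_ofReal hint (Filter.Eventually.of_forall fun z => by positivity),
    h4]

theorem kernelTest_window_mul (g : 𝓢(Pos d, ℂ)) (z : Phase d) :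
    kernelTest d (tensor (window d) (conjS g)) z *
      kernelTest d (tensor (negS g) (negS (window d))) z =
      (‖(inner ℂ (cohL z) (g.toLp 2) : ℂ)‖ : ℂ) ^ 2 := by
  rw [kernelTest_window, kernelTest_negS_window, Complex.conj_mul']

theorem lintegral_enorm_inner_cohL_schwartz (g : 𝓢(Pos d, ℂ)) :
    ∫⁻ z : Phase d, ‖inner ℂ (cohL z) (g.toLp 2)‖ₑ ^ 2 =
      ‖(g.toLp 2 : Lp ℂ 2 (volume : Measure (Pos d)))‖ₑ ^ 2 := by
  refine lintegral_enorm_sq_of_integral ?_ ?_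
  · exact (integrable_mul _ _).congr (Filter.Eventually.of_forall (kernelTest_window_mul g))
  · rw [← integral_norm_sq_eq, ← integral_congr_ae
      (Filter.Eventually.of_forall (kernelTest_window_mul g)), integral_kernelTest_mul_kernelTest]
    simp only [negS_apply, neg_neg, integral_window_mul_window, mul_one, conjS_apply,
      Complex.conj_mul']

/-- On Schwartz functions equality holds by Moyal's identity. Density and Fatou's lemma extend the
inequality, which is all that is needed. -/
theorem lintegral_enorm_inner_cohL_le (g : Lp ℂ 2 (volume : Measure (Pos d))) :
    ∫⁻ z : Phase d, ‖inner ℂ (cohL z) g‖ₑ ^ 2 ≤ ‖g‖ₑ ^ 2 := by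
  have hd : g ∈ closure (Set.range (toLpCLM ℝ ℂ 2 (volume : Measure (Pos d)))) :=
    denseRange_toLpCLM (by norm_num) g
  obtain ⟨x, hx, hlim⟩ := mem_closure_iff_seq_limit.1 hd
  choose φ hφ using hx
  have h1 : ∀ n, ∫⁻ z : Phase d, ‖inner ℂ (cohL z) (x n)‖ₑ ^ 2 = ‖x n‖ₑ ^ 2 := fun n => by
    rw [← hφ n]
    exact lintegral_enorm_inner_cohL_schwartz (φ n)
  have h2 : ∀ z : Phase d, Filter.Tendsto (fun n => ‖inner ℂ (cohL z) (x n)‖ₑ ^ 2) Filter.atTop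
      (nhds (‖inner ℂ (cohL z) g‖ₑ ^ 2)) := fun z =>
    ENNReal.Tendsto.pow ((continuous_enorm.tendsto _).comp
      (((continuous_const.inner continuous_id).tendsto g).comp hlim))
  have h3 : Filter.Tendsto (fun n => ‖x n‖ₑ ^ 2) Filter.atTop (nhds (‖g‖ₑ ^ 2)) :=
    ENNReal.Tendsto.pow ((continuous_enorm.tendsto _).comp hlim)
  calc ∫⁻ z : Phase d, ‖inner ℂ (cohL z) g‖ₑ ^ 2
      = ∫⁻ z : Phase d, Filter.liminf (fun n => ‖inner ℂ (cohL z) (x n)‖ₑ ^ 2) Filter.atTop :=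
        lintegral_congr fun z => (h2 z).liminf_eq.symm
    _ ≤ Filter.liminf (fun n => ∫⁻ z : Phase d, ‖inner ℂ (cohL z) (x n)‖ₑ ^ 2) Filter.atTop :=
        lintegral_liminf_le fun n =>
          ((continuous_cohL.inner continuous_const).enorm.measurable).pow_const 2
    _ = ‖g‖ₑ ^ 2 := by simp only [h1]; exact h3.liminf_eq

/-- Translated coherent states form a Bessel family. -/
theorem isBesselFamily_cohL {s : Phase d × Phase d → Phase d} (hs : Continuous s) :
    IsBesselFamily volume fun q : Phase d × (Phase d × Phase d) => cohL (q.1 - s q.2) where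
  stronglyMeasurable := (continuous_cohL.comp
    (continuous_fst.sub (hs.comp continuous_snd))).stronglyMeasurable
  norm_le_one q := by rw [← ofReal_norm, norm_cohL]; simp
  lintegral_le ω g := by
    rw [lintegral_sub_right_eq_self (fun z => ‖inner ℂ (cohL z) g‖ₑ ^ 2) (s ω)]
    exact lintegral_enorm_inner_cohL_le g

/-- The matrix coefficients of coherent states. -/
theorem kernelTest_coh (a b v : Phase d) :
    kernelTest d (tensor (coh a) (conjS (coh b))) v =
      ch (symp v a / 2 + symp (v + a) b / 2) * ambiguity d (v + a - b) := by
  rw [kernelTest_tensor_apply]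
  simp only [schrodinger_coh, conjS_apply, mul_assoc]
  rw [integral_const_mul, integral_coh_mul_conj_coh, ch_add, mul_assoc]

/-- The overlap of ρ(v)γ_a with γ_b is a Gaussian centred at b - a with frequency (a + b)/2. Solving
b - a = w and (a + b)/2 = y gives the two coherent states. -/
theorem ch_mul_ambiguity (v w y : Phase d) :
    ch (symp v y) * ambiguity d (v - w) = ch (symp w y / 2) *
      kernelTest d (tensor (coh (y - (1 / 2 : ℝ) • w)) (conjS (coh (y + (1 / 2 : ℝ) • w)))) v := by
  rw [kernelTest_coh, ← mul_assoc, ← ch_add,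
    show v + (y - (1 / 2 : ℝ) • w) - (y + (1 / 2 : ℝ) • w) = v - w by module]
  congr 2
  simp only [symp_add_left, symp_add_right, symp_sub_left, symp_sub_right, symp_smul_left,
    symp_smul_right, symp_self, symp_swap y w]
  ring

/-- Once the modulated Gaussian is a matrix coefficient, Moyal's identity factors the integral. The
reflections in that identity become the sign change y ↦ -y. -/
theorem integral_ambiguity_mul_kernelTest (ψ φ : 𝓢(Pos d, ℂ)) (w y : Phase d) :
    ∫ v, ch (symp v y) * ambiguity d (v - w) * kernelTest d (tensor ψ φ) v =
      ch (symp w y / 2) * (inner ℂ (cohL (-y - (1 / 2 : ℝ) • w)) (ψ.toLp 2) *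
        inner ℂ ((conjS φ).toLp 2) (cohL (-y + (1 / 2 : ℝ) • w))) := by
  simp only [ch_mul_ambiguity, mul_assoc]
  rw [integral_const_mul, integral_kernelTest_mul_kernelTest]
  congr 2
  · rw [cohL, inner_toLp, ← integral_neg_eq_self]
    congr 1; ext p
    rw [conjS_apply, ← coh_neg, neg_neg, mul_comm, neg_add']
  · rw [cohL, inner_toLp, ← integral_neg_eq_self]
    congr 1; ext p
    rw [conjS_apply, Complex.conj_conj, ← coh_neg, neg_neg]
    congr 3
    module

end CoherentStatesL2

/-! ### Integration of Schwartz functions over one variable. -/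

section IntegralFst

variable {Y : Type} [NormedAddCommGroup Y] [InnerProductSpace ℝ Y] [FiniteDimensional ℝ Y]
  [MeasurableSpace Y] [BorelSpace Y]

/-- The Schwartz function `y ↦ ∫ Φ(x, y) dx`. -/
def integralFst (Φ : 𝓢(Y × Y, ℂ)) : 𝓢(Y, ℂ) :=
  slice (compCLMOfContinuousLinearEquiv ℂ (ContinuousLinearEquiv.prodComm ℝ Y Y)
    (partialFourier (compCLMOfContinuousLinearEquiv ℂ (ContinuousLinearEquiv.prodComm ℝ Y Y) Φ))) 0

theorem integralFst_apply (Φ : 𝓢(Y × Y, ℂ)) (y : Y) : integralFst Φ y = ∫ x, Φ (x, y) := by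
  have h : integralFst Φ y = ∫ s : Y, 𝐞 (-⟪s, (0 : Y)⟫) • Φ (s, y) := rfl
  rw [h]
  simp

theorem integrable_mul_of_norm_le_one {α : Type} [MeasurableSpace α] [TopologicalSpace α]
    [OpensMeasurableSpace α] [SecondCountableTopology α] {μ : Measure α} {f c : α → ℂ}
    (hf : Integrable f μ) (hc : Continuous c) (h : ∀ x, ‖c x‖ ≤ 1) :
    Integrable (fun x => f x * c x) μ :=
  hf.mono (hf.1.mul hc.aestronglyMeasurable) (Filter.Eventually.of_forall fun x => by
    rw [norm_mul]
    exact mul_le_of_le_one_right (norm_nonneg _) (h x))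

end IntegralFst

/-! ### The cutoff as a superposition of modulated Gaussians. -/

section Cutoff

variable {d : ℕ}

instance : (volume : Measure (Phase d)).IsNegInvariant :=
  Measure.IsAddHaarMeasure.isNegInvariant_of_regular volume

/-- A bump function supported in the unit ball. -/
def unitBump (d : ℕ) : ContDiffBump (0 : Phase d) := ⟨1 / 2, 1, by norm_num, by norm_num⟩

/-- The symplectic Fourier transform of `unitBump`. -/
def unitBumpHat (d : ℕ) : 𝓢(Phase d, ℂ) := sympFourierTest d (bump (unitBump d))

theorem sympFourierTest_apply_eq (φ : 𝓢(Phase d, ℂ)) (z : Phase d) :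
    sympFourierTest d φ z = ∫ w, φ w * ch (symp z w) := by
  rw [sympFourierTest_apply]
  congr 1; ext w
  rw [symp_swap z w, mul_comm]
  rfl

theorem bump_unitBump (v : Phase d) :
    bump (unitBump d) v = ∫ y, unitBumpHat d y * ch (symp v y) := by
  rw [← sympFourierTest_apply_eq, unitBumpHat, sympFourierTest_sympFourierTest]

/-- A compactly supported function that is integrated against translations to build cutoffs. -/
def localWindow (d : ℕ) : 𝓢(Phase d, ℂ) := mulS (bump (unitBump d)) (ambiguity d)

theorem localWindow_apply (v : Phase d) :
    localWindow d v = bump (unitBump d) v * ambiguity d v := mulS_apply _ _ _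

theorem integral_localWindow_ne_zero : ∫ v, localWindow d v ≠ 0 := by
  have h1 : ∀ v, localWindow d v =
      ((unitBump d v * Real.exp (-(Real.pi / 2) * ‖v‖ ^ 2) : ℝ) : ℂ) := fun v => by
    rw [localWindow_apply, bump_apply, ambiguity_apply, Complex.ofReal_mul]
  simp only [h1]
  rw [integral_complex_ofReal, Complex.ofReal_ne_zero]
  refine ne_of_gt (Continuous.integral_pos_of_hasCompactSupport_nonneg_nonzero (x := 0) ?_ ?_ ?_ ?_)
  · have := (unitBump d).continuous
    fun_prop
  · exact (unitBump d).hasCompactSupport.mul_right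
  · exact fun v => mul_nonneg (unitBump d).nonneg (Real.exp_pos _).le
  · rw [(unitBump d).one_of_mem_closedBall (by simp [unitBump])]
    simp

theorem localWindow_eq_zero {v : Phase d} (hv : 1 ≤ ‖v‖) : localWindow d v = 0 := by
  rw [localWindow_apply, bump_apply, (unitBump d).zero_of_le_dist (by simpa [unitBump] using hv)]
  simp

theorem hasTemperateGrowth_comp_fst {X Y : Type} [NormedAddCommGroup X] [NormedSpace ℝ X]
    [NormedAddCommGroup Y] [NormedSpace ℝ Y] (ζ : 𝓢(X, ℂ)) :
    (fun p : X × Y => ζ p.1).HasTemperateGrowth :=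
  Function.HasTemperateGrowth.comp ζ.hasTemperateGrowth
    (ContinuousLinearMap.fst ℝ X Y).hasTemperateGrowth

/-- The product of `A` with the cutoff `v ↦ ∫ ζ(w) localWindow(v - w) dw`. -/
def cutoffMul (ζ A : 𝓢(Phase d, ℂ)) : 𝓢(Phase d, ℂ) :=
  integralFst (smulLeftCLM ℂ (fun p : Phase d × Phase d => ζ p.1) (localize (localWindow d) A))

theorem cutoffMul_apply (ζ A : 𝓢(Phase d, ℂ)) (v : Phase d) :
    cutoffMul ζ A v = ∫ w, ζ w * (localWindow d (v - w) * A v) := by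
  rw [cutoffMul, integralFst_apply]
  congr 1; ext w
  rw [smulLeftCLM_apply_apply (hasTemperateGrowth_comp_fst ζ)]
  rfl

/-- A bump function equal to one on the ball of radius `R + 2`. -/
def ballBump (z₀ : Phase d) {R : ℝ} (hR : 1 ≤ R) : ContDiffBump z₀ :=
  ⟨R + 2, R + 3, by linarith, by linarith⟩

/-- The local window lives in the unit ball, so for |v - z₀| < R + 1 the convolution only sees
points within R + 2 of z₀, where the large bump equals 1. -/
theorem cutoffMul_eq_of_mem_ball (z₀ : Phase d) {R : ℝ} (hR : 1 ≤ R) (A : 𝓢(Phase d, ℂ))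
    {v : Phase d} (hv : v ∈ Metric.ball z₀ (R + 1)) :
    cutoffMul (bump (ballBump z₀ hR)) A v = (∫ w, localWindow d w) * A v := by
  rw [cutoffMul_apply, ← integral_sub_left_eq_self (fun w => localWindow d w) _ v,
    ← integral_mul_const]
  congr 1; ext w
  by_cases hw : 1 ≤ ‖v - w‖
  · simp [localWindow_eq_zero hw]
  · rw [bump_apply, (ballBump z₀ hR).one_of_mem_closedBall, Complex.ofReal_one, one_mul]
    have h1 : dist w z₀ ≤ dist v w + dist v z₀ := dist_triangle_left w z₀ v
    rw [dist_eq_norm v w] at h1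
    rw [Metric.mem_ball] at hv
    rw [Metric.mem_closedBall]
    change dist w z₀ ≤ R + 2
    linarith [not_le.1 hw]

theorem apply_eq_apply_cutoffMul {u : 𝓢'(Phase d, ℂ)} {z₀ : Phase d} {R : ℝ} (hR : 1 ≤ R)
    (hu : Distribution.dsupport u ⊆ Metric.closedBall z₀ R) (A : 𝓢(Phase d, ℂ)) :
    u A = (∫ w, localWindow d w)⁻¹ * u (cutoffMul (bump (ballBump z₀ hR)) A) := by
  have h1 := apply_eq_zero_of_disjoint_dsupport u
    (A - (∫ w, localWindow d w)⁻¹ • cutoffMul (bump (ballBump z₀ hR)) A) (by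
      -- The difference vanishes on the open ball of radius R + 1. The margin of 1 keeps its closed
      -- support away from the closed ball of radius R.
      have h2 : tsupport (A - (∫ w, localWindow d w)⁻¹ • cutoffMul (bump (ballBump z₀ hR)) A :
          𝓢(Phase d, ℂ)) ⊆ (Metric.ball z₀ (R + 1))ᶜ := by
        refine closure_minimal (fun v hv hvb => hv ?_) Metric.isOpen_ball.isClosed_compl
        rw [sub_apply, smul_apply, cutoffMul_eq_of_mem_ball z₀ hR A hvb, smul_eq_mul, ← mul_assoc,
          inv_mul_cancel₀ integral_localWindow_ne_zero, one_mul, sub_self]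
      refine Set.disjoint_of_subset h2 hu (Set.disjoint_left.2 fun v hv hv' => hv ?_)
      rw [Metric.mem_ball]
      linarith [Metric.mem_closedBall.1 hv'])
  have h3 : u (A - (∫ w, localWindow d w)⁻¹ • cutoffMul (bump (ballBump z₀ hR)) A) =
      u A - (∫ w, localWindow d w)⁻¹ * u (cutoffMul (bump (ballBump z₀ hR)) A) := by
    have := (u : 𝓢(Phase d, ℂ) →L[ℂ] ℂ).map_sub A
      ((∫ w, localWindow d w)⁻¹ • cutoffMul (bump (ballBump z₀ hR)) A)
    rw [(u : 𝓢(Phase d, ℂ) →L[ℂ] ℂ).map_smul] at this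
    exact this
  rw [h3, sub_eq_zero] at h1
  exact h1

/-- The weight `(w, y) ↦ ζ(w) κ(y) e^{-2πiσ(w, y)}`, where `κ` is `unitBumpHat`. -/
def weight (ζ : 𝓢(Phase d, ℂ)) (ω : Phase d × Phase d) : ℂ :=
  ζ ω.1 * unitBumpHat d ω.2 * ch (-symp ω.1 ω.2)

theorem continuous_symp_comp {α : Type} [TopologicalSpace α] {f g : α → Phase d}
    (hf : Continuous f) (hg : Continuous g) : Continuous fun x => symp (f x) (g x) :=
  continuous_symp.comp (hf.prodMk hg)

theorem continuous_weight (ζ : 𝓢(Phase d, ℂ)) : Continuous (weight ζ) :=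
  ((ζ.continuous.comp continuous_fst).mul ((unitBumpHat d).continuous.comp continuous_snd)).mul
    (continuous_ch.comp (continuous_symp_comp continuous_fst continuous_snd).neg)

theorem norm_weight (ζ : 𝓢(Phase d, ℂ)) (ω : Phase d × Phase d) :
    ‖weight ζ ω‖ = ‖ζ ω.1‖ * ‖unitBumpHat d ω.2‖ := by
  rw [weight, norm_mul, norm_mul, norm_ch, mul_one]

theorem integrable_weight (ζ : 𝓢(Phase d, ℂ)) : Integrable (weight ζ) :=
  integrable_mul_of_norm_le_one (ζ.integrable.mul_prod (unitBumpHat d).integrable)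
    (continuous_ch.comp (continuous_symp_comp continuous_fst continuous_snd).neg)
    fun _ => (norm_ch _).le

/-- The compactly supported factor of the local window is replaced by its symplectic Fourier
integral, leaving only modulated translates of the Gaussian with integrable weight. -/
theorem integral_weight (ζ : 𝓢(Phase d, ℂ)) (v : Phase d) :
    ∫ w, ζ w * localWindow d (v - w) =
      ∫ ω, weight ζ ω * (ch (symp v ω.2) * ambiguity d (v - ω.1)) := by
  have hi : Integrable (fun ω => weight ζ ω * (ch (symp v ω.2) * ambiguity d (v - ω.1))) := by
    refine integrable_mul_of_norm_le_one (integrable_weight ζ) ?_ fun ω => ?_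
    · exact (continuous_ch.comp (continuous_symp_comp continuous_const continuous_snd)).mul
        ((ambiguity d).continuous.comp (continuous_const.sub continuous_fst))
    · rw [norm_mul, norm_ch, one_mul]
      exact norm_ambiguity_le _
  rw [Measure.volume_eq_prod, integral_prod _ hi]
  congr 1; ext w
  rw [localWindow_apply, bump_unitBump, mul_comm (∫ y, _), ← mul_assoc, ← integral_const_mul]
  congr 1; ext y
  rw [weight, symp_sub_left, sub_eq_add_neg (symp v y), ch_add]
  ring

/-- The variable z enters as a shift of the frequency y to y - z, so after Moyal's identity it
translates both coherent states by z. This makes the result a superposition of matrix elements of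
rank-one operators. -/
theorem sympFourierTest_cutoffMul_kernelTest (ζ : 𝓢(Phase d, ℂ)) (ψ φ : 𝓢(Pos d, ℂ))
    (z : Phase d) : sympFourierTest d (cutoffMul ζ (kernelTest d (tensor ψ φ))) z =
      ∫ ω, weight ζ ω * ch (symp ω.1 (ω.2 - z) / 2) *
        (inner ℂ (cohL (z - (ω.2 + (1 / 2 : ℝ) • ω.1))) (ψ.toLp 2) *
          inner ℂ ((conjS φ).toLp 2) (cohL (z - (ω.2 - (1 / 2 : ℝ) • ω.1)))) := by
  set A := kernelTest d (tensor ψ φ) with hA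
  have hi : Integrable (fun p : Phase d × (Phase d × Phase d) =>
      A p.1 * weight ζ p.2 * (ch (symp p.1 (p.2.2 - z)) * ambiguity d (p.1 - p.2.1)))
      (volume.prod volume) := by
    refine integrable_mul_of_norm_le_one (A.integrable.mul_prod (integrable_weight ζ)) ?_
      fun p => ?_
    · exact (continuous_ch.comp (continuous_symp_comp continuous_fst
        ((continuous_snd.comp continuous_snd).sub continuous_const))).mul
        ((ambiguity d).continuous.comp (continuous_fst.sub (continuous_fst.comp continuous_snd)))
    · rw [norm_mul, norm_ch, one_mul]
      exact norm_ambiguity_le _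
  have h1 : ∀ v, cutoffMul ζ A v * ch (symp z v) =
      ∫ ω, A v * weight ζ ω * (ch (symp v (ω.2 - z)) * ambiguity d (v - ω.1)) := fun v => by
    rw [cutoffMul_apply]
    simp only [← mul_assoc]
    rw [integral_mul_const, integral_weight, mul_assoc, ← integral_mul_const]
    congr 1; ext ω
    rw [symp_sub_right, symp_swap z v, sub_eq_add_neg (symp v ω.2), ch_add]
    ring
  rw [sympFourierTest_apply_eq]
  simp only [h1]
  rw [integral_integral_swap hi]
  congr 1; ext ω
  have h2 := integral_ambiguity_mul_kernelTest ψ φ ω.1 (ω.2 - z)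
  rw [show -(ω.2 - z) - (1 / 2 : ℝ) • ω.1 = z - (ω.2 + (1 / 2 : ℝ) • ω.1) by abel,
    show -(ω.2 - z) + (1 / 2 : ℝ) • ω.1 = z - (ω.2 - (1 / 2 : ℝ) • ω.1) by abel] at h2
  rw [mul_assoc, ← h2, ← integral_const_mul]
  congr 1; ext v
  ring

end Cutoff

/-! ### The two representation formulas and the resulting estimates. -/

section CoherentExpansion

set_option synthInstance.maxSize 1000

variable {d : ℕ}

/-- The shear `(x, v) ↦ (x, v - L x)`. -/
def shearSub {X Y : Type} [NormedAddCommGroup X] [NormedSpace ℝ X] [NormedAddCommGroup Y]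
    [NormedSpace ℝ Y] (L : X →L[ℝ] Y) : (X × Y) ≃L[ℝ] X × Y :=
  ContinuousLinearEquiv.equivOfInverse
    ((ContinuousLinearMap.fst ℝ X Y).prod
      (ContinuousLinearMap.snd ℝ X Y - L ∘L ContinuousLinearMap.fst ℝ X Y))
    ((ContinuousLinearMap.fst ℝ X Y).prod
      (ContinuousLinearMap.snd ℝ X Y + L ∘L ContinuousLinearMap.fst ℝ X Y))
    (fun p => by simp) (fun p => by simp)

/-- The shear `((z, w, y), v) ↦ ((z, w, y), v - w)`. -/
def subWindow (d : ℕ) : ((Phase d × (Phase d × Phase d)) × Phase d) ≃L[ℝ]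
    (Phase d × (Phase d × Phase d)) × Phase d :=
  shearSub (ContinuousLinearMap.fst ℝ (Phase d) (Phase d) ∘L
    ContinuousLinearMap.snd ℝ (Phase d) (Phase d × Phase d))

/-- The real phase `-σ(w, y) + σ(v, y + z)`. -/
def expansionPhase (p : (Phase d × (Phase d × Phase d)) × Phase d) : ℝ :=
  -symp p.1.2.1 p.1.2.2 + symp p.2 (p.1.2.2 + p.1.1)

theorem hasTemperateGrowth_symp {E : Type} [NormedAddCommGroup E] [NormedSpace ℝ E]
    (f g : E →L[ℝ] Phase d) : (fun x => symp (f x) (g x)).HasTemperateGrowth := by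
  simp only [← inner_sympJ]
  exact (innerSL ℝ).bilinear_hasTemperateGrowth f.hasTemperateGrowth
    ((sympJ d : Phase d →L[ℝ] Phase d) ∘L g).hasTemperateGrowth

theorem hasTemperateGrowth_expansionPhase :
    (expansionPhase : (Phase d × (Phase d × Phase d)) × Phase d → ℝ).HasTemperateGrowth := by
  let P := Phase d
  let z : ((P × (P × P)) × P) →L[ℝ] P := .fst ℝ P (P × P) ∘L .fst ℝ (P × (P × P)) P
  let w : ((P × (P × P)) × P) →L[ℝ] P :=
    .fst ℝ P P ∘L .snd ℝ P (P × P) ∘L .fst ℝ (P × (P × P)) P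
  let y : ((P × (P × P)) × P) →L[ℝ] P :=
    .snd ℝ P P ∘L .snd ℝ P (P × P) ∘L .fst ℝ (P × (P × P)) P
  let v : ((P × (P × P)) × P) →L[ℝ] P := .snd ℝ (P × (P × P)) P
  exact (hasTemperateGrowth_symp w y).neg.add (hasTemperateGrowth_symp v (y + z))

/-- The Schwartz function
`((z, w, y), v) ↦ θ(z) ζ(w) κ(y) e^{2πi(-σ(w, y) + σ(v, y + z))} e^{-π|v - w|²/2}`. -/
def expansion (ζ θ : 𝓢(Phase d, ℂ)) : 𝓢((Phase d × (Phase d × Phase d)) × Phase d, ℂ) :=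
  smulLeftCLM ℂ (fun p => ch (expansionPhase p))
    (compCLMOfContinuousLinearEquiv ℂ (subWindow d)
      (tensor (ambiguity d) (tensor (tensor (unitBumpHat d) ζ) θ)))

theorem expansion_apply (ζ θ : 𝓢(Phase d, ℂ)) (z w y v : Phase d) :
    expansion ζ θ ((z, w, y), v) = θ z * (weight ζ (w, y) * (ch (symp v (y + z)) *
      ambiguity d (v - w))) := by
  rw [expansion, smulLeftCLM_apply_apply (hasTemperateGrowth_ch hasTemperateGrowth_expansionPhase)]
  have h : compCLMOfContinuousLinearEquiv ℂ (subWindow d)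
      (tensor (ambiguity d) (tensor (tensor (unitBumpHat d) ζ) θ)) ((z, w, y), v) =
      θ z * (ζ w * unitBumpHat d y) * ambiguity d (v - w) := rfl
  have h2 : expansionPhase ((z, w, y), v) = -symp w y + symp v (y + z) := rfl
  rw [h, h2, ch_add, weight, smul_eq_mul]
  ring

/-- Including θ(z) makes the integrand Schwartz in all variables jointly, as required for applying
`u` under the integral. -/
theorem cutoffMul_sympFourierTest (ζ θ : 𝓢(Phase d, ℂ)) (v : Phase d) :
    cutoffMul ζ (sympFourierTest d θ) v =
      ∫ q : Phase d × (Phase d × Phase d), expansion ζ θ (q, v) := by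
  rw [cutoffMul_apply]
  simp only [← mul_assoc]
  rw [integral_mul_const, integral_weight, sympFourierTest_apply_eq, mul_comm,
    Measure.volume_eq_prod (Phase d) (Phase d × Phase d), ← integral_prod_mul]
  congr 1; ext q
  obtain ⟨z, w, y⟩ := q
  rw [expansion_apply, symp_add_right, ch_add]
  ring

theorem slice_expansion (ζ θ : 𝓢(Phase d, ℂ)) (z : Phase d) (ω : Phase d × Phase d) :
    slice (expansion ζ θ) (z, ω) = (θ z * (weight ζ ω * ch (symp ω.1 (ω.2 + z) / 2))) •
      kernelTest d (tensor (coh (z - ((1 / 2 : ℝ) • ω.1 - ω.2)))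
        (conjS (coh (z - (-(1 / 2 : ℝ) • ω.1 - ω.2))))) := by
  ext v
  obtain ⟨w, y⟩ := ω
  rw [slice_apply, expansion_apply, ch_mul_ambiguity, smul_apply, smul_eq_mul,
    show y + z - (1 / 2 : ℝ) • w = z - ((1 / 2 : ℝ) • w - y) by abel,
    show y + z + (1 / 2 : ℝ) • w = z - (-(1 / 2 : ℝ) • w - y) by module]
  ring

theorem toTemperedDistribution_apply_eq_inner (f : Lp ℂ 2 (volume : Measure (Pos d)))
    (φ : 𝓢(Pos d, ℂ)) :
    Lp.toTemperedDistribution f φ = inner ℂ ((conjS φ).toLp 2) f := by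
  rw [Lp.toTemperedDistribution_apply, L2.inner_def]
  refine integral_congr_ae ?_
  filter_upwards [(conjS φ).coeFn_toLp 2 volume] with t ht
  rw [ht, RCLike.inner_apply, conjS_apply, RingHomCompTriple.comp_apply, smul_eq_mul, mul_comm]
  rfl

theorem weylOp_sympFourier (u : 𝓢'(Phase d, ℂ)) (ψ φ : 𝓢(Pos d, ℂ)) :
    weylOp (sympFourier u) ψ φ = u (kernelTest d (tensor ψ φ)) := by
  rw [weylOp, sympFourier_sympFourier]
  rfl

/-- The weight together with the phases coming from the composition of coherent states. -/
def twistedWeight (ζ : 𝓢(Phase d, ℂ)) (ε : ℝ) (q : Phase d × (Phase d × Phase d)) : ℂ :=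
  (∫ w, localWindow d w)⁻¹ * (weight ζ q.2 * ch (symp q.2.1 (q.2.2 + ε • q.1) / 2))

theorem continuous_twistedWeight (ζ : 𝓢(Phase d, ℂ)) (ε : ℝ) :
    Continuous (twistedWeight ζ ε) :=
  continuous_const.mul (((continuous_weight ζ).comp continuous_snd).mul
    (continuous_ch.comp ((continuous_symp_comp (continuous_fst.comp continuous_snd)
      ((continuous_snd.comp continuous_snd).add (continuous_fst.const_smul ε))).div_const 2)))

/-- The absolute value of `twistedWeight`. -/
def weightBound (ζ : 𝓢(Phase d, ℂ)) (ω : Phase d × Phase d) : ℝ≥0∞ :=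
  ‖(∫ w, localWindow d w)⁻¹‖ₑ * ‖weight ζ ω‖ₑ

theorem enorm_twistedWeight (ζ : 𝓢(Phase d, ℂ)) (ε : ℝ) (q : Phase d × (Phase d × Phase d)) :
    ‖twistedWeight ζ ε q‖ₑ = weightBound ζ q.2 := by
  rw [twistedWeight, weightBound, enorm_mul, enorm_mul, ← ofReal_norm (ch _), norm_ch]
  simp

theorem measurable_weightBound (ζ : 𝓢(Phase d, ℂ)) : Measurable (weightBound ζ) :=
  (continuous_weight ζ).enorm.measurable.const_mul _

theorem lintegral_weightBound_ne_top (ζ : 𝓢(Phase d, ℂ)) : ∫⁻ ω, weightBound ζ ω ≠ ⊤ := by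
  unfold weightBound
  rw [lintegral_const_mul _ (continuous_weight ζ).enorm.measurable]
  exact ENNReal.mul_ne_top enorm_ne_top (integrable_weight ζ).2.ne

theorem weylSchattenNorm_le {u : 𝓢'(Phase d, ℂ)} {z₀ : Phase d} {R : ℝ} (hR : 1 ≤ R)
    (hu : Distribution.dsupport u ⊆ Metric.closedBall z₀ R) (p : ℝ≥0∞) [hp : Fact (1 ≤ p)]
    (f : Lp ℂ p (volume : Measure (Phase d))) (hf : Lp.toTemperedDistribution f = sympFourier u) :
    weylSchattenNorm p (sympFourier u) ≤
      (∫⁻ ω, weightBound (bump (ballBump z₀ hR)) ω) * ‖f‖ₑ := by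
  set ζ := bump (ballBump z₀ hR)
  have hs1 : Continuous fun ω : Phase d × Phase d => ω.2 + (1 / 2 : ℝ) • ω.1 :=
    by fun_prop
  have hs2 : Continuous fun ω : Phase d × Phase d => ω.2 - (1 / 2 : ℝ) • ω.1 :=
    by fun_prop
  obtain ⟨T, hT, hTle⟩ := exists_dyadOperator (μ := volume) (ν := volume)
    (isBesselFamily_cohL hs1) (isBesselFamily_cohL hs2) (measurable_weightBound ζ)
    (continuous_twistedWeight ζ (-1)).stronglyMeasurable
    (fun q => (enorm_twistedWeight ζ (-1) q).le) (lintegral_weightBound_ne_top ζ) hp.out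
    (Lp.stronglyMeasurable f) (Lp.eLpNorm_ne_top f)
  refine (iInf₂_le T fun ψ => ?_).trans (hTle.trans_eq (by rw [Lp.enorm_def]))
  ext φ
  rw [weylOp_sympFourier, toTemperedDistribution_apply_eq_inner, hT,
    apply_eq_apply_cutoffMul hR hu]
  -- Since F_σ is an involution, `u` is recovered by pairing `f` with the symplectic Fourier
  -- transform of the test function.
  have h1 : u (cutoffMul ζ (kernelTest d (tensor ψ φ))) =
      Lp.toTemperedDistribution f (sympFourierTest d (cutoffMul ζ (kernelTest d (tensor ψ φ)))) := by
    rw [hf, ← congrFun (congrArg DFunLike.coe (sympFourier_sympFourier u))]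
    rfl
  rw [h1, Lp.toTemperedDistribution_apply, ← integral_const_mul]
  congr 1; ext z
  rw [sympFourierTest_cutoffMul_kernelTest, smul_eq_mul, mul_comm _ (f z), mul_left_comm,
    ← integral_const_mul]
  congr 2; ext ω
  rw [twistedWeight, neg_one_smul, ← sub_eq_add_neg]
  ring

theorem sympFourier_apply_eq {u : 𝓢'(Phase d, ℂ)} {z₀ : Phase d} {R : ℝ} (hR : 1 ≤ R)
    (hu : Distribution.dsupport u ⊆ Metric.closedBall z₀ R)
    {T : Lp ℂ 2 (volume : Measure (Pos d)) →L[ℂ] Lp ℂ 2 (volume : Measure (Pos d))}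
    (hT : ∀ ψ : 𝓢(Pos d, ℂ), weylOp (sympFourier u) ψ =
      Lp.toTemperedDistribution (T (ψ.toLp 2))) (θ : 𝓢(Phase d, ℂ)) :
    sympFourier u θ = ∫ z, θ z * ∫ ω : Phase d × Phase d,
      twistedWeight (bump (ballBump z₀ hR)) 1 (z, ω) *
        inner ℂ (cohL (z - (-(1 / 2 : ℝ) • ω.1 - ω.2))) (T (cohL (z - ((1 / 2 : ℝ) • ω.1 - ω.2)))) := by
  set ζ := bump (ballBump z₀ hR)
  set I : Phase d × (Phase d × Phase d) → ℂ := fun q =>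
    inner ℂ (cohL (q.1 - (-(1 / 2 : ℝ) • q.2.1 - q.2.2)))
      (T (cohL (q.1 - ((1 / 2 : ℝ) • q.2.1 - q.2.2)))) with hI
  have hIc : Continuous I := by
    have h1 : Continuous fun q : Phase d × (Phase d × Phase d) =>
        q.1 - (-(1 / 2 : ℝ) • q.2.1 - q.2.2) := by fun_prop
    have h2 : Continuous fun q : Phase d × (Phase d × Phase d) =>
        q.1 - ((1 / 2 : ℝ) • q.2.1 - q.2.2) := by fun_prop
    exact (continuous_cohL.comp h1).inner (T.continuous.comp (continuous_cohL.comp h2))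
  have hIb : ∀ q, ‖I q‖ ≤ ‖T‖ := fun q => by
    refine (norm_inner_le_norm _ _).trans ?_
    rw [norm_cohL, one_mul]
    refine (T.le_opNorm _).trans_eq ?_
    rw [norm_cohL, mul_one]
  -- Each slice of the expansion is a multiple of a matrix coefficient of two coherent states, on
  -- which `u` is by hypothesis a matrix element of `T`.
  have hu1 : ∀ q : Phase d × (Phase d × Phase d), (∫ w, localWindow d w)⁻¹ *
      u (slice (expansion ζ θ) q) = θ q.1 * (twistedWeight ζ 1 q * I q) := fun q => by
    obtain ⟨z, ω⟩ := q
    have h1 := (u : 𝓢(Phase d, ℂ) →L[ℂ] ℂ).map_smul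
      (θ z * (weight ζ ω * ch (symp ω.1 (ω.2 + z) / 2)))
      (kernelTest d (tensor (coh (z - ((1 / 2 : ℝ) • ω.1 - ω.2)))
        (conjS (coh (z - (-(1 / 2 : ℝ) • ω.1 - ω.2))))))
    rw [← slice_expansion] at h1
    have h2 : u (kernelTest d (tensor (coh (z - ((1 / 2 : ℝ) • ω.1 - ω.2)))
        (conjS (coh (z - (-(1 / 2 : ℝ) • ω.1 - ω.2)))))) = I (z, ω) := by
      rw [← weylOp_sympFourier, hT, toTemperedDistribution_apply_eq_inner, conjS_conjS]
      rfl
    refine (congrArg _ h1).trans ?_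
    rw [smul_eq_mul]
    refine (congrArg (fun t => _ * (_ * t)) h2).trans ?_
    rw [twistedWeight, one_smul]
    ring
  have hint : Integrable (fun q : Phase d × (Phase d × Phase d) =>
      θ q.1 * (twistedWeight ζ 1 q * I q)) (volume.prod volume) := by
    have h1 : Integrable (fun q : Phase d × (Phase d × Phase d) => θ q.1 * weight ζ q.2)
        (volume.prod volume) := θ.integrable.mul_prod (integrable_weight ζ)
    have hc : Continuous fun q : Phase d × (Phase d × Phase d) =>
        θ q.1 * (twistedWeight ζ 1 q * I q) :=
      (θ.continuous.comp continuous_fst).mul ((continuous_twistedWeight ζ 1).mul hIc)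
    refine (h1.norm.const_mul (‖(∫ w, localWindow d w)⁻¹‖ * ‖T‖)).mono' hc.aestronglyMeasurable
      (Filter.Eventually.of_forall fun q => ?_)
    rw [norm_mul, norm_mul, twistedWeight, norm_mul, norm_mul, norm_ch, mul_one, norm_mul]
    calc _ ≤ ‖θ q.1‖ * (‖(∫ w, localWindow d w)⁻¹‖ * ‖weight ζ q.2‖ * ‖T‖) := by
          gcongr
          exact hIb q
      _ = _ := by ring
  have h3 := integral_apply_slice (μ := volume) (u : 𝓢(Phase d, ℂ) →L[ℂ] ℂ) (expansion ζ θ) _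
    (cutoffMul_sympFourierTest ζ θ)
  have h4 : sympFourier u θ = (∫ w, localWindow d w)⁻¹ * u (cutoffMul ζ (sympFourierTest d θ)) :=
    apply_eq_apply_cutoffMul hR hu _
  rw [h4]
  refine (congrArg _ h3).trans ?_
  rw [← integral_const_mul]
  refine (integral_congr_ae (Filter.Eventually.of_forall hu1)).trans ?_
  rw [Measure.volume_eq_prod, integral_prod _ hint]
  congr 1; ext z
  rw [← integral_const_mul]

theorem distLpNorm_le {u : 𝓢'(Phase d, ℂ)} {z₀ : Phase d} {R : ℝ} (hR : 1 ≤ R)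
    (hu : Distribution.dsupport u ⊆ Metric.closedBall z₀ R) (p : ℝ≥0∞) [hp : Fact (1 ≤ p)]
    {T : Lp ℂ 2 (volume : Measure (Pos d)) →L[ℂ] Lp ℂ 2 (volume : Measure (Pos d))}
    (hT : ∀ ψ : 𝓢(Pos d, ℂ), weylOp (sympFourier u) ψ =
      Lp.toTemperedDistribution (T (ψ.toLp 2))) (hTp : schattenNorm p T ≠ ⊤) :
    distLpNorm p (sympFourier u) ≤
      (∫⁻ ω, weightBound (bump (ballBump z₀ hR)) ω) * schattenNorm p T := by
  set ζ := bump (ballBump z₀ hR) with hζ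
  have hs1 : Continuous fun ω : Phase d × Phase d => (1 / 2 : ℝ) • ω.1 - ω.2 := by fun_prop
  have hs2 : Continuous fun ω : Phase d × Phase d => -(1 / 2 : ℝ) • ω.1 - ω.2 := by fun_prop
  have hle := eLpNorm_integral_inner_le (μ := volume) (ν := volume) (M := twistedWeight ζ 1)
    (isBesselFamily_cohL hs1) (isBesselFamily_cohL hs2) (measurable_weightBound ζ)
    (fun q => (enorm_twistedWeight ζ 1 q).le) hp.out hTp
  set f : Phase d → ℂ := fun z => ∫ ω : Phase d × Phase d, twistedWeight ζ 1 (z, ω) *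
    inner ℂ (cohL (z - (-(1 / 2 : ℝ) • ω.1 - ω.2))) (T (cohL (z - ((1 / 2 : ℝ) • ω.1 - ω.2))))
    with hf
  have hfm : StronglyMeasurable f := by
    refine StronglyMeasurable.integral_prod_right (f := fun z ω => twistedWeight ζ 1 (z, ω) *
      inner ℂ (cohL (z - (-(1 / 2 : ℝ) • ω.1 - ω.2))) (T (cohL (z - ((1 / 2 : ℝ) • ω.1 - ω.2))))) ?_
    exact (continuous_twistedWeight ζ 1).stronglyMeasurable.mul
      ((isBesselFamily_cohL hs2).stronglyMeasurable.inner
        (T.continuous.comp_stronglyMeasurable (isBesselFamily_cohL hs1).stronglyMeasurable))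
  have hfp : MemLp f p := ⟨hfm.aestronglyMeasurable,
    hle.trans_lt (ENNReal.mul_lt_top (lintegral_weightBound_ne_top ζ).lt_top hTp.lt_top)⟩
  refine (iInf₂_le hfp.toLp ?_).trans ?_
  · ext θ
    rw [sympFourier_apply_eq hR hu hT, Lp.toTemperedDistribution_apply]
    refine integral_congr_ae ?_
    filter_upwards [hfp.coeFn_toLp] with z hz
    rw [hz, smul_eq_mul]
  · rw [Lp.enorm_def, eLpNorm_congr_ae hfp.coeFn_toLp]
    exact hle

/-- The growth of the mass of the weight in the radius of the ball. -/
theorem exists_lintegral_weightBound_le (d : ℕ) : ∃ C : ℝ, 0 < C ∧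
    ∀ (z₀ : Phase d) (R : ℝ) (hR : 1 ≤ R),
      ∫⁻ ω, weightBound (bump (ballBump z₀ hR)) ω ≤ ENNReal.ofReal (C * R ^ (5 * d + 2)) := by
  set c := ‖(∫ w, localWindow d w)⁻¹‖ₑ
  set k := ∫⁻ y, ‖unitBumpHat d y‖ₑ
  set b := volume (Metric.ball (0 : Phase d) 1)
  have hk : k ≠ ⊤ := (unitBumpHat d).integrable.2.ne
  have hb : b ≠ ⊤ := measure_ball_lt_top.ne
  have hckb : c * (b * k) ≠ ⊤ := ENNReal.mul_ne_top enorm_ne_top (ENNReal.mul_ne_top hb hk)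
  have hfin : Module.finrank ℝ (Phase d) = 2 * d := by
    rw [(WithLp.linearEquiv 2 ℝ (Pos d × Pos d)).finrank_eq, Module.finrank_prod,
      finrank_euclideanSpace_fin]
    ring
  -- The mass factors into the norm of a fixed function and the integral of the large bump, at most
  -- the volume of a ball of radius R + 3 ≤ 4R in dimension 2d. The summand 1 ensures a positive
  -- constant without showing that the mass is nonzero.
  refine ⟨4 ^ (2 * d) * (c * (b * k)).toReal + 1, by positivity, fun z₀ R hR => ?_⟩
  set ζ := bump (ballBump z₀ hR)
  have hζ : ∫⁻ w, ‖ζ w‖ₑ ≤ ENNReal.ofReal ((R + 3) ^ (2 * d)) * b := by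
    calc ∫⁻ w, ‖ζ w‖ₑ ≤ ∫⁻ w, (Metric.closedBall z₀ (R + 3)).indicator 1 w := by
          refine lintegral_mono fun w => ?_
          by_cases hw : w ∈ Metric.closedBall z₀ (R + 3)
          · rw [Set.indicator_of_mem hw, ← ofReal_norm, bump_apply, Complex.norm_real,
              Real.norm_of_nonneg (ballBump z₀ hR).nonneg]
            exact ENNReal.ofReal_le_one.2 (ballBump z₀ hR).le_one
          · rw [bump_apply, (ballBump z₀ hR).zero_of_le_dist
              (le_of_lt (not_le.1 fun h => hw h))]
            simp
      _ = _ := by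
          rw [lintegral_indicator_one Metric.isClosed_closedBall.measurableSet,
            Measure.addHaar_closedBall _ _ (by linarith), hfin]
  have hw : ∫⁻ ω, weightBound ζ ω = c * ((∫⁻ w, ‖ζ w‖ₑ) * k) := by
    unfold weightBound
    rw [lintegral_const_mul _ (continuous_weight ζ).enorm.measurable]
    congr 1
    have h1 : ∀ ω : Phase d × Phase d, ‖weight ζ ω‖ₑ = ‖ζ ω.1‖ₑ * ‖unitBumpHat d ω.2‖ₑ :=
      fun ω => by rw [← ofReal_norm, norm_weight, ENNReal.ofReal_mul (norm_nonneg _), ofReal_norm,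
        ofReal_norm]
    simp only [h1]
    rw [Measure.volume_eq_prod]
    exact lintegral_prod_mul ζ.continuous.enorm.aemeasurable
      (unitBumpHat d).continuous.enorm.aemeasurable
  rw [hw]
  have hR0 : 0 ≤ R := by linarith
  calc c * ((∫⁻ w, ‖ζ w‖ₑ) * k) ≤ c * ((ENNReal.ofReal ((R + 3) ^ (2 * d)) * b) * k) := by gcongr
    _ = ENNReal.ofReal ((R + 3) ^ (2 * d) * (c * (b * k)).toReal) := by
        rw [ENNReal.ofReal_mul (by positivity), ENNReal.ofReal_toReal hckb]
        ring
    _ ≤ _ := by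
        refine ENNReal.ofReal_le_ofReal ?_
        have h1 : (R + 3) ^ (2 * d) ≤ 4 ^ (2 * d) * R ^ (5 * d + 2) := by
          calc (R + 3) ^ (2 * d) ≤ (4 * R) ^ (2 * d) := by gcongr; linarith
            _ = 4 ^ (2 * d) * R ^ (2 * d) := mul_pow _ _ _
            _ ≤ _ := by
                gcongr
                omega
        calc _ ≤ 4 ^ (2 * d) * R ^ (5 * d + 2) * (c * (b * k)).toReal := by gcongr
          _ ≤ 4 ^ (2 * d) * R ^ (5 * d + 2) * (c * (b * k)).toReal + R ^ (5 * d + 2) :=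
            le_add_of_nonneg_right (by positivity)
          _ = _ := by ring

end CoherentExpansion

end Weyl

end

theorem theorem4p2 (d : ℕ) :
    ∃ C : ℝ, 0 < C ∧
      ∀ (u : 𝓢'(Weyl.Phase d, ℂ)) (z₀ : Weyl.Phase d) (R : ℝ), 1 ≤ R →
        Distribution.dsupport u ⊆ Metric.closedBall z₀ R →
        ∀ (p : ℝ≥0∞) [Fact (1 ≤ p)],
          Weyl.weylSchattenNorm p (Weyl.sympFourier u) ≤
              ENNReal.ofReal (C * R ^ (5 * d + 2)) * Weyl.distLpNorm p (Weyl.sympFourier u) ∧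
          Weyl.distLpNorm p (Weyl.sympFourier u) ≤
              ENNReal.ofReal (C * R ^ (5 * d + 2)) *
                Weyl.weylSchattenNorm p (Weyl.sympFourier u) := by
  obtain ⟨C, hC, h⟩ := Weyl.exists_lintegral_weightBound_le d
  refine ⟨C, hC, fun u z₀ R hR hu p _ => ?_⟩
  -- The norms on the right are infima. A factor that is neither 0 nor ∞ passes through them,
  -- including empty infima of value ∞, so each inequality reduces to a single representing function
  -- or operator.
  have hK0 : ENNReal.ofReal (C * R ^ (5 * d + 2)) ≠ 0 :=
    (ENNReal.ofReal_pos.2 (by positivity)).ne'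
  have hK : ENNReal.ofReal (C * R ^ (5 * d + 2)) ≠ ⊤ := ENNReal.ofReal_ne_top
  constructor
  · rw [Weyl.distLpNorm, ENNReal.mul_iInf_of_ne hK0 hK]
    refine le_iInf fun f => ?_
    rw [ENNReal.mul_iInf_of_ne hK0 hK]
    refine le_iInf fun hf => (Weyl.weylSchattenNorm_le hR hu p f hf).trans ?_
    gcongr
    exact h z₀ R hR
  · rw [Weyl.weylSchattenNorm, ENNReal.mul_iInf_of_ne hK0 hK]
    refine le_iInf fun T => ?_
    rw [ENNReal.mul_iInf_of_ne hK0 hK]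
    refine le_iInf fun hT => ?_
    by_cases hTp : Weyl.schattenNorm p T = ⊤
    · rw [hTp, ENNReal.mul_top hK0]
      exact le_top
    · refine (Weyl.distLpNorm_le hR hu p hT hTp).trans ?_
      gcongr
      exact h z₀ R hR
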